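/- **Setting.** Let $n\ge 1$. For $k\ge 1$ write $(\mathbf x_k,\mathbf x_k')=(x_1,\dots,x_k;x_1',\dots,x_k')\in\mathbb R^{kn}\times\mathbb R^{kn}$. For $\alpha>0$ let $\mathrm H^\alpha_k$ be the space of $\gamma\in L^2(\mathbb R^{kn}\times\mathbb R^{kn})$ that are symmetric, i.e. $\gamma(\mathbf x_k,\mathbf x_k')=\overline{\gamma(\mathbf x_k',\mathbf x_k)}$ and $\gamma(x_1,\dots,x_k;x'_1,\dots,x'_k)=\gamma(x_{\sigma(1)},\dots,x_{\sigma(k)};x'_{\sigma(1)},\dots,x'_{\sigma(k)})$ for all permutations $\sigma$, with finite norm $$\|\gamma\|_{\mathrm H^\alpha_k}=\Big\|\prod_{j=1}^k(1-\Delta_{x_j})^{\alpha/2}(1-\Delta_{x_j'})^{\alpha/2}\gamma\Big\|_{L^2}.$$ For a sequence $a=(a_k)_{k\ge1}$ in $[0,\infty]$ with $\sum_k\lambda^{-k}a_k<\infty$ for some $\lambda>0$ put $N(a)=\frac12\inf\{\lambda>0:\sum_{k\ge1}\lambda^{-k}a_k\le1\}$; all conditions $N(\cdot)\le\dots$ below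 include that such a $\lambda$ exists. * $\mathcal H^\alpha$ is the set of $\Gamma=\{\gamma^{(k)}\}_{k\ge1}$ with $\gamma^{(k)}\in\mathrm H^\alpha_k$ and $\|\Gamma\|_{\mathcal H^\alpha}:=N\big((\|\gamma^{(k)}\|_{\mathrm H^\alpha_k})_k\big)<\infty$. * $C([0,T],\mathcal H^\alpha)$ is the set of $\Gamma(t)=\{\gamma^{(k)}_t\}_{k\ge1}$ with each $\gamma^{(k)}\in C([0,T],\mathrm H^\alpha_k)$ and $\|\Gamma\|_{C([0,T],\mathcal H^\alpha)}:=N\big((\sup_{t\in[0,T]}\|\gamma^{(k)}_t\|_{\mathrm H^\alpha_k})_k\big)<\infty$. This quantity dominates $\sup_{t\in[0,T]}\|\Gamma(t)\|_{\mathcal H^\alpha}$. * $L^1_{t\in[0,T]}\mathcal H^\alpha$ is the set of $\Xi(t)=\{\rho^{(k)}_t\}_{k\ge1}$, with each $\rho^{(k)}$ strongly measurable and $\Xi(t)\in\mathcal H^\alpha$ for a.e. $t$, such that $\|\Xi\|_{L^1_{t\in[0,T]}\mathcal H^\alpha}:=N\big((\int_0^T\|\rho^{(k)}_t\|_{\mathrm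 H^\alpha_k}dt)_k\big)<\infty$. Let $\mu\in\{1,-1\}$, $\triangle^{(k)}_\pm=\sum_{j=1}^k(\Delta_{x_j}-\Delta_{x_j'})$ and $\tilde B^{(k)}=-\mathrm i\mu B^{(k)}$, $B^{(k)}=\sum_{j=1}^k(B^1_{j,k}-B^2_{j,k})$, where $$B^1_{j,k}\gamma^{(k+1)}=\iint\delta(x_{k+1}-x_{k+1}')\,\delta(x_j-x_{k+1})\,\gamma^{(k+1)}\,dx_{k+1}dx_{k+1}'$$ and $B^2_{j,k}$ is the same with $\delta(x_j'-x_{k+1})$ in place of $\delta(x_j-x_{k+1})$. For a curve $\Gamma\in C([0,T],\mathcal H^\alpha)$ we write $\hat B\Gamma=\{\rho^{(k)}\}_{k\ge1}\in L^1_{t\in[0,T]}\mathcal H^\alpha$ if for every $k$ and every $h\in C_c^\infty(\mathbb R^n;\mathbb R)$ with $\int h=1$ the functions obtained from $\tilde B^{(k)}\gamma^{(k+1)}_t$ by replacing each $\delta$ with $h_\varepsilon=\varepsilon^{-n}h(\cdot/\varepsilon)$ converge to $\rho^{(k)}$ in the sense of distributions on $(0,T)\times\mathbb R^{kn}\times\mathbb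 R^{kn}$ as $\varepsilon\downarrow0$. This relation is linear and determines $\hat B\Gamma$. A *solution* on $[0,T]$ of the cubic Gross–Pitaevskii hierarchy with initial data $\Gamma_0=\{\gamma_0^{(k)}\}_{k\ge1}$, with $\hat B\Gamma\in L^1_{t\in[0,T]}\mathcal H^\alpha$, is a $\Gamma\in C([0,T],\mathcal H^\alpha)$ with $\hat B\Gamma\in L^1_{t\in[0,T]}\mathcal H^\alpha$ such that for every $k\ge1$ and all $t\in[0,T]$ $$\gamma^{(k)}_t=e^{\mathrm it\triangle^{(k)}_\pm}\gamma^{(k)}_0+\int_0^te^{\mathrm i(t-s)\triangle^{(k)}_\pm}\tilde B^{(k)}\gamma^{(k+1)}_s\,ds .$$ **Theorem.** There is an absolute constant $A>2$ such that for all $n\ge2$ and $\alpha>(n-1)/2$ there is a constant $C=C_{n,\alpha}>0$, depending only on $n$ and $\alpha$, such that for $\mu=\pm1$ the following hold. 1. Let $\Gamma_0\in\mathcal H^\alpha$ and let $T>0$ satisfy $4CA^2\|\Gamma_0\|_{\mathcal H^\alpha}^2\,T\le1$ (that is, $T\le 1/[4CA^2\|\Gamma_0\|^2_{\mathcal H^\alpha}]$,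 any $T>0$ being allowed if $\Gamma_0=0$). Then there is a solution $\Gamma\in C([0,T],\mathcal H^\alpha)$ with $\Gamma(0)=\Gamma_0$, with $\hat B\Gamma\in L^1_{t\in[0,T]}\mathcal H^\alpha$ and $$\|\hat B\Gamma\|_{L^1_{t\in[0,T]}\mathcal H^\alpha}\le4A\|\Gamma_0\|_{\mathcal H^\alpha}.\qquad(*)$$ 2. Let $T_0>0$ and let $\Gamma\in C([0,T_0],\mathcal H^\alpha)$ with $\hat B\Gamma\in L^1_{t\in[0,T_0]}\mathcal H^\alpha$ be a solution on $[0,T_0]$ with initial data $\Gamma_0$. Then $(*)$ holds for every $0<T\le T_0$ with $4CA^2\max\{\|\hat B\Gamma\|^2_{L^1_{t\in[0,T_0]}\mathcal H^\alpha},\|\Gamma_0\|^2_{\mathcal H^\alpha}\}\,T\le1$. 3. Let $T_0>0$ and let $\Gamma,\Gamma'\in C([0,T_0],\mathcal H^\alpha)$ with $\hat B\Gamma,\hat B\Gamma'\in L^1_{t\in[0,T_0]}\mathcal H^\alpha$ be two solutions on $[0,T_0]$ with initial data $\Gamma_0,\Gamma_0'$. Then $$\|\Gamma-\Gamma'\|_{C([0,T],\mathcal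 H^\alpha)}\le(1+4A)\|\Gamma_0-\Gamma_0'\|_{\mathcal H^\alpha}$$ for every $0<T\le T_0$ with $4CA^2\max\{\|\hat B[\Gamma-\Gamma']\|^2_{L^1_{t\in[0,T_0]}\mathcal H^\alpha},\|\Gamma_0-\Gamma_0'\|^2_{\mathcal H^\alpha}\}\,T\le1$. -/

import Mathlib

open MeasureTheory Set Filter Topology
open scoped ENNReal FourierTransform ContDiff

namespace GPHierarchy

noncomputable section

/-- One-particle space `ℝⁿ` with its Euclidean norm. -/
abbrev Pt (n : ℕ) : Type := EuclideanSpace ℝ (Fin n)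

/-- The space `ℝ^{kn} × ℝ^{kn}` of pairs `(𝐱_k, 𝐱'_k)`: for `z : Conf n k`, the point `x_j` is
`z (Sum.inl j)` and the point `x'_j` is `z (Sum.inr j)`. -/
abbrev Conf (n k : ℕ) : Type := PiLp 2 (fun _ : Fin k ⊕ Fin k => Pt n)

/-- `L²(ℝ^{kn} × ℝ^{kn}; ℂ)`. -/
abbrev L2 (n k : ℕ) : Type := Lp (α := Conf n k) ℂ 2 (volume : Measure (Conf n k))

/-- Sequences `{γ^{(k)}}_{k ≥ 1}` of square integrable functions. The entry with index `k : ℕ` is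
the marginal `γ^{(k+1)}`. -/
abbrev Hierarchy (n : ℕ) : Type := (k : ℕ) → L2 n (k + 1)

/-! ### The Sobolev spaces `H^α_k` -/

/-- Exchange of `𝐱_k` and `𝐱'_k`. -/
def swapConf {n k : ℕ} (z : Conf n k) : Conf n k := WithLp.toLp 2 (fun i => z i.swap)

/-- Simultaneous permutation of the points `x_1, …, x_k` and of the points `x'_1, …, x'_k`. -/
def permConf {n k : ℕ} (σ : Equiv.Perm (Fin k)) (z : Conf n k) : Conf n k :=
  WithLp.toLp 2 (fun i => z (Sum.map σ σ i))

/-- Symmetry of a marginal density matrix: it is Hermitian and invariant under permutations of the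
particles. -/
def IsSymm {n k : ℕ} (f : L2 n k) : Prop :=
  (∀ᵐ z : Conf n k, f z = (starRingEnd ℂ) (f (swapConf z))) ∧
    ∀ σ : Equiv.Perm (Fin k), ∀ᵐ z : Conf n k, f z = f (permConf σ z)

/-- The Fourier symbol of `S^{(k,α)} = ∏_j (1 - Δ_{x_j})^{α/2} (1 - Δ_{x'_j})^{α/2}`. The Fourier
transform is `∫ f(z) e^{-2πi⟨z,ξ⟩} dz`, so that `1 - Δ_{x_j}` has the symbol `1 + |2πξ_j|²`. -/
def sobolevWeight {n k : ℕ} (α : ℝ) (ξ : Conf n k) : ℝ :=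
  ∏ i, (1 + (2 * Real.pi * ‖ξ i‖) ^ 2) ^ (α / 2)

/-- The norm `‖f‖_{H^α_k} = ‖S^{(k,α)} f‖_{L²}`, with the value `∞` if `S^{(k,α)} f ∉ L²`. -/
def sobolevNorm {n k : ℕ} (α : ℝ) (f : L2 n k) : ℝ≥0∞ :=
  eLpNorm (fun ξ : Conf n k => (sobolevWeight α ξ : ℂ) * (𝓕 f : L2 n k) ξ) 2 volume

/-- Membership in `H^α_k`. -/
def MemSobolev {n k : ℕ} (α : ℝ) (f : L2 n k) : Prop :=
  IsSymm f ∧ sobolevNorm α f < ⊤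

/-! ### Quasi-norms -/

/-- `∑_{k ≥ 1} λ^{-k} a_k`, where `a_k` has the index `k - 1`. -/
def geomSum (a : ℕ → ℝ≥0∞) (l : ℝ) : ℝ≥0∞ := ∑' k : ℕ, a k / ENNReal.ofReal (l ^ (k + 1))

/-- `∑_{k ≥ 1} λ^{-k} a_k < ∞` for some `λ > 0`. -/
def GeomBounded (a : ℕ → ℝ≥0∞) : Prop := ∃ l : ℝ, 0 < l ∧ geomSum a l < ⊤

/-- `½ inf {λ > 0 : ∑_{k ≥ 1} λ^{-k} a_k ≤ 1}`. -/
def quasiNorm (a : ℕ → ℝ≥0∞) : ℝ := (1 / 2) * sInf {l : ℝ | 0 < l ∧ geomSum a l ≤ 1}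

/-- Membership in `𝓗^α`. -/
structure MemH {n : ℕ} (α : ℝ) (Γ : Hierarchy n) : Prop where
  mem : ∀ k, MemSobolev α (Γ k)
  bounded : GeomBounded (fun k => sobolevNorm α (Γ k))

/-- The quasi-norm of `𝓗^α`. -/
def hNorm {n : ℕ} (α : ℝ) (Γ : Hierarchy n) : ℝ := quasiNorm (fun k => sobolevNorm α (Γ k))

/-- Membership in `C([0,T], 𝓗^α)`: every marginal is continuous on `[0,T]` with values in `H^α_k`,
and the norms in `C([0,T], H^α_k)` grow at most geometrically in `k`. -/
structure MemC {n : ℕ} (α T : ℝ) (Γ : ℝ → Hierarchy n) : Prop where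
  mem : ∀ t ∈ Icc 0 T, MemH α (Γ t)
  continuous : ∀ k, ∀ t₀ ∈ Icc 0 T,
    Tendsto (fun t => sobolevNorm α (Γ t k - Γ t₀ k)) (𝓝[Icc 0 T] t₀) (𝓝 0)
  bounded : GeomBounded (fun k => ⨆ t ∈ Icc 0 T, sobolevNorm α (Γ t k))

/-- The quasi-norm of `C([0,T], 𝓗^α)`. -/
def cNorm {n : ℕ} (α T : ℝ) (Γ : ℝ → Hierarchy n) : ℝ :=
  quasiNorm (fun k => ⨆ t ∈ Icc 0 T, sobolevNorm α (Γ t k))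

/-- Membership in `L¹_{t ∈ [0,T]} 𝓗^α`. -/
structure MemL1 {n : ℕ} (α T : ℝ) (Ξ : ℝ → Hierarchy n) : Prop where
  measurable : ∀ k, AEStronglyMeasurable (fun t => Ξ t k) (volume.restrict (Icc 0 T))
  mem : ∀ᵐ t ∂(volume.restrict (Icc 0 T)), MemH α (Ξ t)
  bounded : GeomBounded (fun k => ∫⁻ t in Icc 0 T, sobolevNorm α (Ξ t k))

/-- The quasi-norm of `L¹_{t ∈ [0,T]} 𝓗^α`. -/
def l1Norm {n : ℕ} (α T : ℝ) (Ξ : ℝ → Hierarchy n) : ℝ :=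
  quasiNorm (fun k => ∫⁻ t in Icc 0 T, sobolevNorm α (Ξ t k))

/-! ### The free evolution -/

/-- The Fourier symbol of `e^{itΔ_±^{(k)}}`, where `Δ_±^{(k)} = ∑_j (Δ_{x_j} - Δ_{x'_j})`. -/
def freePhase {n k : ℕ} (t : ℝ) (ξ : Conf n k) : ℂ :=
  Complex.exp (((-(t * ∑ j : Fin k, ((2 * Real.pi * ‖ξ (Sum.inl j)‖) ^ 2
    - (2 * Real.pi * ‖ξ (Sum.inr j)‖) ^ 2)) : ℝ) : ℂ) * Complex.I)

theorem memLp_freePhase_mul {n k : ℕ} (t : ℝ) (g : L2 n k) :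
    MemLp (fun ξ : Conf n k => freePhase t ξ * g ξ) 2 volume := by
  have hc : Continuous (fun ξ : Conf n k => freePhase t ξ) := by
    unfold freePhase
    fun_prop
  refine (Lp.memLp g).of_le (hc.aestronglyMeasurable.mul (Lp.aestronglyMeasurable g)) ?_
  refine Eventually.of_forall fun ξ => ?_
  have h1 : ‖freePhase t ξ‖ = 1 := Complex.norm_exp_ofReal_mul_I _
  rw [norm_mul, h1, one_mul]

/-- The free evolution `e^{itΔ_±^{(k)}}` on `L²`. -/
def freeEvol {n k : ℕ} (t : ℝ) (f : L2 n k) : L2 n k :=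
  𝓕⁻ ((memLp_freePhase_mul t (𝓕 f : L2 n k)).toLp _ : L2 n k)

/-! ### The collision operator -/

/-- A mollifier: a smooth compactly supported function of integral `1`. -/
structure IsMollifier {n : ℕ} (h : Pt n → ℝ) : Prop where
  smooth : ContDiff ℝ ∞ h
  compact : HasCompactSupport h
  integral : ∫ x, h x = 1

/-- The approximate identity `h_ε(x) = ε^{-n} h(x/ε)`. -/
def rescale {n : ℕ} (h : Pt n → ℝ) (ε : ℝ) (x : Pt n) : ℝ := (ε ^ n)⁻¹ * h (ε⁻¹ • x)

/-- `(𝐱_{k+1}, 𝐱'_{k+1})` with `x_{k+1} = y` and `x'_{k+1} = y'`. -/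
def extend {n k : ℕ} (z : Conf n k) (y y' : Pt n) : Conf n (k + 1) :=
  WithLp.toLp 2 (Sum.elim
    (Fin.snoc (α := fun _ => Pt n) (fun j => z (Sum.inl j)) y)
    (Fin.snoc (α := fun _ => Pt n) (fun j => z (Sum.inr j)) y'))

/-- The operator obtained from `B^{(k)} = ∑_j (B¹_{j,k} - B²_{j,k})` when every `δ` in
`∫∫ δ(x_{k+1} - x'_{k+1}) δ(x_j - x_{k+1}) γ^{(k+1)} dx_{k+1} dx'_{k+1}` and in
`∫∫ δ(x_{k+1} - x'_{k+1}) δ(x'_j - x_{k+1}) γ^{(k+1)} dx_{k+1} dx'_{k+1}`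
is replaced by `h_ε`. -/
def mollifiedB {n k : ℕ} (h : Pt n → ℝ) (ε : ℝ) (f : L2 n (k + 1)) (z : Conf n k) : ℂ :=
  ∑ j : Fin k,
    ((∫ p : Pt n × Pt n, ((rescale h ε (p.1 - p.2) * rescale h ε (z (Sum.inl j) - p.1) : ℝ) : ℂ)
        * f (extend z p.1 p.2))
      - ∫ p : Pt n × Pt n, ((rescale h ε (p.1 - p.2) * rescale h ε (z (Sum.inr j) - p.1) : ℝ) : ℂ)
        * f (extend z p.1 p.2))

/-- `ρ = B̃^{(k)} γ = -iμ B^{(k)} γ` on `(0,T)`: for every mollifier `h`, the functions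
`-iμ B^{(k)}_{h_ε} γ` converge to `ρ` in the sense of distributions on `(0,T) × ℝ^{kn} × ℝ^{kn}`
as `ε ↓ 0`. -/
def IsCollision {n k : ℕ} (μ T : ℝ) (γ : ℝ → L2 n (k + 1)) (ρ : ℝ → L2 n k) : Prop :=
  ∀ h : Pt n → ℝ, IsMollifier h →
    ∀ Φ : ℝ × Conf n k → ℂ, ContDiff ℝ ∞ Φ → HasCompactSupport Φ →
      tsupport Φ ⊆ Ioo 0 T ×ˢ univ →
      Tendsto
        (fun ε : ℝ => ∫ t in Ioo 0 T, ∫ z : Conf n k,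
          Φ (t, z) * ((-Complex.I * (μ : ℂ)) * mollifiedB h ε (γ t) z))
        (𝓝[>] 0) (𝓝 (∫ t in Ioo 0 T, ∫ z : Conf n k, Φ (t, z) * ρ t z))

/-- `Ξ = B̂ Γ` on `(0,T)`, that is, `Ξ^{(k)} = B̃^{(k)} Γ^{(k+1)}` for all `k ≥ 1`. -/
def IsBHat {n : ℕ} (μ T : ℝ) (Γ Ξ : ℝ → Hierarchy n) : Prop :=
  ∀ k : ℕ, IsCollision μ T (fun t => Γ t (k + 1)) (fun t => Ξ t k)

/-! ### Solutions -/

/-- `Γ ∈ C([0,T], 𝓗^α)` is a solution of the cubic Gross-Pitaevskii hierarchy with initial data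
`Γ₀`, and `Ξ = B̂ Γ` lies in `L¹_{t ∈ [0,T]} 𝓗^α`. -/
structure IsSolution {n : ℕ} (α μ T : ℝ) (Γ₀ : Hierarchy n) (Γ Ξ : ℝ → Hierarchy n) : Prop where
  memC : MemC α T Γ
  memL1 : MemL1 α T Ξ
  bHat : IsBHat μ T Γ Ξ
  mild : ∀ k : ℕ, ∀ t ∈ Icc 0 T,
    Γ t k = freeEvol t (Γ₀ k) + ∫ s in (0 : ℝ)..t, freeEvol (t - s) (Ξ s k)

end

end GPHierarchy

/-! The hierarchy is linear, and the proof works in the interaction picture on the Fourier side: the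
free evolution is undone and the Sobolev weight is absorbed (`fromInt`, `toInt`). Then `H^α` becomes
`L²`, Duhamel's formula becomes plain integration in time, and the initial data `g` and the
collision terms `r` satisfy `r_k = B(g_{k+1} + ∫₀ᵗ r_{k+1})` with a time dependent `B`. Tested
against functions `ψ(t, ξ)` this is `IsInteraction`; the adjoint operator `duhamel` maps a test
function of `k` particles to one of `k + 1` particles at an earlier time. Iteration gives `r_k` as a
series in `g` plus a remainder in `r` (`IsInteraction.iterate`). Two facts control the terms with
`m` collisions.

Analysis. Each collision obeys an `L²` space-time estimate (`collision_bound`), the dual form of the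
Klainerman-Machedon estimate. Plancherel in time reduces it to `lintegral_merge_le`: the squared
kernel has bounded density along the map that sends the frequencies to the resonance function and
the merged frequency. For a fixed merged frequency `p` the resonance function is affine in one free
frequency, with gradient proportional to `p - η`. The bracket `(1 + |η'|)^(-2α)` is integrable over
hyperplanes because `2α > n - 1`, and the resulting factor `1 / |p - η|` is integrable, uniformly in
`p`, against the other bracket because `n ≥ 2`.

Combinatorics. The number of sequences of `m` collisions grows factorially in `m`. Collisions at
unrelated particles commute once their times are exchanged (`stepL_comm`), so every sequence can be
brought into a normal form, and there are at most `2^(k+1) * 8^m` normal forms for `k + 1` particles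
(`card_normalWords_le`). For given times at most one sequence contributes to a normal form, so all
sequences with this form add up to one integral over the times with a coefficient of modulus at most
`1` (`exists_expansion_eq`). Hence the `m`-th term gains `(D √T)^m` and costs only `2^(k+1)`
(`norm_expansion_le`).

If `D √T` is small against the growth rates of the data and of `r`, the remainder tends to zero and
the series converges geometrically. It is a bounded functional of the test function in `L²` of time
and frequency, so the Riesz theorem represents it. This produces `r` for existence, and for any
solution it identifies `r` and yields `‖r_k‖_{L¹} ≤ majorant`, which costs a factor `12` in the
quasi-norm. Applied to a difference of two solutions it gives stability, with factor `13`.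

The link with the definition of `B̂` is `tendsto_mollifiedB`: on the Fourier side mollification
multiplies the collision kernel by a factor which is bounded and tends to `1`. Permutation symmetry
is needed there, because the collision operator removes the last particle while the normal forms
insert the new particle next to its partner. -/

open scoped NNReal

namespace GPHierarchy

noncomputable section

/-! ### Inserting and removing a particle -/

/-- Insertion of a pair `(y, y')` as the particle with index `q`. -/
def insConf {n k : ℕ} (q : Fin (k + 1)) (p : Conf n k × (Pt n × Pt n)) : Conf n (k + 1) :=
  WithLp.toLp 2 (Sum.elim
    (q.insertNth (α := fun _ => Pt n) p.2.1 (fun j => p.1 (Sum.inl j)))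
    (q.insertNth (α := fun _ => Pt n) p.2.2 (fun j => p.1 (Sum.inr j))))

/-- Removal of the particle with index `q`. -/
def delConf {n k : ℕ} (q : Fin (k + 1)) (z : Conf n (k + 1)) : Conf n k :=
  WithLp.toLp 2 (fun i => z (i.map q.succAbove q.succAbove))

@[simp] theorem delConf_apply {n k : ℕ} (q : Fin (k + 1)) (z : Conf n (k + 1)) (i : Fin k ⊕ Fin k) :
    delConf q z i = z (i.map q.succAbove q.succAbove) := rfl

@[simp] theorem insConf_inl {n k : ℕ} (q : Fin (k + 1)) (p : Conf n k × (Pt n × Pt n)) :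
    insConf q p (Sum.inl q) = p.2.1 := by
  simp [insConf]

@[simp] theorem insConf_inr {n k : ℕ} (q : Fin (k + 1)) (p : Conf n k × (Pt n × Pt n)) :
    insConf q p (Sum.inr q) = p.2.2 := by
  simp [insConf]

@[simp] theorem insConf_inl_succAbove {n k : ℕ} (q : Fin (k + 1)) (p : Conf n k × (Pt n × Pt n))
    (j : Fin k) : insConf q p (Sum.inl (q.succAbove j)) = p.1 (Sum.inl j) := by
  simp [insConf]

@[simp] theorem insConf_inr_succAbove {n k : ℕ} (q : Fin (k + 1)) (p : Conf n k × (Pt n × Pt n))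
    (j : Fin k) : insConf q p (Sum.inr (q.succAbove j)) = p.1 (Sum.inr j) := by
  simp [insConf]

@[simp] theorem delConf_insConf {n k : ℕ} (q : Fin (k + 1)) (p : Conf n k × (Pt n × Pt n)) :
    delConf q (insConf q p) = p.1 := by
  ext i : 1
  rcases i with i | i <;> simp

theorem insConf_delConf {n k : ℕ} (q : Fin (k + 1)) (z : Conf n (k + 1)) :
    insConf q (delConf q z, (z (Sum.inl q), z (Sum.inr q))) = z := by
  ext i : 1
  rcases i with i | i
  · rcases Fin.eq_self_or_eq_succAbove q i with rfl | ⟨j, rfl⟩ <;> simp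
  · rcases Fin.eq_self_or_eq_succAbove q i with rfl | ⟨j, rfl⟩ <;> simp

theorem extend_eq_insConf {n k : ℕ} (z : Conf n k) (y y' : Pt n) :
    extend z y y' = insConf (Fin.last k) (z, (y, y')) := by
  simp [extend, insConf, Fin.insertNth_last']

/-- `insConf` as a linear isometry. -/
def insIsometry (n : ℕ) {k : ℕ} (q : Fin (k + 1)) :
    WithLp 2 (Conf n k × WithLp 2 (Pt n × Pt n)) ≃ₗᵢ[ℝ] Conf n (k + 1) where
  toFun p := insConf q (p.fst, (p.snd.fst, p.snd.snd))
  invFun z := WithLp.toLp 2 (delConf q z, WithLp.toLp 2 (z (Sum.inl q), z (Sum.inr q)))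
  left_inv p := by
    simp only [delConf_insConf, insConf_inl, insConf_inr]
    rfl
  right_inv z := by simp [insConf_delConf]
  map_add' p p' := by
    ext i : 1
    rcases i with i | i
    · rcases Fin.eq_self_or_eq_succAbove q i with rfl | ⟨j, rfl⟩ <;> simp
    · rcases Fin.eq_self_or_eq_succAbove q i with rfl | ⟨j, rfl⟩ <;> simp
  map_smul' c p := by
    ext i : 1
    rcases i with i | i
    · rcases Fin.eq_self_or_eq_succAbove q i with rfl | ⟨j, rfl⟩ <;> simp
    · rcases Fin.eq_self_or_eq_succAbove q i with rfl | ⟨j, rfl⟩ <;> simp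
  norm_map' p := by
    rw [← sq_eq_sq₀ (norm_nonneg _) (norm_nonneg _)]
    simp only [LinearEquiv.coe_mk, LinearMap.coe_mk, AddHom.coe_mk, PiLp.norm_sq_eq_of_L2,
      WithLp.prod_norm_sq_eq_of_L2, Fintype.sum_sum_type, Fin.sum_univ_succAbove _ q,
      insConf_inl, insConf_inr, insConf_inl_succAbove, insConf_inr_succAbove]
    ring

/-- `insConf` as a measurable equivalence. -/
def insEquiv (n : ℕ) {k : ℕ} (q : Fin (k + 1)) :
    Conf n k × (Pt n × Pt n) ≃ᵐ Conf n (k + 1) :=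
  ((MeasurableEquiv.prodCongr (MeasurableEquiv.refl _) (MeasurableEquiv.toLp 2 (Pt n × Pt n))).trans
    (MeasurableEquiv.toLp 2 (Conf n k × WithLp 2 (Pt n × Pt n)))).trans
      (insIsometry n q).toMeasurableEquiv

theorem measurePreserving_insEquiv {n k : ℕ} (q : Fin (k + 1)) :
    MeasurePreserving (insEquiv n q) volume volume := by
  refine ((LinearIsometryEquiv.measurePreserving (insIsometry n q)).comp
    (WithLp.volume_preserving_toLp (Conf n k) (WithLp 2 (Pt n × Pt n)))).comp
    (MeasurePreserving.prod (MeasurePreserving.id _) (WithLp.volume_preserving_toLp (Pt n) (Pt n)))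

theorem lintegral_insConf {n k : ℕ} (q : Fin (k + 1)) (F : Conf n (k + 1) → ℝ≥0∞) :
    ∫⁻ z, F z = ∫⁻ p : Conf n k × (Pt n × Pt n), F (insConf q p) :=
  ((measurePreserving_insEquiv q).lintegral_comp_emb
    (insEquiv n q).measurableEmbedding F).symm

/-- The sign of a coordinate: `1` for the points `x_j` and `-1` for the points `x'_j`. -/
def sgn {k : ℕ} (i : Fin k ⊕ Fin k) : ℝ := Sum.elim (fun _ => 1) (fun _ => -1) i

/-- The frequency after a collision: the particle `q` is removed and its two frequencies are added
to the coordinate `i`. -/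
def merge {n k : ℕ} (i : Fin k ⊕ Fin k) (q : Fin (k + 1)) (z : Conf n (k + 1)) : Conf n k :=
  delConf q z + WithLp.toLp 2 (Pi.single i (z (Sum.inl q) + z (Sum.inr q)))

theorem merge_apply {n k : ℕ} (i : Fin k ⊕ Fin k) (q : Fin (k + 1)) (z : Conf n (k + 1))
    (l : Fin k ⊕ Fin k) :
    merge i q z l = z (l.map q.succAbove q.succAbove)
      + if l = i then z (Sum.inl q) + z (Sum.inr q) else 0 := by
  simp [merge]

theorem continuous_merge {n k : ℕ} (i : Fin k ⊕ Fin k) (q : Fin (k + 1)) :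
    Continuous (merge (n := n) i q) := by
  have h : Continuous fun z : Conf n (k + 1) => fun l : Fin k ⊕ Fin k =>
      z (l.map q.succAbove q.succAbove)
        + if l = i then z (Sum.inl q) + z (Sum.inr q) else 0 := by
    refine continuous_pi fun l => ?_
    split_ifs <;> fun_prop
  refine ((PiLp.continuous_toLp 2 _).comp h).congr fun z => ?_
  ext l : 1
  exact (merge_apply i q z l).symm

/-- The dispersion relation: `e^{itΔ_±}` has the symbol `e^{-it energy}`. -/
def energy {n k : ℕ} (z : Conf n k) : ℝ := ∑ i, sgn i * (2 * Real.pi * ‖z i‖) ^ 2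

theorem continuous_energy {n k : ℕ} : Continuous (energy (n := n) (k := k)) := by
  unfold energy
  fun_prop

theorem freePhase_eq {n k : ℕ} (t : ℝ) (z : Conf n k) :
    freePhase t z = Complex.exp (((-(t * energy z) : ℝ) : ℂ) * Complex.I) := by
  simp [freePhase, energy, sgn, Fintype.sum_sum_type, sub_eq_add_neg, Finset.sum_add_distrib]

/-- All coordinates not involved in the collision cancel. The resonance function therefore depends
on three frequencies only, which makes all later bounds independent of `k`. -/
theorem energy_sub_merge {n k : ℕ} (i : Fin k ⊕ Fin k) (q : Fin (k + 1)) (z : Conf n (k + 1)) :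
    energy z - energy (merge i q z) =
      (2 * Real.pi) ^ 2 * (‖z (Sum.inl q)‖ ^ 2 - ‖z (Sum.inr q)‖ ^ 2
        + sgn i * (‖z (i.map q.succAbove q.succAbove)‖ ^ 2
          - ‖z (i.map q.succAbove q.succAbove) + (z (Sum.inl q) + z (Sum.inr q))‖ ^ 2)) := by
  have h1 : energy z = (2 * Real.pi) ^ 2 * (‖z (Sum.inl q)‖ ^ 2 - ‖z (Sum.inr q)‖ ^ 2)
      + ∑ l : Fin k ⊕ Fin k, sgn l * (2 * Real.pi * ‖z (l.map q.succAbove q.succAbove)‖) ^ 2 := by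
    simp only [energy, Fintype.sum_sum_type, Fin.sum_univ_succAbove _ q, Sum.map_inl, Sum.map_inr,
      sgn, Sum.elim_inl, Sum.elim_inr]
    ring
  have h2 : energy (merge i q z)
      - ∑ l : Fin k ⊕ Fin k, sgn l * (2 * Real.pi * ‖z (l.map q.succAbove q.succAbove)‖) ^ 2
      = sgn i * (2 * Real.pi) ^ 2 *
        (‖z (i.map q.succAbove q.succAbove) + (z (Sum.inl q) + z (Sum.inr q))‖ ^ 2
          - ‖z (i.map q.succAbove q.succAbove)‖ ^ 2) := by
    rw [energy, ← Finset.sum_sub_distrib, Finset.sum_eq_single i]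
    · rw [merge_apply, if_pos rfl]; ring
    · intro l _ hl
      rw [merge_apply, if_neg hl, add_zero, sub_self]
    · simp
  linear_combination h1 - h2

/-- The one-particle factor of `sobolevWeight`. -/
def wt {n : ℕ} (α : ℝ) (x : Pt n) : ℝ := (1 + (2 * Real.pi * ‖x‖) ^ 2) ^ (α / 2)

theorem wt_pos {n : ℕ} (α : ℝ) (x : Pt n) : 0 < wt α x := by unfold wt; positivity

theorem one_le_wt {n : ℕ} {α : ℝ} (hα : 0 ≤ α) (x : Pt n) : 1 ≤ wt α x :=
  Real.one_le_rpow (by nlinarith [sq_nonneg (2 * Real.pi * ‖x‖)]) (by positivity)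

theorem continuous_wt {n : ℕ} (α : ℝ) : Continuous (wt (n := n) α) := by
  unfold wt
  exact Continuous.rpow_const (by fun_prop) fun x => Or.inl (by positivity)

theorem sobolevWeight_eq {n k : ℕ} (α : ℝ) (z : Conf n k) :
    sobolevWeight α z = ∏ i, wt α (z i) := rfl

theorem sobolevWeight_pos {n k : ℕ} (α : ℝ) (z : Conf n k) : 0 < sobolevWeight α z :=
  Finset.prod_pos fun i _ => wt_pos α (z i)

theorem one_le_sobolevWeight {n k : ℕ} {α : ℝ} (hα : 0 ≤ α) (z : Conf n k) :
    1 ≤ sobolevWeight α z := by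
  rw [sobolevWeight_eq]
  exact Finset.one_le_prod fun i _ => one_le_wt hα (z i)

theorem continuous_sobolevWeight {n k : ℕ} (α : ℝ) :
    Continuous (sobolevWeight (n := n) (k := k) α) := by
  simp_rw [funext (sobolevWeight_eq (n := n) (k := k) α)]
  exact continuous_finsetProd _ fun i _ => (continuous_wt α).comp (by fun_prop)

/-- As for the energy, the weights of the spectators cancel and a quotient in three frequencies is
left. -/
theorem sobolevWeight_merge_div {n k : ℕ} (α : ℝ) (i : Fin k ⊕ Fin k) (q : Fin (k + 1))
    (z : Conf n (k + 1)) :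
    sobolevWeight α (merge i q z) / sobolevWeight α z =
      wt α (z (i.map q.succAbove q.succAbove) + (z (Sum.inl q) + z (Sum.inr q))) /
        (wt α (z (i.map q.succAbove q.succAbove)) * wt α (z (Sum.inl q)) * wt α (z (Sum.inr q))) := by
  have h1 : sobolevWeight α z = wt α (z (Sum.inl q)) * wt α (z (Sum.inr q))
      * ∏ l : Fin k ⊕ Fin k, wt α (z (l.map q.succAbove q.succAbove)) := by
    simp only [sobolevWeight_eq, Fintype.prod_sum_type, Fin.prod_univ_succAbove _ q, Sum.map_inl,
      Sum.map_inr]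
    ring
  rw [h1, sobolevWeight_eq, ← Finset.mul_prod_erase _ _ (Finset.mem_univ i),
    ← Finset.mul_prod_erase _ (fun l => wt α (z (l.map q.succAbove q.succAbove)))
      (Finset.mem_univ i), merge_apply, if_pos rfl]
  have h2 : ∏ l ∈ Finset.univ.erase i, wt α (merge i q z l)
      = ∏ l ∈ Finset.univ.erase i, wt α (z (l.map q.succAbove q.succAbove)) := by
    refine Finset.prod_congr rfl fun l hl => ?_
    rw [merge_apply, if_neg (Finset.ne_of_mem_erase hl), add_zero]
  rw [h2]
  have h3 : ∏ l ∈ Finset.univ.erase i, wt α (z (l.map q.succAbove q.succAbove)) ≠ 0 :=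
    (Finset.prod_pos fun l _ => wt_pos α _).ne'
  have := (wt_pos α (z (Sum.inl q))).ne'
  have := (wt_pos α (z (Sum.inr q))).ne'
  have := (wt_pos α (z (i.map q.succAbove q.succAbove))).ne'
  field_simp

end

end GPHierarchy

namespace GPHierarchy

noncomputable section

/-! ### The bilinear density estimate -/

theorem lintegral_comp_affine {a : ℝ} (ha : a ≠ 0) (c : ℝ) {u : ℝ → ℝ≥0∞} (hu : Measurable u) :
    ∫⁻ x, u (c + a * x) = ENNReal.ofReal |a⁻¹| * ∫⁻ x, u x := by
  have h1 : ∫⁻ x, u (c + a * x) = ∫⁻ x, u (c + x) ∂(Measure.map (fun x => a * x) volume) :=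
    (lintegral_map (f := fun x => u (c + x)) (by fun_prop) (by fun_prop)).symm
  rw [h1, Real.map_volume_mul_left ha, lintegral_smul_measure, lintegral_add_left_eq_self]
  rfl

theorem exists_norm_le_sqrt_mul_coord {m : ℕ} (v : Pt (m + 1)) :
    ∃ i, ‖v‖ ≤ √(m + 1) * |v i| := by
  obtain ⟨i, -, hi⟩ := Finset.exists_max_image Finset.univ (fun i => |v i|) Finset.univ_nonempty
  refine ⟨i, ?_⟩
  rw [EuclideanSpace.norm_eq]
  refine Real.sqrt_le_iff.2 ⟨by positivity, ?_⟩
  calc ∑ j, ‖v j‖ ^ 2 ≤ ∑ _j : Fin (m + 1), |v i| ^ 2 := by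
        refine Finset.sum_le_sum fun j hj => ?_
        exact pow_le_pow_left₀ (norm_nonneg _) (hi j hj) 2
    _ = _ := by
        rw [mul_pow, Real.sq_sqrt (by positivity)]
        simp

/-- Integrate first in the coordinate where `v` is largest: an affine substitution costs `1 / |v
i|`, which is at most `√(m + 1) / ‖v‖`. The bracket is bounded by the bracket of the other `m`
coordinates, integrable since `r > m`. -/
theorem lintegral_japanese_comp_inner_le {m : ℕ} {r : ℝ} (hr : (m : ℝ) < r) :
    ∃ C : ℝ≥0∞, C < ⊤ ∧ ∀ (v : Pt (m + 1)), v ≠ 0 → ∀ (c : ℝ) (u : ℝ → ℝ≥0∞), Measurable u →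
      ∫⁻ y : Pt (m + 1), ENNReal.ofReal ((1 + ‖y‖) ^ (-r)) * u (c + inner ℝ v y)
        ≤ C * ENNReal.ofReal (‖v‖⁻¹) * ∫⁻ x, u x := by
  have hfin : ∫⁻ w : Fin m → ℝ, ENNReal.ofReal ((1 + ‖w‖) ^ (-r)) < ⊤ :=
    finite_integral_one_add_norm (by simpa using hr)
  have hr0 : 0 < r := lt_of_le_of_lt (Nat.cast_nonneg m) hr
  refine ⟨ENNReal.ofReal √(m + 1) * ∫⁻ w : Fin m → ℝ, ENNReal.ofReal ((1 + ‖w‖) ^ (-r)),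
    ENNReal.mul_lt_top ENNReal.ofReal_lt_top hfin, fun v hv c u hu => ?_⟩
  obtain ⟨i, hi⟩ := exists_norm_le_sqrt_mul_coord v
  have hvpos : 0 < ‖v‖ := norm_pos_iff.2 hv
  have hvi : v i ≠ 0 := by
    intro h
    rw [h] at hi
    simp at hi
    exact hv hi
  set F : Pt (m + 1) → ℝ≥0∞ :=
    fun y => ENNReal.ofReal ((1 + ‖y‖) ^ (-r)) * u (c + inner ℝ v y) with hF
  have hFm : Measurable F := by
    refine Measurable.mul (by fun_prop) (hu.comp (by fun_prop))
  have h1 : ∫⁻ y, F y = ∫⁻ p : ℝ × (Fin m → ℝ), F (WithLp.toLp 2 (i.insertNth p.1 p.2)) := by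
    rw [← (PiLp.volume_preserving_toLp (Fin (m + 1))).lintegral_comp hFm,
      ← ((volume_preserving_piFinSuccAbove (fun _ : Fin (m + 1) => ℝ) i).symm).lintegral_comp
        (f := fun y => F (WithLp.toLp 2 y)) (by fun_prop)]
    rfl
  rw [h1, Measure.volume_eq_prod ℝ (Fin m → ℝ), lintegral_prod_symm]
  swap
  · refine (hFm.comp ?_).aemeasurable
    refine (PiLp.continuous_toLp 2 _).measurable.comp ?_
    exact (MeasurableEquiv.piFinSuccAbove (fun _ => ℝ) i).symm.measurable
  have h2 : ∀ w : Fin m → ℝ, ∫⁻ x, F (WithLp.toLp 2 (i.insertNth x w))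
      ≤ ENNReal.ofReal ((1 + ‖w‖) ^ (-r)) * (ENNReal.ofReal |(v i)⁻¹| * ∫⁻ x, u x) := by
    intro w
    rw [← lintegral_comp_affine hvi (c + ∑ j, v (i.succAbove j) * w j) hu,
      ← lintegral_const_mul _ (by fun_prop)]
    refine lintegral_mono fun x => ?_
    simp only [hF]
    refine mul_le_mul' (ENNReal.ofReal_le_ofReal ?_) (le_of_eq ?_)
    · refine Real.rpow_le_rpow_of_nonpos (by positivity) ?_ (by linarith)
      gcongr
      refine (pi_norm_le_iff_of_nonneg (norm_nonneg _)).2 fun j => ?_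
      have := PiLp.norm_apply_le (WithLp.toLp 2 (i.insertNth x w) : Pt (m + 1)) (i.succAbove j)
      simpa using this
    · congr 1
      simp only [PiLp.inner_apply, Fin.sum_univ_succAbove _ i, Fin.insertNth_apply_same,
        Fin.insertNth_apply_succAbove, RCLike.inner_apply, conj_trivial]
      have : ∑ j, v (i.succAbove j) * w j = ∑ j, w j * v (i.succAbove j) :=
        Finset.sum_congr rfl fun j _ => mul_comm _ _
      rw [this]
      ring
  refine (lintegral_mono h2).trans ?_
  rw [lintegral_mul_const _ (by fun_prop)]
  have h3 : ENNReal.ofReal |(v i)⁻¹| ≤ ENNReal.ofReal √(m + 1) * ENNReal.ofReal (‖v‖⁻¹) := by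
    rw [← ENNReal.ofReal_mul (by positivity)]
    refine ENNReal.ofReal_le_ofReal ?_
    rw [abs_inv, ← div_eq_mul_inv, le_div_iff₀ hvpos, inv_mul_le_iff₀ (abs_pos.2 hvi)]
    linarith
  calc _ ≤ (∫⁻ w : Fin m → ℝ, ENNReal.ofReal ((1 + ‖w‖) ^ (-r)))
        * (ENNReal.ofReal √(m + 1) * ENNReal.ofReal (‖v‖⁻¹) * ∫⁻ x, u x) := by gcongr
    _ = _ := by ring

/-- For `‖p - y‖ < 1` the bracket is dropped and the singularity `1 / ‖x‖` is integrable on the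
ball. Otherwise the smaller of `1 + ‖y‖` and `‖p - y‖` alone controls the product, to the power `-(r
+ 1)`, which is integrable since `r + 1 > n`. Every majorant is a function of `y` or a translate, so
the bound is uniform in `p`. -/
theorem lintegral_japanese_mul_inv_norm_sub_le {n : ℕ} (hn : 2 ≤ n) {r : ℝ}
    (hr : (n : ℝ) - 1 < r) :
    ∃ C : ℝ≥0∞, C < ⊤ ∧ ∀ p : Pt n,
      ∫⁻ y : Pt n, ENNReal.ofReal ((1 + ‖y‖) ^ (-r)) * ENNReal.ofReal (‖p - y‖⁻¹) ≤ C := by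
  have hn' : (2 : ℝ) ≤ n := by exact_mod_cast hn
  have hr0 : 0 < r := by linarith
  have : Nonempty (Fin n) := ⟨⟨0, by omega⟩⟩
  set g : Pt n → ℝ≥0∞ := fun x => ENNReal.ofReal ((1 + ‖x‖) ^ (-(r + 1))) with hg
  have hgm : Measurable g := by fun_prop
  have hgfin : ∫⁻ x : Pt n, g x < ⊤ :=
    finite_integral_one_add_norm (by simp; linarith)
  set h : Pt n → ℝ≥0∞ := (Metric.ball (0 : Pt n) 1).indicator fun x => ENNReal.ofReal (‖x‖⁻¹)
  have hhm : Measurable h := by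
    refine Measurable.indicator ?_ Metric.isOpen_ball.measurableSet
    fun_prop
  have hhfin : ∫⁻ x : Pt n, h x < ⊤ := by
    have hint : IntegrableOn (fun x : Pt n => (fun y : ℝ => y⁻¹) ‖x‖) (Metric.ball 0 1) volume := by
      -- In polar coordinates the integrand is the power `n - 2` of the radius, bounded on `(0, 1)`
      -- because `n ≥ 2`.
      rw [integrableOn_fun_norm_addHaar]
      refine (integrableOn_const (C := (1 : ℝ)) (by simp)).mono' ?_ ?_
      · exact (by fun_prop : Measurable fun y : ℝ =>
          y ^ (Module.finrank ℝ (Pt n) - 1) • y⁻¹).aestronglyMeasurable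
      · refine (ae_restrict_iff' measurableSet_Ioo).2 (Eventually.of_forall fun y hy => ?_)
        rw [finrank_euclideanSpace_fin]
        have hy0 : 0 < y := hy.1
        obtain ⟨m, rfl⟩ : ∃ m, n = m + 2 := ⟨n - 2, by omega⟩
        have : y ^ (m + 2 - 1) • y⁻¹ = y ^ m := by
          rw [show m + 2 - 1 = m + 1 by omega, smul_eq_mul, pow_succ, mul_assoc,
            mul_inv_cancel₀ hy0.ne', mul_one]
        rw [this, Real.norm_of_nonneg (by positivity)]
        exact pow_le_one₀ hy0.le hy.2.le
    rw [lintegral_indicator Metric.isOpen_ball.measurableSet]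
    exact hint.setLIntegral_lt_top
  refine ⟨(∫⁻ x, h x) + ((∫⁻ x, g x) + ENNReal.ofReal (2 ^ (r + 1)) * ∫⁻ x, g x), ?_, fun p => ?_⟩
  · exact ENNReal.add_lt_top.2 ⟨hhfin, ENNReal.add_lt_top.2
      ⟨hgfin, ENNReal.mul_lt_top ENNReal.ofReal_lt_top hgfin⟩⟩
  have key : ∀ y : Pt n, ENNReal.ofReal ((1 + ‖y‖) ^ (-r)) * ENNReal.ofReal (‖p - y‖⁻¹)
      ≤ h (p - y) + (g y + ENNReal.ofReal (2 ^ (r + 1)) * g (p - y)) := by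
    intro y
    by_cases hb : p - y ∈ Metric.ball (0 : Pt n) 1
    · refine le_trans ?_ le_self_add
      simp only [h, indicator_of_mem hb]
      refine mul_le_of_le_one_left zero_le ?_
      rw [← ENNReal.ofReal_one]
      refine ENNReal.ofReal_le_ofReal ?_
      exact Real.rpow_le_one_of_one_le_of_nonpos (by simp) (by linarith)
    · refine le_trans ?_ le_add_self
      have hb' : 1 ≤ ‖p - y‖ := by simpa using hb
      rw [← ENNReal.ofReal_mul (by positivity), ← ENNReal.ofReal_mul (by positivity),
        ← ENNReal.ofReal_add (by positivity) (by positivity)]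
      refine ENNReal.ofReal_le_ofReal ?_
      set a := 1 + ‖y‖
      set b := ‖p - y‖
      have ha : 0 < a := by positivity
      have hb0 : 0 < b := by linarith
      rcases le_total a b with hab | hab
      · refine le_add_of_le_of_nonneg ?_ (by positivity)
        rw [neg_add, Real.rpow_add ha, Real.rpow_neg_one]
        gcongr
      · refine le_add_of_nonneg_of_le (by positivity) ?_
        have h1 : a ^ (-r) ≤ b ^ (-r) :=
          Real.rpow_le_rpow_of_nonpos hb0 hab (by linarith)
        have h2 : (2 * b) ^ (-(r + 1)) ≤ (1 + b) ^ (-(r + 1)) :=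
          Real.rpow_le_rpow_of_nonpos (by linarith) (by linarith) (by linarith)
        rw [Real.mul_rpow (by norm_num) hb0.le] at h2
        calc a ^ (-r) * b⁻¹ ≤ b ^ (-r) * b⁻¹ := by gcongr
          _ = b ^ (-(r + 1)) := by rw [neg_add, Real.rpow_add hb0, Real.rpow_neg_one]
          _ = 2 ^ (r + 1) * (2 ^ (-(r + 1)) * b ^ (-(r + 1))) := by
              rw [← mul_assoc, ← Real.rpow_add (by norm_num)]; simp
          _ ≤ _ := by gcongr
  refine (lintegral_mono key).trans ?_
  rw [lintegral_add_left (by fun_prop), lintegral_add_left hgm, lintegral_const_mul _ (by fun_prop),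
    lintegral_sub_left_eq_self, lintegral_sub_left_eq_self]

/-- The basic estimate: the form `⟨η + η', p - η⟩` has bounded density with respect to the product
of two Japanese brackets. -/
theorem lintegral_japanese_density_le {n : ℕ} (hn : 2 ≤ n) {r : ℝ} (hr : (n : ℝ) - 1 < r) :
    ∃ C : ℝ≥0∞, C < ⊤ ∧ ∀ (p : Pt n) (c : ℝ), 1 ≤ |c| → ∀ (d : Pt n → ℝ) (u : ℝ → ℝ≥0∞),
      Measurable u →
      ∫⁻ η : Pt n, ∫⁻ η' : Pt n, ENNReal.ofReal ((1 + ‖η‖) ^ (-r)) *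
        (ENNReal.ofReal ((1 + ‖η'‖) ^ (-r)) * u (d η + inner ℝ (c • (p - η)) η'))
        ≤ C * ∫⁻ x, u x := by
  obtain ⟨m, rfl⟩ : ∃ m, n = m + 1 := ⟨n - 1, by omega⟩
  obtain ⟨C1, hC1, h1⟩ := lintegral_japanese_comp_inner_le (m := m) (r := r)
    (by push_cast at hr; linarith)
  obtain ⟨C2, hC2, h2⟩ := lintegral_japanese_mul_inv_norm_sub_le hn hr
  refine ⟨C1 * C2, ENNReal.mul_lt_top hC1 hC2, fun p c hc d u hu => ?_⟩
  have hc0 : c ≠ 0 := by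
    rintro rfl
    norm_num at hc
  have hne : ∀ᵐ η : Pt (m + 1), η ≠ p := by
    simp [ae_iff]
  -- For fixed `η` the form is affine in `η'` with gradient `c • (p - η)`, so the inner integral
  -- costs at most `1 / ‖p - η‖` since `1 ≤ |c|`. The remaining integral in `η` is bounded uniformly
  -- in `p`.
  calc _ ≤ ∫⁻ η : Pt (m + 1), ENNReal.ofReal ((1 + ‖η‖) ^ (-r)) * ENNReal.ofReal (‖p - η‖⁻¹)
          * (C1 * ∫⁻ x, u x) := by
        refine lintegral_mono_ae (hne.mono fun η hη => ?_)
        have hv : c • (p - η) ≠ 0 := smul_ne_zero hc0 (sub_ne_zero.2 hη.symm)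
        rw [lintegral_const_mul _ (by fun_prop), mul_assoc]
        refine mul_le_mul_right ((h1 _ hv (d η) u hu).trans ?_) _
        have : ENNReal.ofReal (‖c • (p - η)‖⁻¹) ≤ ENNReal.ofReal (‖p - η‖⁻¹) := by
          refine ENNReal.ofReal_le_ofReal (inv_anti₀ (norm_pos_iff.2 (sub_ne_zero.2 hη.symm)) ?_)
          rw [norm_smul]
          exact le_mul_of_one_le_left (norm_nonneg _) hc
        calc C1 * ENNReal.ofReal (‖c • (p - η)‖⁻¹) * ∫⁻ x, u x
            ≤ C1 * ENNReal.ofReal (‖p - η‖⁻¹) * ∫⁻ x, u x := by gcongr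
          _ = _ := by ring
    _ = (∫⁻ η : Pt (m + 1), ENNReal.ofReal ((1 + ‖η‖) ^ (-r)) * ENNReal.ofReal (‖p - η‖⁻¹))
          * (C1 * ∫⁻ x, u x) := lintegral_mul_const _ (by fun_prop)
    _ ≤ C2 * (C1 * ∫⁻ x, u x) := by gcongr; exact h2 p
    _ = _ := by ring

end

end GPHierarchy

/-! ### Bounded density of the squared collision kernel along the resonance function -/

namespace GPHierarchy

noncomputable section

theorem wt_sq {n : ℕ} (α : ℝ) (x : Pt n) : wt α x ^ 2 = (1 + (2 * Real.pi * ‖x‖) ^ 2) ^ α := by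
  unfold wt
  rw [← Real.rpow_natCast, ← Real.rpow_mul (by positivity)]
  norm_num

theorem inv_wt_sq_le {n : ℕ} {α : ℝ} (hα : 0 ≤ α) (x : Pt n) :
    (wt α x ^ 2)⁻¹ ≤ 2 ^ α * (1 + ‖x‖) ^ (-(2 * α)) := by
  have h1 : (1 + ‖x‖) ^ 2 ≤ 2 * (1 + (2 * Real.pi * ‖x‖) ^ 2) := by
    have : ‖x‖ ^ 2 ≤ (2 * Real.pi * ‖x‖) ^ 2 := by
      refine pow_le_pow_left₀ (norm_nonneg x) ?_ 2
      have := Real.pi_gt_three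
      nlinarith [norm_nonneg x]
    nlinarith [sq_nonneg (1 - ‖x‖)]
  have h2 : (1 + ‖x‖) ^ (2 * α) ≤ 2 ^ α * wt α x ^ 2 := by
    rw [wt_sq, ← Real.mul_rpow (by norm_num) (by positivity), Real.rpow_mul (by positivity)]
    refine Real.rpow_le_rpow (by positivity) ?_ hα
    exact_mod_cast h1
  rw [Real.rpow_neg (by positivity), inv_le_iff_one_le_mul₀ (by have := wt_pos α x; positivity)]
  have h3 : 0 < (1 + ‖x‖) ^ (2 * α) := by positivity
  rw [mul_right_comm, ← div_eq_mul_inv, one_le_div h3]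
  exact h2

/-- The sum is at most three times the longest of the three vectors, and the weight of that vector
is one of the terms on the right. The constant is `(3 ^ 2) ^ α`. -/
theorem wt_sq_add_le {n : ℕ} {α : ℝ} (hα : 0 ≤ α) (x y z : Pt n) :
    wt α (x + (y + z)) ^ 2 ≤ 9 ^ α * (wt α x ^ 2 + wt α y ^ 2 + wt α z ^ 2) := by
  set M := max (max ‖x‖ ‖y‖) ‖z‖ with hM
  have hM0 : 0 ≤ M := (norm_nonneg z).trans (le_max_right _ _)
  have h1 : ‖x + (y + z)‖ ≤ 3 * M := by
    refine (norm_add_le _ _).trans ?_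
    have := norm_add_le y z
    have : ‖x‖ ≤ M := (le_max_left _ _).trans (le_max_left _ _)
    have : ‖y‖ ≤ M := (le_max_right _ _).trans (le_max_left _ _)
    have : ‖z‖ ≤ M := le_max_right _ _
    linarith
  have h2 : wt α (x + (y + z)) ^ 2 ≤ 9 ^ α * (1 + (2 * Real.pi * M) ^ 2) ^ α := by
    rw [wt_sq, ← Real.mul_rpow (by norm_num) (by positivity)]
    refine Real.rpow_le_rpow (by positivity) ?_ hα
    have : (2 * Real.pi * ‖x + (y + z)‖) ^ 2 ≤ (2 * Real.pi * (3 * M)) ^ 2 := by gcongr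
    nlinarith
  refine h2.trans ?_
  gcongr
  have hx := sq_nonneg (wt α x)
  have hy := sq_nonneg (wt α y)
  have hz := sq_nonneg (wt α z)
  rcases max_choice (max ‖x‖ ‖y‖) ‖z‖ with h | h
  · rcases max_choice ‖x‖ ‖y‖ with h' | h'
    · rw [hM, h, h', ← wt_sq]; linarith
    · rw [hM, h, h', ← wt_sq]; linarith
  · rw [hM, h, ← wt_sq]; linarith

/-- The Japanese bracket to the power `-2α`. -/
def brk {n : ℕ} (α : ℝ) (x : Pt n) : ℝ≥0∞ := ENNReal.ofReal ((1 + ‖x‖) ^ (-(2 * α)))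

theorem measurable_brk {n : ℕ} (α : ℝ) : Measurable (brk (n := n) α) := by
  unfold brk; fun_prop

/-- After `wt_sq_add_le` each of the three numerators cancels one squared weight of the denominator,
so two inverse squared weights survive in each term. -/
theorem kernel_le {n : ℕ} {α : ℝ} (hα : 0 ≤ α) (x y z : Pt n) :
    ENNReal.ofReal ((wt α (x + (y + z)) / (wt α x * wt α y * wt α z)) ^ 2) ≤
      ENNReal.ofReal (9 ^ α * (2 ^ α * 2 ^ α)) *
        (brk α y * brk α z + brk α x * brk α z + brk α x * brk α y) := by
  have hx := wt_pos α x
  have hy := wt_pos α y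
  have hz := wt_pos α z
  unfold brk
  rw [← ENNReal.ofReal_mul (by positivity), ← ENNReal.ofReal_mul (by positivity),
    ← ENNReal.ofReal_mul (by positivity), ← ENNReal.ofReal_add (by positivity) (by positivity),
    ← ENNReal.ofReal_add (by positivity) (by positivity), ← ENNReal.ofReal_mul (by positivity)]
  refine ENNReal.ofReal_le_ofReal ?_
  have ix := inv_wt_sq_le hα x
  have iy := inv_wt_sq_le hα y
  have iz := inv_wt_sq_le hα z
  have key : ∀ a b : Pt n, (wt α a ^ 2)⁻¹ * (wt α b ^ 2)⁻¹ ≤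
      2 ^ α * 2 ^ α * ((1 + ‖a‖) ^ (-(2 * α)) * (1 + ‖b‖) ^ (-(2 * α))) := by
    intro a b
    calc _ ≤ (2 ^ α * (1 + ‖a‖) ^ (-(2 * α))) * (2 ^ α * (1 + ‖b‖) ^ (-(2 * α))) := by
          have := wt_pos α b
          gcongr
          · exact inv_wt_sq_le hα a
          · exact inv_wt_sq_le hα b
      _ = _ := by ring
  calc (wt α (x + (y + z)) / (wt α x * wt α y * wt α z)) ^ 2
      ≤ 9 ^ α * (wt α x ^ 2 + wt α y ^ 2 + wt α z ^ 2) / (wt α x * wt α y * wt α z) ^ 2 := by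
        rw [div_pow]
        gcongr
        exact wt_sq_add_le hα x y z
    _ = 9 ^ α * ((wt α y ^ 2)⁻¹ * (wt α z ^ 2)⁻¹ + (wt α x ^ 2)⁻¹ * (wt α z ^ 2)⁻¹
          + (wt α x ^ 2)⁻¹ * (wt α y ^ 2)⁻¹) := by
        field_simp
    _ ≤ 9 ^ α * (2 ^ α * 2 ^ α * ((1 + ‖y‖) ^ (-(2 * α)) * (1 + ‖z‖) ^ (-(2 * α)))
          + 2 ^ α * 2 ^ α * ((1 + ‖x‖) ^ (-(2 * α)) * (1 + ‖z‖) ^ (-(2 * α)))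
          + 2 ^ α * 2 ^ α * ((1 + ‖x‖) ^ (-(2 * α)) * (1 + ‖y‖) ^ (-(2 * α)))) := by
        exact mul_le_mul_of_nonneg_left
          (add_le_add (add_le_add (key y z) (key x z)) (key x y)) (by positivity)
    _ = _ := by ring

theorem continuous_norm_form {n : ℕ} (p : Pt n) : Continuous fun y : Pt n × Pt n =>
    (2 * Real.pi) ^ 2 * (‖y.1‖ ^ 2 - ‖y.2‖ ^ 2 + (‖p - (y.1 + y.2)‖ ^ 2 - ‖p‖ ^ 2)) := by
  fun_prop

theorem one_le_eight_pi_sq : 1 ≤ |8 * Real.pi ^ 2| := by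
  have := Real.pi_gt_three
  rw [abs_of_pos (by positivity)]
  nlinarith

/-- With `p` fixed the resonance function equals `-8π² ⟨y + y', p - y⟩`, affine in `y'` with
gradient proportional to `p - y`. The three terms of `kernel_le` are reduced to
`lintegral_japanese_density_le` by measure preserving substitutions. -/
theorem lintegral_kernel_le {n : ℕ} (hn : 2 ≤ n) {α : ℝ} (hα : ((n : ℝ) - 1) / 2 < α) :
    ∃ C : ℝ≥0∞, C < ⊤ ∧ ∀ (p : Pt n) (u : ℝ → ℝ≥0∞), Measurable u →
      ∫⁻ y : Pt n, ∫⁻ y' : Pt n,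
        ENNReal.ofReal ((wt α p / (wt α (p - (y + y')) * wt α y * wt α y')) ^ 2) *
          u ((2 * Real.pi) ^ 2 * (‖y‖ ^ 2 - ‖y'‖ ^ 2 + (‖p - (y + y')‖ ^ 2 - ‖p‖ ^ 2)))
        ≤ C * ∫⁻ x, u x := by
  have hn' : (2 : ℝ) ≤ n := by exact_mod_cast hn
  have hα0 : 0 ≤ α := by linarith
  obtain ⟨C, hC, hle⟩ := lintegral_japanese_density_le hn (r := 2 * α) (by linarith)
  refine ⟨ENNReal.ofReal (9 ^ α * (2 ^ α * 2 ^ α)) * (C + C + C),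
    ENNReal.mul_lt_top ENNReal.ofReal_lt_top (by simp [hC]), fun p u hu => ?_⟩
  set Q : Pt n → Pt n → ℝ := fun y y' =>
    (2 * Real.pi) ^ 2 * (‖y‖ ^ 2 - ‖y'‖ ^ 2 + (‖p - (y + y')‖ ^ 2 - ‖p‖ ^ 2)) with hQ
  have hQm : Measurable fun y : Pt n × Pt n => u (Q y.1 y.2) :=
    hu.comp (continuous_norm_form p).measurable
  have hb := measurable_brk (n := n) α
  have hQ' : ∀ y y', Q y y' = -(8 * Real.pi ^ 2) * inner ℝ (y + y') (p - y) := by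
    intro y y'
    simp only [hQ]
    rw [← real_inner_self_eq_norm_sq, ← real_inner_self_eq_norm_sq, ← real_inner_self_eq_norm_sq,
      ← real_inner_self_eq_norm_sq]
    simp only [inner_sub_left, inner_sub_right, inner_add_left, inner_add_right,
      real_inner_comm y p, real_inner_comm y' p, real_inner_comm y' y]
    ring
  have hA : ∫⁻ y : Pt n, ∫⁻ y' : Pt n, brk α y * (brk α y' * u (Q y y')) ≤ C * ∫⁻ x, u x := by
    refine le_trans (le_of_eq ?_) (hle p (-(8 * Real.pi ^ 2)) (by
      rw [abs_neg]; exact one_le_eight_pi_sq)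
      (fun y => -(8 * Real.pi ^ 2) * inner ℝ y (p - y)) u hu)
    refine lintegral_congr fun y => lintegral_congr fun y' => ?_
    unfold brk
    congr 3
    rw [hQ', real_inner_smul_left, real_inner_comm, inner_add_right, real_inner_comm y,
      real_inner_comm y']
    rw [real_inner_comm (p - y) y']
    ring
  -- Here `y' ↦ p - y - y'` makes the third frequency the inner variable; the gradient changes its
  -- sign.
  have hBC : ∫⁻ y : Pt n, ∫⁻ y' : Pt n, brk α y * (brk α (p - (y + y')) * u (Q y y'))
      ≤ C * ∫⁻ x, u x := by
    refine le_trans (le_of_eq ?_) (hle p (8 * Real.pi ^ 2) one_le_eight_pi_sq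
      (fun y => -(8 * Real.pi ^ 2) * inner ℝ p (p - y)) u hu)
    refine lintegral_congr fun y => ?_
    rw [← lintegral_sub_left_eq_self _ (p - y)]
    refine lintegral_congr fun y' => ?_
    unfold brk
    have e : p - (y + (p - y - y')) = y' := by abel
    rw [e]
    congr 3
    rw [hQ', real_inner_smul_left, show y + (p - y - y') = p - y' by abel, inner_sub_left,
      real_inner_comm y']
    ring
  -- For fixed `y'`, the reflection `y ↦ p - y' - y` exchanges `y` with `p - (y + y')` and `y + y'`
  -- with `p - y`. It preserves the resonance function and reduces this term to `hA`.
  have hD : ∫⁻ y : Pt n, ∫⁻ y' : Pt n, brk α (p - (y + y')) * (brk α y' * u (Q y y'))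
      ≤ C * ∫⁻ x, u x := by
    refine le_trans (le_of_eq ?_) hA
    have m1 : Measurable fun y : Pt n × Pt n =>
        brk α (p - (y.1 + y.2)) * (brk α y.2 * u (Q y.1 y.2)) :=
      (hb.comp (by fun_prop)).mul ((hb.comp measurable_snd).mul hQm)
    have m2 : Measurable fun y : Pt n × Pt n =>
        brk α y.1 * (brk α y.2 * u (Q y.1 y.2)) :=
      (hb.comp measurable_fst).mul ((hb.comp measurable_snd).mul hQm)
    rw [lintegral_lintegral_swap (f := fun y y' => brk α (p - (y + y')) * (brk α y' * u (Q y y')))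
        m1.aemeasurable, lintegral_lintegral_swap (f := fun y y' => brk α y * (brk α y' * u (Q y y')))
        m2.aemeasurable]
    refine lintegral_congr fun y' => ?_
    rw [← lintegral_sub_left_eq_self _ (p - y')]
    refine lintegral_congr fun y => ?_
    rw [show p - (p - y' - y + y') = y by abel, hQ', hQ',
      show p - y' - y + y' = p - y by abel, show p - (p - y' - y) = y + y' by abel,
      real_inner_comm]
  have m3 : Measurable fun y : Pt n × Pt n => brk α y.1 * (brk α y.2 * u (Q y.1 y.2)) :=
    (hb.comp measurable_fst).mul ((hb.comp measurable_snd).mul hQm)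
  have m4 : Measurable fun y : Pt n × Pt n =>
      brk α (p - (y.1 + y.2)) * (brk α y.2 * u (Q y.1 y.2)) :=
    (hb.comp (by fun_prop)).mul ((hb.comp measurable_snd).mul hQm)
  have m5 : Measurable fun y : Pt n × Pt n =>
      brk α y.1 * (brk α (p - (y.1 + y.2)) * u (Q y.1 y.2)) :=
    (hb.comp measurable_fst).mul ((hb.comp (by fun_prop)).mul hQm)
  calc _ ≤ ∫⁻ y : Pt n, ∫⁻ y' : Pt n, ENNReal.ofReal (9 ^ α * (2 ^ α * 2 ^ α)) *
          (brk α y * (brk α y' * u (Q y y')) + brk α (p - (y + y')) * (brk α y' * u (Q y y'))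
            + brk α y * (brk α (p - (y + y')) * u (Q y y'))) := by
        refine lintegral_mono fun y => lintegral_mono fun y' => ?_
        have := kernel_le hα0 (p - (y + y')) y y'
        rw [sub_add_cancel] at this
        refine (mul_le_mul_left this _).trans (le_of_eq ?_)
        simp only [hQ]
        ring
    _ = ENNReal.ofReal (9 ^ α * (2 ^ α * 2 ^ α)) *
          ((∫⁻ y : Pt n, ∫⁻ y' : Pt n, brk α y * (brk α y' * u (Q y y')))
            + (∫⁻ y : Pt n, ∫⁻ y' : Pt n, brk α (p - (y + y')) * (brk α y' * u (Q y y')))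
            + (∫⁻ y : Pt n, ∫⁻ y' : Pt n, brk α y * (brk α (p - (y + y')) * u (Q y y')))) := by
        have e : ∀ F : Pt n × Pt n → ℝ≥0∞, Measurable F →
            ∫⁻ y, ∫⁻ y', F (y, y') = ∫⁻ z, F z ∂(volume.prod volume) :=
          fun F hF => (lintegral_prod _ hF.aemeasurable).symm
        rw [e _ m3, e _ m4, e _ m5, ← lintegral_add_right _ m4, ← lintegral_add_right _ m5,
          ← lintegral_const_mul' _ _ ENNReal.ofReal_ne_top]
        exact e (fun z => _) (((m3.add m4).add m5).const_mul _)
    _ ≤ _ := by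
        rw [mul_assoc]
        refine mul_le_mul_right ?_ _
        rw [add_mul, add_mul]
        exact add_le_add (add_le_add hA hD) hBC

theorem lintegral_volume_prod {X Y : Type*} [MeasureSpace X] [MeasureSpace Y]
    [SFinite (volume : Measure X)] [SFinite (volume : Measure Y)] {f : X × Y → ℝ≥0∞}
    (hf : Measurable f) : ∫⁻ z, f z = ∫⁻ x, ∫⁻ y, f (x, y) :=
  lintegral_prod f hf.aemeasurable

theorem lintegral_volume_prod_symm {X Y : Type*} [MeasureSpace X] [MeasureSpace Y]
    [SFinite (volume : Measure X)] [SFinite (volume : Measure Y)] {f : X × Y → ℝ≥0∞}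
    (hf : Measurable f) : ∫⁻ z, f z = ∫⁻ y, ∫⁻ x, f (x, y) :=
  lintegral_prod_symm f hf.aemeasurable

theorem lintegral_shear {X Y : Type*} [MeasureSpace X] [MeasureSpace Y] [AddGroup X]
    [MeasurableAdd₂ X] [SFinite (volume : Measure X)] [SFinite (volume : Measure Y)]
    [(volume : Measure X).IsAddRightInvariant] {G : X × Y → ℝ≥0∞} (hG : Measurable G)
    {s : Y → X} (hs : Measurable s) :
    ∫⁻ w : X × Y, G (w.1 + s w.2, w.2) = ∫⁻ x, ∫⁻ y, G (x, y) := by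
  rw [← lintegral_volume_prod hG, lintegral_volume_prod_symm hG,
    lintegral_volume_prod_symm (by fun_prop)]
  exact lintegral_congr fun y => lintegral_add_right_eq_self (fun x => G (x, y)) (s y)

theorem measurable_kernel {n : ℕ} (α : ℝ) : Measurable fun w : Pt n × (Pt n × Pt n) =>
    ENNReal.ofReal ((wt α w.1 / (wt α (w.1 - (w.2.1 + w.2.2)) * wt α w.2.1 * wt α w.2.2)) ^ 2) := by
  have hwt := (continuous_wt (n := n) α).measurable
  refine ENNReal.measurable_ofReal.comp (Measurable.pow_const (Measurable.div ?_ (Measurable.mul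
    (Measurable.mul ?_ ?_) ?_)) 2)
  · exact hwt.comp measurable_fst
  · exact hwt.comp (measurable_fst.sub (measurable_snd.fst.add measurable_snd.snd))
  · exact hwt.comp measurable_snd.fst
  · exact hwt.comp measurable_snd.snd

theorem measurable_resonance {n : ℕ} (s : ℝ) : Measurable fun w : Pt n × (Pt n × Pt n) =>
    (2 * Real.pi) ^ 2 * (‖w.2.1‖ ^ 2 - ‖w.2.2‖ ^ 2
      + s * (‖w.1 - (w.2.1 + w.2.2)‖ ^ 2 - ‖w.1‖ ^ 2)) :=
  Continuous.measurable (by fun_prop)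

/-- The sign `-1` belongs to collisions at primed coordinates. Exchanging `y` and `y'` changes the
sign of the whole resonance function, and the integral of `u` is invariant under reflection. -/
theorem lintegral_kernel_sign_le {n : ℕ} (hn : 2 ≤ n) {α : ℝ} (hα : ((n : ℝ) - 1) / 2 < α) :
    ∃ C : ℝ≥0∞, C < ⊤ ∧ ∀ (s : ℝ), (s = 1 ∨ s = -1) → ∀ (p : Pt n) (u : ℝ → ℝ≥0∞),
      Measurable u →
      ∫⁻ y : Pt n × Pt n,
        ENNReal.ofReal ((wt α p / (wt α (p - (y.1 + y.2)) * wt α y.1 * wt α y.2)) ^ 2) *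
          u ((2 * Real.pi) ^ 2 * (‖y.1‖ ^ 2 - ‖y.2‖ ^ 2
            + s * (‖p - (y.1 + y.2)‖ ^ 2 - ‖p‖ ^ 2)))
        ≤ C * ∫⁻ x, u x := by
  obtain ⟨C, hC, hle⟩ := lintegral_kernel_le hn hα
  refine ⟨C, hC, fun s hs p u hu => ?_⟩
  have hm : Measurable fun y : Pt n × Pt n =>
      ENNReal.ofReal ((wt α p / (wt α (p - (y.1 + y.2)) * wt α y.1 * wt α y.2)) ^ 2) *
          u ((2 * Real.pi) ^ 2 * (‖y.1‖ ^ 2 - ‖y.2‖ ^ 2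
            + s * (‖p - (y.1 + y.2)‖ ^ 2 - ‖p‖ ^ 2))) := by
    have h1 := (measurable_kernel α).comp (measurable_prodMk_left (x := p))
    have h2 := hu.comp ((measurable_resonance s).comp (measurable_prodMk_left (x := p)))
    exact h1.mul h2
  rcases hs with rfl | rfl
  · refine (lintegral_volume_prod hm).le.trans ?_
    simpa only [one_mul] using hle p u hu
  · refine (lintegral_volume_prod_symm hm).le.trans ?_
    refine (le_trans (le_of_eq ?_) (hle p (fun τ => u (-τ)) (hu.comp measurable_neg))).trans
      (le_of_eq ?_)
    · refine lintegral_congr fun y => lintegral_congr fun y' => ?_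
      rw [add_comm y' y, mul_right_comm _ (wt α y') (wt α y)]
      congr 3
      ring
    · rw [lintegral_neg_eq_self]

/-- The squared collision kernel has uniformly bounded density along the resonance function. -/
theorem lintegral_merge_le {n : ℕ} (hn : 2 ≤ n) {α : ℝ} (hα : ((n : ℝ) - 1) / 2 < α) :
    ∃ C : ℝ≥0∞, C < ⊤ ∧ ∀ (k : ℕ) (i : Fin k ⊕ Fin k) (q : Fin (k + 1))
      (u : ℝ × Conf n k → ℝ≥0∞), Measurable u →
      ∫⁻ z : Conf n (k + 1),
        ENNReal.ofReal ((sobolevWeight α (merge i q z) / sobolevWeight α z) ^ 2) *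
          u (energy z - energy (merge i q z), merge i q z)
        ≤ C * ∫⁻ p : ℝ × Conf n k, u p := by
  obtain ⟨C, hC, hle⟩ := lintegral_kernel_sign_le hn hα
  refine ⟨C, hC, fun k i q u hu => ?_⟩
  set κ : Pt n → Pt n → Pt n → ℝ≥0∞ := fun p y y' =>
    ENNReal.ofReal ((wt α p / (wt α (p - (y + y')) * wt α y * wt α y')) ^ 2) with hκ
  set Q : Pt n → Pt n → Pt n → ℝ := fun p y y' =>
    (2 * Real.pi) ^ 2 * (‖y‖ ^ 2 - ‖y'‖ ^ 2 + sgn i * (‖p - (y + y')‖ ^ 2 - ‖p‖ ^ 2)) with hQ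
  obtain ⟨G, hG⟩ : ∃ G : Conf n k × (Pt n × Pt n) → ℝ≥0∞, G = fun w =>
    κ (w.1 i) w.2.1 w.2.2 * u (Q (w.1 i) w.2.1 w.2.2, w.1) := ⟨_, rfl⟩
  have hcoord : Measurable fun w : Conf n k × (Pt n × Pt n) => (w.1 i, w.2) :=
    Continuous.measurable (by fun_prop)
  have hGm : Measurable G := by
    rw [hG]
    have h1 := (measurable_kernel α).comp hcoord
    have h2 := hu.comp (((measurable_resonance (sgn i)).comp hcoord).prodMk measurable_fst)
    exact h1.mul h2
  have hshift : ∀ (z : Conf n k) (y y' : Pt n),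
      merge i q (insConf q (z, (y, y'))) = z + WithLp.toLp 2 (Pi.single i (y + y')) := by
    intro z y y'
    simp [merge]
  have h1 : ∀ w : Conf n k × (Pt n × Pt n),
      ENNReal.ofReal ((sobolevWeight α (merge i q (insConf q w)) /
          sobolevWeight α (insConf q w)) ^ 2) *
          u (energy (insConf q w) - energy (merge i q (insConf q w)), merge i q (insConf q w))
        = G (w.1 + WithLp.toLp 2 (Pi.single i (w.2.1 + w.2.2)), w.2) := by
    rintro ⟨z, y, y'⟩
    have hz : (insConf q (z, (y, y'))) (i.map q.succAbove q.succAbove) = z i := by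
      rcases i with i | i <;> simp
    rw [sobolevWeight_merge_div, energy_sub_merge, hz, insConf_inl, insConf_inr, hshift]
    simp only [hG, hκ, hQ]
    simp
  have hcont : Measurable fun y : Pt n × Pt n =>
      (WithLp.toLp 2 (Pi.single i (y.1 + y.2)) : Conf n k) :=
    ((PiLp.continuous_toLp 2 _).comp
      ((continuous_single i).comp (continuous_fst.add continuous_snd))).measurable
  -- Translating the coordinate `i` by `y + y'` turns the merged frequency into an independent
  -- variable, which can then be frozen while `y` and `y'` are integrated.
  have s1 := lintegral_shear hGm hcont
  have s3 : ∀ z : Conf n k, ∫⁻ y : Pt n × Pt n, G (z, y) ≤ C * ∫⁻ τ, u (τ, z) := by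
    intro z
    rw [hG]
    exact hle (sgn i) (by rcases i with i | i <;> simp [sgn]) (z i) (fun τ => u (τ, z))
      (hu.comp measurable_prodMk_right)
  have s4 : ∫⁻ p : ℝ × Conf n k, u p = ∫⁻ z : Conf n k, ∫⁻ τ, u (τ, z) :=
    lintegral_volume_prod_symm hu
  rw [lintegral_insConf q, s4, ← lintegral_const_mul' _ _ hC.ne]
  refine (lintegral_congr h1).le.trans ?_
  rw [s1]
  exact lintegral_mono s3

end

end GPHierarchy

namespace GPHierarchy

noncomputable section

/-! ### Fourier transforms of functions in `L¹ ∩ L²` -/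

section Fourier

variable {V : Type*} [NormedAddCommGroup V] [InnerProductSpace ℝ V] [FiniteDimensional ℝ V]
  [MeasurableSpace V] [BorelSpace V]

theorem continuous_fourierInv {f : V → ℂ} (hf : Integrable f) : Continuous (𝓕⁻ f) :=
  VectorFourier.fourierIntegral_continuous Real.continuous_fourierChar
    (by exact (continuous_fst.inner continuous_snd).neg) hf

theorem norm_fourierInv_le (f : V → ℂ) (ξ : V) : ‖𝓕⁻ f ξ‖ ≤ ∫ x, ‖f x‖ :=
  VectorFourier.norm_fourierIntegral_le_integral_norm _ _ _ _ _

theorem integral_fourierInv_mul_eq {f g : V → ℂ} (hf : Integrable f) (hg : Integrable g) :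
    ∫ ξ, 𝓕⁻ f ξ * g ξ = ∫ x, f x * 𝓕⁻ g x := by
  have := VectorFourier.integral_fourierIntegral_smul_eq_flip (μ := (volume : Measure V))
    (ν := (volume : Measure V)) (L := -innerₗ V) (e := Real.fourierChar) (f := f) (g := g)
    Real.continuous_fourierChar (by exact (continuous_fst.inner continuous_snd).neg) hf hg
  have e : (-innerₗ V).flip = -innerₗ V := by
    ext x y
    simp [real_inner_comm]
  rw [e] at this
  exact this

/-- Testing against smooth compactly supported functions suffices. The transform is moved onto the
test function on both sides, through tempered distributions for the `L²` transform and by Fubini for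
the integral. -/
theorem fourierInv_toLp_ae_eq {f : V → ℂ} (h1 : Integrable f) (h2 : MemLp f 2) :
    ((𝓕⁻ (h2.toLp f) : Lp (α := V) ℂ 2 (volume : Measure V)) : V → ℂ) =ᵐ[volume] 𝓕⁻ f := by
  refine ae_eq_of_integral_contDiff_smul_eq
    ((Lp.memLp _).locallyIntegrable one_le_two)
    (continuous_fourierInv h1).locallyIntegrable fun g hg hgs => ?_
  have hgc : ContDiff ℝ ∞ fun x => (g x : ℂ) := Complex.ofRealCLM.contDiff.comp hg
  have hgcs : HasCompactSupport fun x => (g x : ℂ) := hgs.comp_left Complex.ofReal_zero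
  set G : SchwartzMap V ℂ := hgcs.toSchwartzMap hgc with hG
  have e1 : ∫ x, g x • (𝓕⁻ (h2.toLp f) : Lp (α := V) ℂ 2 (volume : Measure V)) x
      = Lp.toTemperedDistribution (𝓕⁻ (h2.toLp f) : Lp (α := V) ℂ 2 (volume : Measure V)) G := by
    rw [Lp.toTemperedDistribution_apply]
    rfl
  rw [e1, ← Lp.fourierInv_toTemperedDistribution_eq, TemperedDistribution.fourierInv_apply,
    Lp.toTemperedDistribution_apply]
  have e2 : ∫ x, (𝓕⁻ G : SchwartzMap V ℂ) x • (h2.toLp f : V → ℂ) x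
      = ∫ x, 𝓕⁻ (G : V → ℂ) x * f x := by
    refine integral_congr_ae ?_
    filter_upwards [h2.coeFn_toLp] with x hx
    rw [hx, SchwartzMap.fourierInv_coe]
    rfl
  rw [e2, integral_fourierInv_mul_eq G.integrable h1]
  refine integral_congr_ae (Eventually.of_forall fun x => ?_)
  simp [hG]

theorem lintegral_enorm_fourierInv_sq {f : V → ℂ} (h1 : Integrable f) (h2 : MemLp f 2) :
    ∫⁻ ξ, ‖𝓕⁻ f ξ‖ₑ ^ 2 = ∫⁻ x, ‖f x‖ₑ ^ 2 := by
  have h3 : ∀ g : Lp (α := V) ℂ 2 (volume : Measure V), ∫⁻ x, ‖g x‖ₑ ^ 2 = ‖g‖ₑ ^ 2 := by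
    intro g
    rw [Lp.enorm_def, eLpNorm_eq_lintegral_rpow_enorm_toReal (by norm_num) (by norm_num),
      ← ENNReal.rpow_natCast, ← ENNReal.rpow_mul]
    norm_num
  have h4 : ‖(𝓕⁻ (h2.toLp f) : Lp (α := V) ℂ 2 (volume : Measure V))‖ₑ = ‖h2.toLp f‖ₑ := by
    have := Lp.norm_fourier_eq (𝓕⁻ (h2.toLp f) : Lp (α := V) ℂ 2 (volume : Measure V))
    rw [FourierTransform.fourier_fourierInv_eq] at this
    rw [← ofReal_norm, ← ofReal_norm, this]
  calc _ = ∫⁻ ξ, ‖(𝓕⁻ (h2.toLp f) : Lp (α := V) ℂ 2 (volume : Measure V)) ξ‖ₑ ^ 2 := by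
        refine lintegral_congr_ae ?_
        filter_upwards [fourierInv_toLp_ae_eq h1 h2] with x hx
        rw [hx]
    _ = ∫⁻ x, ‖h2.toLp f x‖ₑ ^ 2 := by rw [h3, h3, h4]
    _ = _ := by
        refine lintegral_congr_ae ?_
        filter_upwards [h2.coeFn_toLp] with x hx
        rw [hx]

end Fourier

/-- Plancherel on the line. The factor `2π` comes from rescaling the frequency, since the transform
has the phase `2π t ξ`. -/
theorem lintegral_enorm_oscillatory_sq {f : ℝ → ℂ} (h1 : Integrable f) (h2 : MemLp f 2) :
    ∫⁻ τ : ℝ, ‖∫ t, Complex.exp ((t * τ : ℝ) * Complex.I) * f t‖ₑ ^ 2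
      = ENNReal.ofReal (2 * Real.pi) * ∫⁻ t, ‖f t‖ₑ ^ 2 := by
  rw [← lintegral_enorm_fourierInv_sq h1 h2]
  have hm : Measurable fun ξ : ℝ => ‖𝓕⁻ f ξ‖ₑ ^ 2 :=
    ((continuous_fourierInv h1).measurable.enorm).pow_const 2
  have := lintegral_comp_affine (a := (2 * Real.pi)⁻¹) (by positivity) 0 hm
  rw [inv_inv, abs_of_pos (by positivity)] at this
  rw [← this]
  refine lintegral_congr fun τ => ?_
  rw [Real.fourierInv_eq']
  congr 2
  refine integral_congr_ae (Eventually.of_forall fun t => ?_)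
  simp only [zero_add, smul_eq_mul]
  congr 3
  have : (Real.pi : ℂ) ≠ 0 := by exact_mod_cast Real.pi_ne_zero
  push_cast
  simp
  field_simp

end

end GPHierarchy

/-! ### The space-time estimate for a single collision -/

namespace GPHierarchy

noncomputable section

/-- The range of dimensions and regularities for which the bilinear estimate holds. -/
structure Adm (n : ℕ) (α : ℝ) : Prop where
  dim : 2 ≤ n
  reg : ((n : ℝ) - 1) / 2 < α

theorem Adm.nonneg {n : ℕ} {α : ℝ} (H : Adm n α) : 0 ≤ α := by
  have h1 := H.reg
  have h2 : (2 : ℝ) ≤ n := by exact_mod_cast H.dim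
  linarith

/-- Lebesgue measure on `[0,T]`. -/
def tm (T : ℝ) : Measure ℝ := volume.restrict (Icc 0 T)

instance (T : ℝ) : IsFiniteMeasure (tm T) := by unfold tm; infer_instance

/-- The kernel of the collision operator between Sobolev spaces. -/
def kern {n k : ℕ} (α : ℝ) (i : Fin k ⊕ Fin k) (q : Fin (k + 1)) (z : Conf n (k + 1)) : ℝ :=
  sobolevWeight α (merge i q z) / sobolevWeight α z

theorem continuous_kern {n k : ℕ} (α : ℝ) (i : Fin k ⊕ Fin k) (q : Fin (k + 1)) :
    Continuous (kern (n := n) α i q) :=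
  ((continuous_sobolevWeight α).comp (continuous_merge i q)).div (continuous_sobolevWeight α)
    fun z => (sobolevWeight_pos α z).ne'

theorem kern_pos {n k : ℕ} (α : ℝ) (i : Fin k ⊕ Fin k) (q : Fin (k + 1)) (z : Conf n (k + 1)) :
    0 < kern α i q z := div_pos (sobolevWeight_pos α _) (sobolevWeight_pos α _)

/-- Only boundedness matters: it lets the collision step preserve bounded test functions. As all
weights are at least `1`, each of the three terms of `wt_sq_add_le` is at most the product of the
three squared weights. -/
theorem kern_le {n k : ℕ} {α : ℝ} (hα : 0 ≤ α) (i : Fin k ⊕ Fin k) (q : Fin (k + 1))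
    (z : Conf n (k + 1)) : kern α i q z ≤ √(9 ^ α * 3) := by
  refine Real.le_sqrt_of_sq_le ?_
  rw [kern, sobolevWeight_merge_div, div_pow, div_le_iff₀]
  swap
  · have h1 := wt_pos α (z (i.map q.succAbove q.succAbove))
    have h2 := wt_pos α (z (Sum.inl q))
    have h3 := wt_pos α (z (Sum.inr q))
    positivity
  refine (wt_sq_add_le hα _ _ _).trans ?_
  have h1 := one_le_wt hα (z (i.map q.succAbove q.succAbove))
  have h2 := one_le_wt hα (z (Sum.inl q))
  have h3 := one_le_wt hα (z (Sum.inr q))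
  set a := wt α (z (i.map q.succAbove q.succAbove))
  set b := wt α (z (Sum.inl q))
  set c := wt α (z (Sum.inr q))
  have ha : 1 ≤ a ^ 2 := one_le_pow₀ h1
  have hb : 1 ≤ b ^ 2 := one_le_pow₀ h2
  have hc : 1 ≤ c ^ 2 := one_le_pow₀ h3
  have hbc : 1 ≤ b ^ 2 * c ^ 2 := one_le_mul_of_one_le_of_one_le hb hc
  have hac : 1 ≤ a ^ 2 * c ^ 2 := one_le_mul_of_one_le_of_one_le ha hc
  have hab : 1 ≤ a ^ 2 * b ^ 2 := one_le_mul_of_one_le_of_one_le ha hb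
  rw [mul_assoc]
  refine mul_le_mul_of_nonneg_left ?_ (by positivity)
  nlinarith [mul_le_mul_of_nonneg_left hbc (sq_nonneg a), mul_le_mul_of_nonneg_left hac (sq_nonneg b),
    mul_le_mul_of_nonneg_left hab (sq_nonneg c)]

/-- The resonance function. -/
def phase {n k : ℕ} (i : Fin k ⊕ Fin k) (q : Fin (k + 1)) (z : Conf n (k + 1)) : ℝ :=
  energy z - energy (merge i q z)

theorem continuous_phase {n k : ℕ} (i : Fin k ⊕ Fin k) (q : Fin (k + 1)) :
    Continuous (phase (n := n) i q) :=
  continuous_energy.sub (continuous_energy.comp (continuous_merge i q))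

/-- The adjoint of the collision operator in the interaction picture. -/
def stepFun {n k : ℕ} (α T : ℝ) (i : Fin k ⊕ Fin k) (q : Fin (k + 1)) (G : ℝ → Conf n k → ℂ)
    (z : Conf n (k + 1)) : ℂ :=
  (kern α i q z : ℂ) * ∫ t, Complex.exp ((t * phase i q z : ℝ) * Complex.I) * G t (merge i q z) ∂tm T

/-- The square of `stepFun` is the squared kernel times `u(phase, merge)`, where `u(τ, ξ)` is the
squared modulus of the time Fourier integral of `G` at the merged frequency `ξ`. Bounded density
(`lintegral_merge_le`) replaces the integral over `k + 1` particles by that of `u`, and Plancherel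
in time evaluates it. -/
theorem exists_collision_bound {n : ℕ} {α : ℝ} (H : Adm n α) :
    ∃ C : ℝ≥0, ∀ (k : ℕ) (i : Fin k ⊕ Fin k) (q : Fin (k + 1)) (T : ℝ) (G : ℝ → Conf n k → ℂ),
      Measurable (Function.uncurry G) → (∃ M : ℝ, ∀ t ξ, ‖G t ξ‖ ≤ M) →
      ∫⁻ z, ‖stepFun α T i q G z‖ₑ ^ 2 ≤ C * ∫⁻ t, ∫⁻ ξ, ‖G t ξ‖ₑ ^ 2 ∂volume ∂tm T := by
  obtain ⟨C, hC, hle⟩ := lintegral_merge_le H.dim H.reg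
  refine ⟨(C * ENNReal.ofReal (2 * Real.pi)).toNNReal, fun k i q T G hG ⟨M, hM⟩ => ?_⟩
  rw [ENNReal.coe_toNNReal (ENNReal.mul_lt_top hC ENNReal.ofReal_lt_top).ne]
  set F : ℝ → Conf n k → ℂ := fun t ξ => (Icc (0 : ℝ) T).indicator (fun t => G t ξ) t with hF
  have hFm : Measurable (Function.uncurry F) := by
    have : Function.uncurry F = (Prod.fst ⁻¹' Icc (0 : ℝ) T).indicator (Function.uncurry G) := by
      ext ⟨t, ξ⟩
      simp [F, indicator]
    rw [this]
    exact hG.indicator (measurable_fst measurableSet_Icc)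
  have hGs : ∀ ξ, MemLp (fun t => G t ξ) ⊤ (tm T) := fun ξ =>
    memLp_top_of_bound (hG.comp measurable_prodMk_right).aestronglyMeasurable M
      (Eventually.of_forall fun t => hM t ξ)
  have hF1 : ∀ ξ, Integrable (fun t => F t ξ) := fun ξ =>
    (integrable_indicator_iff measurableSet_Icc).2
      (memLp_one_iff_integrable.1 ((hGs ξ).mono_exponent le_top))
  have hF2 : ∀ ξ, MemLp (fun t => F t ξ) 2 := fun ξ =>
    (memLp_indicator_iff_restrict measurableSet_Icc).2 ((hGs ξ).mono_exponent le_top)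
  obtain ⟨u, hu⟩ : ∃ u : ℝ × Conf n k → ℝ≥0∞, u = fun p =>
    ‖∫ t, Complex.exp ((t * p.1 : ℝ) * Complex.I) * F t p.2‖ₑ ^ 2 := ⟨_, rfl⟩
  have hum : Measurable u := by
    rw [hu]
    have h1 : Measurable fun w : (ℝ × Conf n k) × ℝ =>
        Complex.exp ((w.2 * w.1.1 : ℝ) * Complex.I) * F w.2 w.1.2 :=
      Measurable.mul (Continuous.measurable (by fun_prop))
        (hFm.comp (measurable_snd.prodMk measurable_fst.snd))
    exact (h1.stronglyMeasurable.integral_prod_right).measurable.enorm.pow_const 2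
  have h1 : ∀ z, ‖stepFun α T i q G z‖ₑ ^ 2 =
      ENNReal.ofReal ((sobolevWeight α (merge i q z) / sobolevWeight α z) ^ 2) *
          u (energy z - energy (merge i q z), merge i q z) := by
    intro z
    have e1 : ∫ t, Complex.exp ((t * phase i q z : ℝ) * Complex.I) * G t (merge i q z) ∂tm T
        = ∫ t, Complex.exp ((t * phase i q z : ℝ) * Complex.I) * F t (merge i q z) := by
      rw [tm, ← integral_indicator measurableSet_Icc]
      refine integral_congr_ae (Eventually.of_forall fun t => ?_)
      by_cases ht : t ∈ Icc 0 T <;> simp [F, ht]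
    rw [stepFun, e1, enorm_mul, mul_pow, hu]
    congr 1
    rw [← ofReal_norm, ← ENNReal.ofReal_pow (norm_nonneg _), Complex.norm_real, Real.norm_eq_abs,
      sq_abs, kern]
  have s2 : ∀ ξ, ∫⁻ τ, u (τ, ξ) = ENNReal.ofReal (2 * Real.pi) * ∫⁻ t, ‖G t ξ‖ₑ ^ 2 ∂tm T := by
    intro ξ
    rw [hu]
    refine (lintegral_enorm_oscillatory_sq (hF1 ξ) (hF2 ξ)).trans ?_
    rw [tm, ← lintegral_indicator measurableSet_Icc]
    congr 1
    refine lintegral_congr fun t => ?_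
    by_cases ht : t ∈ Icc 0 T <;> simp [F, ht]
  have s3 : ∫⁻ ξ, ∫⁻ t, ‖G t ξ‖ₑ ^ 2 ∂tm T = ∫⁻ t, ∫⁻ ξ, ‖G t ξ‖ₑ ^ 2 ∂volume ∂tm T :=
    lintegral_lintegral_swap (f := fun ξ t => ‖G t ξ‖ₑ ^ 2)
      ((hG.comp measurable_swap).enorm.pow_const 2).aemeasurable
  rw [lintegral_congr h1, mul_assoc, ← s3, ← lintegral_const_mul' _ _ ENNReal.ofReal_ne_top,
    ← lintegral_congr s2, ← lintegral_volume_prod_symm hum]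
  exact hle k i q u hum

/-- The constant in the space-time estimate for the collision operator. -/
def kmConst {n : ℕ} {α : ℝ} (H : Adm n α) : ℝ≥0 := Classical.choose (exists_collision_bound H)

theorem collision_bound {n : ℕ} {α : ℝ} (H : Adm n α) {k : ℕ} (i : Fin k ⊕ Fin k) (q : Fin (k + 1))
    (T : ℝ) {G : ℝ → Conf n k → ℂ} (hG : Measurable (Function.uncurry G))
    (hb : ∃ M : ℝ, ∀ t ξ, ‖G t ξ‖ ≤ M) :
    ∫⁻ z, ‖stepFun α T i q G z‖ₑ ^ 2 ≤ kmConst H * ∫⁻ t, ∫⁻ ξ, ‖G t ξ‖ₑ ^ 2 ∂volume ∂tm T :=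
  Classical.choose_spec (exists_collision_bound H) k i q T G hG hb

/-! ### Families of test functions -/

theorem eLpNorm_two_sq {X : Type*} [MeasurableSpace X] {μ : Measure X} (f : X → ℂ) :
    eLpNorm f 2 μ ^ 2 = ∫⁻ x, ‖f x‖ₑ ^ 2 ∂μ := by
  rw [eLpNorm_eq_lintegral_rpow_enorm_toReal (by norm_num) (by norm_num), ← ENNReal.rpow_natCast,
    ← ENNReal.rpow_mul]
  norm_num

/-- Bounded measurable families of bounded functions on `Conf n k`, with bounded `L²` norms. -/
def TestOn (X : Type) [MeasurableSpace X] (n k : ℕ) : Submodule ℂ (X → Conf n k → ℂ) where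
  carrier := {ψ | Measurable (Function.uncurry ψ) ∧ (∃ M : ℝ, ∀ x ξ, ‖ψ x ξ‖ ≤ M) ∧
    ∃ M : ℝ≥0, ∀ x, eLpNorm (ψ x) 2 volume ≤ M}
  zero_mem' := ⟨measurable_const, ⟨0, by simp⟩, ⟨0, by simp⟩⟩
  add_mem' := by
    rintro a b ⟨ha, ⟨Ma, hMa⟩, ⟨Na, hNa⟩⟩ ⟨hb, ⟨Mb, hMb⟩, ⟨Nb, hNb⟩⟩
    refine ⟨ha.add hb, ⟨Ma + Mb, fun x ξ => (norm_add_le _ _).trans (add_le_add (hMa _ _) (hMb _ _))⟩,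
      ⟨Na + Nb, fun x => ?_⟩⟩
    push_cast
    exact (eLpNorm_add_le (ha.comp measurable_prodMk_left).aestronglyMeasurable
      (hb.comp measurable_prodMk_left).aestronglyMeasurable one_le_two).trans
        (add_le_add (hNa x) (hNb x))
  smul_mem' := by
    rintro c a ⟨ha, ⟨Ma, hMa⟩, ⟨Na, hNa⟩⟩
    refine ⟨ha.const_smul c, ⟨‖c‖ * Ma, fun x ξ => ?_⟩, ⟨‖c‖₊ * Na, fun x => ?_⟩⟩
    · exact (norm_smul c (a x ξ)).le.trans (mul_le_mul_of_nonneg_left (hMa _ _) (norm_nonneg _))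
    · push_cast
      exact (eLpNorm_const_smul_le (c := c) (f := a x)).trans (mul_le_mul_right (hNa x) _)

section

variable {X Y : Type} [MeasurableSpace X] [MeasurableSpace Y] {n k : ℕ}

theorem TestOn.measurable (ψ : TestOn X n k) : Measurable (Function.uncurry ψ.1) := ψ.2.1

theorem TestOn.bounded (ψ : TestOn X n k) : ∃ M : ℝ, ∀ x ξ, ‖ψ.1 x ξ‖ ≤ M := ψ.2.2.1

theorem TestOn.bounded_L2 (ψ : TestOn X n k) : ∃ M : ℝ≥0, ∀ x, eLpNorm (ψ.1 x) 2 volume ≤ M :=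
  ψ.2.2.2

theorem TestOn.measurable_slice (ψ : TestOn X n k) (x : X) : Measurable (ψ.1 x) :=
  ψ.2.1.comp measurable_prodMk_left

theorem TestOn.memLp (ψ : TestOn X n k) (x : X) : MemLp (ψ.1 x) 2 volume := by
  obtain ⟨M, hM⟩ := (TestOn.bounded_L2 ψ)
  exact ⟨((TestOn.measurable_slice ψ) x).aestronglyMeasurable, (hM x).trans_lt ENNReal.coe_lt_top⟩

/-- The value of a family at a point of the parameter space, as an element of `L²`. -/
def slice (x : X) : TestOn X n k →ₗ[ℂ] L2 n k where
  toFun ψ := (TestOn.memLp ψ x).toLp _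
  map_add' _ _ := rfl
  map_smul' _ _ := rfl

theorem coeFn_slice (x : X) (ψ : TestOn X n k) : slice x ψ =ᵐ[volume] ψ.1 x :=
  (TestOn.memLp ψ x).coeFn_toLp

theorem enorm_slice_sq (x : X) (ψ : TestOn X n k) :
    ‖slice x ψ‖ₑ ^ 2 = ∫⁻ ξ, ‖ψ.1 x ξ‖ₑ ^ 2 := by
  rw [← eLpNorm_two_sq, Lp.enorm_def, eLpNorm_congr_ae (coeFn_slice x ψ)]

/-- Change of parameters. -/
def pull (g : Y → X) (hg : Measurable g) : TestOn X n k →ₗ[ℂ] TestOn Y n k where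
  toFun ψ := ⟨fun y => ψ.1 (g y), (TestOn.measurable ψ).comp ((hg.comp measurable_fst).prodMk measurable_snd),
    (TestOn.bounded ψ).imp fun _ hM _ ξ => hM _ ξ, (TestOn.bounded_L2 ψ).imp fun _ hM _ => hM _⟩
  map_add' _ _ := rfl
  map_smul' _ _ := rfl

@[simp] theorem pull_apply (g : Y → X) (hg : Measurable g) (ψ : TestOn X n k) (y : Y) :
    (pull g hg ψ).1 y = ψ.1 (g y) := rfl

/-- Multiplication by a bounded function of the parameters. -/
def mulc (c : X → ℂ) (hc : Measurable c) (hb : ∀ x, ‖c x‖ ≤ 1) : TestOn X n k →ₗ[ℂ] TestOn X n k where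
  toFun ψ := ⟨fun x ξ => c x * ψ.1 x ξ, (hc.comp measurable_fst).mul (TestOn.measurable ψ),
    (TestOn.bounded ψ).imp fun M hM x ξ => by
      rw [norm_mul]
      exact (mul_le_of_le_one_left (norm_nonneg _) (hb x)).trans (hM x ξ),
    (TestOn.bounded_L2 ψ).imp fun M hM x => le_trans (eLpNorm_mono fun ξ => by
      rw [norm_mul]
      exact mul_le_of_le_one_left (norm_nonneg _) (hb x)) (hM x)⟩
  map_add' ψ φ := by
    ext x ξ
    exact mul_add _ _ _
  map_smul' r ψ := by
    ext x ξ
    exact mul_left_comm _ _ _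

@[simp] theorem mulc_apply (c : X → ℂ) (hc : Measurable c) (hb : ∀ x, ‖c x‖ ≤ 1)
    (ψ : TestOn X n k) (x : X) (ξ : Conf n k) : (mulc c hc hb ψ).1 x ξ = c x * ψ.1 x ξ := rfl

theorem enorm_exp_mul_I (a : ℝ) (w : ℂ) : ‖Complex.exp (a * Complex.I) * w‖ = ‖w‖ := by
  rw [norm_mul, Complex.norm_exp_ofReal_mul_I, one_mul]

theorem norm_stepFun_le {α : ℝ} (hα : 0 ≤ α) (T : ℝ) (i : Fin k ⊕ Fin k) (q : Fin (k + 1))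
    {G : ℝ → Conf n k → ℂ} {M : ℝ} (hM : ∀ t ξ, ‖G t ξ‖ ≤ M) (z : Conf n (k + 1)) :
    ‖stepFun α T i q G z‖ ≤ √(9 ^ α * 3) * (M * (tm T).real univ) := by
  rw [stepFun, norm_mul, Complex.norm_real, Real.norm_of_nonneg (kern_pos α i q z).le]
  refine mul_le_mul (kern_le hα i q z) ?_ (norm_nonneg _) (Real.sqrt_nonneg _)
  refine norm_integral_le_of_norm_le_const (Eventually.of_forall fun t => ?_)
  rw [enorm_exp_mul_I]
  exact hM _ _

theorem integrable_step (T : ℝ) (i : Fin k ⊕ Fin k) (q : Fin (k + 1))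
    (ψ : TestOn (ℝ × X) n k) (x : X) (z : Conf n (k + 1)) :
    Integrable (fun t => Complex.exp ((t * phase i q z : ℝ) * Complex.I) * ψ.1 (t, x) (merge i q z))
      (tm T) := by
  obtain ⟨M, hM⟩ := (TestOn.bounded ψ)
  refine Integrable.of_bound (Measurable.aestronglyMeasurable ?_) M (Eventually.of_forall fun t => ?_)
  · exact Measurable.mul (Continuous.measurable (by fun_prop))
      ((TestOn.measurable ψ).comp ((measurable_id.prodMk measurable_const).prodMk measurable_const))
  · rw [enorm_exp_mul_I]
    exact hM _ _

variable {α : ℝ} (H : Adm n α) (T : ℝ)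

theorem lintegral_stepFun_le (i : Fin k ⊕ Fin k) (q : Fin (k + 1)) (ψ : TestOn (ℝ × X) n k) (x : X) :
    ∫⁻ z, ‖stepFun α T i q (fun t => ψ.1 (t, x)) z‖ₑ ^ 2
      ≤ kmConst H * ∫⁻ t, ∫⁻ ξ, ‖ψ.1 (t, x) ξ‖ₑ ^ 2 ∂volume ∂tm T :=
  collision_bound H i q T
    ((TestOn.measurable ψ).comp ((measurable_fst.prodMk measurable_const).prodMk measurable_snd))
    ((TestOn.bounded ψ).imp fun _ hM _ ξ => hM _ ξ)

/-- The collision step on families of test functions. -/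
def step (i : Fin k ⊕ Fin k) (q : Fin (k + 1)) : TestOn (ℝ × X) n k →ₗ[ℂ] TestOn X n (k + 1) where
  toFun ψ := ⟨fun x => stepFun α T i q (fun t => ψ.1 (t, x)), by
    refine ⟨?_, ?_, ?_⟩
    · have h1 : Measurable fun w : (X × Conf n (k + 1)) × ℝ =>
          Complex.exp ((w.2 * phase i q w.1.2 : ℝ) * Complex.I) * ψ.1 (w.2, w.1.1) (merge i q w.1.2) := by
        refine Measurable.mul ?_ ?_
        · have := (continuous_phase (n := n) i q).measurable
          fun_prop
        · exact (TestOn.measurable ψ).comp ((measurable_snd.prodMk measurable_fst.fst).prodMk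
            ((continuous_merge i q).measurable.comp measurable_fst.snd))
      exact (Complex.measurable_ofReal.comp
        ((continuous_kern α i q).measurable.comp measurable_snd)).mul
          h1.stronglyMeasurable.integral_prod_right.measurable
    · obtain ⟨M, hM⟩ := (TestOn.bounded ψ)
      exact ⟨_, fun x z => norm_stepFun_le H.nonneg T i q (fun t ξ => hM (t, x) ξ) z⟩
    · obtain ⟨M, hM⟩ := (TestOn.bounded_L2 ψ)
      refine ⟨(((kmConst H : ℝ≥0∞) * (M ^ 2 * tm T univ)) ^ (1 / 2 : ℝ)).toNNReal, fun x => ?_⟩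
      rw [ENNReal.coe_toNNReal]
      swap
      · refine (ENNReal.rpow_lt_top_of_nonneg (by norm_num) ?_).ne
        exact (ENNReal.mul_lt_top ENNReal.coe_lt_top (ENNReal.mul_lt_top
          (ENNReal.pow_lt_top ENNReal.coe_lt_top) (measure_lt_top _ _))).ne
      rw [one_div, ENNReal.le_rpow_inv_iff (by norm_num)]
      rw [show (2 : ℝ) = (2 : ℕ) by norm_num, ENNReal.rpow_natCast, eLpNorm_two_sq]
      refine (lintegral_stepFun_le H T i q ψ x).trans (mul_le_mul_right ?_ _)
      rw [← lintegral_const]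
      refine lintegral_mono fun t => ?_
      rw [← eLpNorm_two_sq]
      exact pow_le_pow_left₀ zero_le (hM _) 2⟩
  map_add' ψ φ := by
    ext x z
    change stepFun α T i q _ z = stepFun α T i q _ z + stepFun α T i q _ z
    unfold stepFun
    rw [← mul_add, ← integral_add (integrable_step T i q ψ x z) (integrable_step T i q φ x z)]
    congr 1
    refine integral_congr_ae (Eventually.of_forall fun t => ?_)
    exact mul_add _ _ _
  map_smul' c ψ := by
    ext x z
    change stepFun α T i q _ z = c * stepFun α T i q _ z
    have h := integral_const_mul (μ := tm T) c fun t =>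
      Complex.exp ((t * phase i q z : ℝ) * Complex.I) * ψ.1 (t, x) (merge i q z)
    unfold stepFun
    rw [mul_left_comm, ← h]
    congr 1
    refine integral_congr_ae (Eventually.of_forall fun t => ?_)
    exact mul_left_comm _ _ _

theorem step_apply (i : Fin k ⊕ Fin k) (q : Fin (k + 1)) (ψ : TestOn (ℝ × X) n k) (x : X)
    (z : Conf n (k + 1)) : (step H T i q ψ).1 x z = stepFun α T i q (fun t => ψ.1 (t, x)) z := rfl

end

end

end GPHierarchy

namespace GPHierarchy

noncomputable section

/-! ### Exchange of collisions -/

/-- The coordinate `x_{j+1}` (for `b = true`) or `x'_{j+1}` (for `b = false`). -/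
def target {k : ℕ} (b : Bool) (j : Fin k) : Fin k ⊕ Fin k := if b then Sum.inl j else Sum.inr j

@[simp] theorem target_true {k : ℕ} (j : Fin k) : target true j = Sum.inl j := rfl

@[simp] theorem target_false {k : ℕ} (j : Fin k) : target false j = Sum.inr j := rfl

theorem map_target {k l : ℕ} (f : Fin k → Fin l) (b : Bool) (j : Fin k) :
    (target b j).map f f = target b (f j) := by cases b <;> rfl

theorem target_inj {k : ℕ} {b b' : Bool} {j j' : Fin k} :
    target b j = target b' j' ↔ b = b' ∧ j = j' := by
  cases b <;> cases b' <;> simp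

theorem exists_eq_target {k : ℕ} (i : Fin k ⊕ Fin k) : ∃ b j, i = target b j := by
  rcases i with j | j
  · exact ⟨true, j, rfl⟩
  · exact ⟨false, j, rfl⟩

theorem merge_target {n k : ℕ} (b : Bool) (j : Fin k) (q : Fin (k + 1)) (z : Conf n (k + 1))
    (c : Bool) (l : Fin k) :
    merge (target b j) q z (target c l) = z (target c (q.succAbove l))
      + if c = b ∧ l = j then z (target true q) + z (target false q) else 0 := by
  rw [merge_apply, map_target]
  simp only [target_inj, target_true, target_false]

theorem merge_target_of_lt {n k a : ℕ} (b' : Bool) (ha : a + 1 < k + 1) (z : Conf n (k + 2)) (c : Bool) (l : Fin (k + 1)) (hl : (l : ℕ) < a + 1) :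
    merge (target b' (⟨a + 1, ha⟩ : Fin (k + 1))) ⟨a + 2, by omega⟩ z (target c l)
      = z (target c l.castSucc) := by
  rw [merge_target, if_neg (fun h => by
    have := congrArg Fin.val h.2
    simp only at this
    omega), add_zero, Fin.succAbove_of_castSucc_lt]
  simp only [Fin.lt_def, Fin.val_castSucc]
  omega

section

variable {n k : ℕ} {j a : ℕ} (b b' : Bool) (hj : j < k) (ha : a + 1 < k + 1)

/-- The collisions act on different particles: the particle `a + 1` of the larger configuration is
the particle `a` of the smaller one, shifted because a particle sits at `j + 1`. The two removals
commute up to this shift. -/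
theorem merge_merge (hja : j < a) (z : Conf n (k + 2)) :
    merge (target b (⟨j, hj⟩ : Fin k)) ⟨j + 1, by omega⟩
        (merge (target b' (⟨a + 1, ha⟩ : Fin (k + 1))) ⟨a + 2, by omega⟩ z)
      = merge (target b' (⟨a, by omega⟩ : Fin k)) ⟨a + 1, by omega⟩
        (merge (target b (⟨j, by omega⟩ : Fin (k + 1))) ⟨j + 1, by omega⟩ z) := by
  ext i : 1
  obtain ⟨c, l, rfl⟩ := exists_eq_target i
  rw [merge_target, merge_target_of_lt b' ha _ true _ (by simp; omega),
    merge_target_of_lt b' ha _ false _ (by simp; omega), merge_target, merge_target (j := ⟨a, _⟩),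
    merge_target, merge_target, merge_target]
  have e1 : (⟨a + 2, by omega⟩ : Fin (k + 2)).succAbove ((⟨j + 1, by omega⟩ : Fin (k + 1)).succAbove l)
      = (⟨j + 1, by omega⟩ : Fin (k + 2)).succAbove ((⟨a + 1, by omega⟩ : Fin (k + 1)).succAbove l) := by
    ext
    simp only [Fin.succAbove, Fin.lt_def, Fin.val_castSucc]
    split_ifs <;> (simp_all; try omega)
  have e2 : (⟨j + 1, by omega⟩ : Fin (k + 1)).succAbove l = ⟨a + 1, ha⟩ ↔ l = ⟨a, by omega⟩ := by
    simp only [Fin.succAbove, Fin.lt_def, Fin.val_castSucc, Fin.ext_iff]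
    split_ifs <;> (simp_all; try omega)
  have e3 : (⟨a + 1, by omega⟩ : Fin (k + 1)).succAbove l = ⟨j, by omega⟩ ↔ l = ⟨j, hj⟩ := by
    simp only [Fin.succAbove, Fin.lt_def, Fin.val_castSucc, Fin.ext_iff]
    split_ifs <;> (simp_all; try omega)
  have e4 : (⟨j + 1, by omega⟩ : Fin (k + 2)).succAbove (⟨a + 1, by omega⟩ : Fin (k + 1))
      = ⟨a + 2, by omega⟩ := by
    ext
    simp only [Fin.succAbove, Fin.lt_def, Fin.val_castSucc]
    split_ifs <;> (simp_all; try omega)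
  have e5 : (⟨a + 1, by omega⟩ : Fin (k + 1)) ≠ ⟨j, by omega⟩ := by
    simp only [ne_eq, Fin.ext_iff]
    omega
  simp only [e1, e2, e3, e4, e5, and_false, if_false, add_zero, Fin.castSucc_mk]
  rw [add_right_comm]

/-- The resonance function of the collision at `j` involves the particles `j` and `j + 1` only, and
merging `a + 2` into `a + 1` leaves these alone. -/
theorem phase_merge (hja : j < a) (z : Conf n (k + 2)) :
    phase (target b (⟨j, hj⟩ : Fin k)) ⟨j + 1, by omega⟩
        (merge (target b' (⟨a + 1, ha⟩ : Fin (k + 1))) ⟨a + 2, by omega⟩ z)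
      = phase (target b (⟨j, by omega⟩ : Fin (k + 1))) ⟨j + 1, by omega⟩ z := by
  have h1 : sgn (target b (⟨j, hj⟩ : Fin k)) = sgn (target b (⟨j, by omega⟩ : Fin (k + 1))) := by
    cases b <;> rfl
  have e1 : (⟨j + 1, by omega⟩ : Fin (k + 1)).succAbove ⟨j, hj⟩ = ⟨j, by omega⟩ := by
    ext
    simp [Fin.succAbove, Fin.lt_def]
  have e2 : (⟨j + 1, by omega⟩ : Fin (k + 2)).succAbove (⟨j, by omega⟩ : Fin (k + 1))
      = ⟨j, by omega⟩ := by
    ext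
    simp [Fin.succAbove, Fin.lt_def]
  rw [phase, energy_sub_merge, phase, energy_sub_merge, h1]
  rw [map_target, map_target, e1, e2, ← target_true, ← target_false,
    merge_target_of_lt b' ha _ true _ (by simp; omega),
    merge_target_of_lt b' ha _ false _ (by simp; omega),
    merge_target_of_lt b' ha _ b _ (by simp; omega)]
  rfl

end

section

variable {X Y : Type} [MeasurableSpace X] [MeasurableSpace Y] {n k : ℕ} {α : ℝ} (H : Adm n α) (T : ℝ)

theorem TestOn.ext {ψ φ : TestOn X n k} (h : ∀ x z, ψ.1 x z = φ.1 x z) : ψ = φ :=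
  Subtype.ext (funext₂ h)

theorem mulc_step (c : X → ℂ) (hc : Measurable c) (hb : ∀ x, ‖c x‖ ≤ 1) (i : Fin k ⊕ Fin k)
    (q : Fin (k + 1)) (ψ : TestOn (ℝ × X) n k) :
    mulc (n := n) (k := k + 1) c hc hb (step H T i q ψ)
      = step H T i q (mulc (fun p : ℝ × X => c p.2) (hc.comp measurable_snd) (fun p => hb p.2) ψ) := by
  apply TestOn.ext
  intro x z
  change c x * stepFun α T i q _ z = stepFun α T i q _ z
  have h := integral_const_mul (μ := tm T) (c x) fun t =>
    Complex.exp ((t * phase i q z : ℝ) * Complex.I) * ψ.1 (t, x) (merge i q z)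
  unfold stepFun
  rw [mul_left_comm, ← h]
  congr 1
  refine integral_congr_ae (Eventually.of_forall fun t => ?_)
  exact mul_left_comm _ _ _

theorem step_step_apply (ia : Fin (k + 1) ⊕ Fin (k + 1)) (qa : Fin (k + 2)) (ij : Fin k ⊕ Fin k)
    (qj : Fin (k + 1)) (Ψ : TestOn (ℝ × (ℝ × X)) n k) (x : X) (z : Conf n (k + 2)) :
    (step H T ia qa (step H T ij qj Ψ)).1 x z
      = ((kern α ia qa z * kern α ij qj (merge ia qa z) : ℝ) : ℂ) *
        ∫ s, ∫ t, Complex.exp ((s * phase ia qa z + t * phase ij qj (merge ia qa z) : ℝ) * Complex.I)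
          * Ψ.1 (t, (s, x)) (merge ij qj (merge ia qa z)) ∂tm T ∂tm T := by
  simp only [step_apply, stepFun]
  push_cast
  rw [mul_assoc]
  congr 1
  rw [← integral_const_mul (μ := tm T) (L := ℂ)]
  refine integral_congr_ae (Eventually.of_forall fun s => ?_)
  simp only
  rw [mul_left_comm, ← integral_const_mul (μ := tm T) (L := ℂ)]
  congr 1
  refine integral_congr_ae (Eventually.of_forall fun t => ?_)
  simp only
  rw [add_mul, Complex.exp_add]
  ring

/-- Products of kernels telescope to a quotient of weights at the two ends, and sums of phases to a
difference of energies; both depend on the total merging only, given by `hm`. One equality of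
phases, `hp`, therefore implies the other. Fubini exchanges the two times. -/
theorem step_comm {ia ij' : Fin (k + 1) ⊕ Fin (k + 1)} {qa qj' : Fin (k + 2)}
    {ij ia' : Fin k ⊕ Fin k} {qj qa' : Fin (k + 1)}
    (hm : ∀ z : Conf n (k + 2), merge ij qj (merge ia qa z) = merge ia' qa' (merge ij' qj' z))
    (hp : ∀ z : Conf n (k + 2), phase ij qj (merge ia qa z) = phase ij' qj' z)
    (Ψ : TestOn (ℝ × (ℝ × X)) n k) :
    step H T ia qa (step H T ij qj Ψ) = step H T ij' qj' (step H T ia' qa'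
      (pull (fun p : ℝ × (ℝ × X) => (p.2.1, (p.1, p.2.2)))
        (measurable_snd.fst.prodMk (measurable_fst.prodMk measurable_snd.snd)) Ψ)) := by
  apply TestOn.ext
  intro x z
  have hp2 : phase ia qa z = phase ia' qa' (merge ij' qj' z) := by
    have h1 : phase ia qa z + phase ij qj (merge ia qa z)
        = phase ij' qj' z + phase ia' qa' (merge ij' qj' z) := by
      simp only [phase, hm]
      ring
    rw [hp] at h1
    linarith
  have hk : kern α ia qa z * kern α ij qj (merge ia qa z)
      = kern α ij' qj' z * kern α ia' qa' (merge ij' qj' z) := by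
    simp only [kern, hm]
    have h1 := (sobolevWeight_pos α (merge ia qa z)).ne'
    have h2 := (sobolevWeight_pos α (merge ij' qj' z)).ne'
    field_simp
  rw [step_step_apply, step_step_apply, hk, hp, hm, hp2]
  congr 1
  rw [integral_integral_swap]
  · refine integral_congr_ae (Eventually.of_forall fun s => ?_)
    refine integral_congr_ae (Eventually.of_forall fun t => ?_)
    simp only [pull_apply]
    rw [add_comm (t * _)]
  · obtain ⟨M, hM⟩ := TestOn.bounded Ψ
    refine Integrable.of_bound (Measurable.aestronglyMeasurable ?_) M
      (Eventually.of_forall fun t => ?_)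
    · refine Measurable.mul (Continuous.measurable (by fun_prop)) ?_
      exact (TestOn.measurable Ψ).comp ((measurable_snd.prodMk
        (measurable_fst.prodMk measurable_const)).prodMk measurable_const)
    · simp only [Function.uncurry]
      rw [enorm_exp_mul_I]
      exact hM _ _

/-- The collision of the new particle `l.1 + 2` with the particle `l.1 + 1`; the two sides are
distinguished by `l.2`. -/
def stepL (l : ℕ × Bool) : TestOn (ℝ × X) n k →ₗ[ℂ] TestOn X n (k + 1) :=
  if h : l.1 < k then step H T (target l.2 ⟨l.1, h⟩) ⟨l.1 + 1, by omega⟩ else 0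

theorem pull_stepL (g : Y → X) (hg : Measurable g) (l : ℕ × Bool) (ψ : TestOn (ℝ × X) n k) :
    pull g hg (stepL H T l ψ)
      = stepL H T l (pull (fun p : ℝ × Y => (p.1, g p.2))
          (measurable_fst.prodMk (hg.comp measurable_snd)) ψ) := by
  unfold stepL
  split_ifs
  · rfl
  · rfl

theorem mulc_stepL (c : X → ℂ) (hc : Measurable c) (hb : ∀ x, ‖c x‖ ≤ 1) (l : ℕ × Bool)
    (ψ : TestOn (ℝ × X) n k) :
    mulc (n := n) (k := k + 1) c hc hb (stepL H T l ψ)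
      = stepL H T l (mulc (fun p : ℝ × X => c p.2) (hc.comp measurable_snd) (fun p => hb p.2) ψ) := by
  unfold stepL
  split_ifs
  · exact mulc_step H T c hc hb (target l.2 ⟨l.1, _⟩) ⟨l.1 + 1, _⟩ ψ
  · simp

/-- The letter `a` counts particles after `l` has inserted one. The hypothesis says that `a` hits
neither the partner `l.1` nor the new particle `l.1 + 1`, but a later one, whose number before the
insertion was `a.1 - 1`. Out of range, both sides vanish. -/
theorem stepL_comm (l a : ℕ × Bool) (h : l.1 + 1 < a.1) (Ψ : TestOn (ℝ × (ℝ × X)) n k) :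
    stepL H T a (stepL H T l Ψ) = stepL H T l (stepL H T (a.1 - 1, a.2)
      (pull (fun p : ℝ × (ℝ × X) => (p.2.1, (p.1, p.2.2)))
        (measurable_snd.fst.prodMk (measurable_fst.prodMk measurable_snd.snd)) Ψ)) := by
  obtain ⟨j, b⟩ := l
  obtain ⟨a, b'⟩ := a
  simp only at h
  obtain ⟨a, rfl⟩ : ∃ a', a = a' + 1 := ⟨a - 1, by omega⟩
  simp only [Nat.add_sub_cancel]
  by_cases h1 : a + 1 < k + 1
  · have h2 : a < k := by omega
    have h3 : j < k := by omega
    have h4 : j < k + 1 := by omega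
    simp only [stepL, h1, h2, h3, h4, dif_pos]
    exact step_comm H T (merge_merge b b' h3 h1 (by omega)) (phase_merge b b' h3 h1 (by omega)) Ψ
  · have h2 : ¬ a < k := by omega
    simp [stepL, h1, h2]

theorem lintegral_stepL_le (l : ℕ × Bool) (ψ : TestOn (ℝ × X) n k) (x : X) :
    ∫⁻ z, ‖(stepL H T l ψ).1 x z‖ₑ ^ 2
      ≤ kmConst H * ∫⁻ t, ∫⁻ ξ, ‖ψ.1 (t, x) ξ‖ₑ ^ 2 ∂volume ∂tm T := by
  unfold stepL
  split_ifs
  · exact lintegral_stepFun_le H T _ _ ψ x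
  · simp

end

end

end GPHierarchy

namespace GPHierarchy

noncomputable section

/-! ### Words and times -/

/-- Tuples of `m` times. -/
def Times : ℕ → Type
  | 0 => Unit
  | m + 1 => ℝ × Times m

/-- The product `σ`-algebra. -/
instance instMeasurableSpaceTimes : (m : ℕ) → MeasurableSpace (Times m)
  | 0 => inferInstanceAs (MeasurableSpace Unit)
  | m + 1 => @Prod.instMeasurableSpace ℝ (Times m) _ (instMeasurableSpaceTimes m)

/-- Tuples of `m` collisions. -/
inductive Word : ℕ → Type
  | nil : Word 0
  | cons {m : ℕ} (l : ℕ × Bool) (w : Word m) : Word (m + 1)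

instance (m : ℕ) : DecidableEq (Word m) := Classical.decEq _

/-- The maximum of `s` and of the given times. -/
def lastTime (s : ℝ) : (m : ℕ) → Times m → ℝ
  | 0, _ => s
  | m + 1, y => max y.1 (lastTime s m y.2)

theorem measurable_lastTime (s : ℝ) : (m : ℕ) → Measurable (lastTime s m)
  | 0 => measurable_const
  | m + 1 => Measurable.max (α := ℝ) (δ := ℝ × Times m) measurable_fst
      ((measurable_lastTime s m).comp measurable_snd)

/-- Removal of the time with index `p`. -/
def splitTime : (p m : ℕ) → Times (m + 1) → ℝ × Times m
  | 0, _, y => y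
  | _ + 1, 0, y => y
  | p + 1, m + 1, y => ((splitTime p m y.2).1, (y.1, (splitTime p m y.2).2))

theorem measurable_splitTime : (p m : ℕ) → Measurable (splitTime p m)
  | 0, _ => measurable_id
  | _ + 1, 0 => measurable_id
  | p + 1, m + 1 => by
    have h : Measurable fun y : ℝ × Times (m + 1) => splitTime p m y.2 :=
      (measurable_splitTime p m).comp measurable_snd
    have h2 : Measurable fun y : ℝ × Times (m + 1) =>
      ((splitTime p m y.2).1, (y.1, (splitTime p m y.2).2)) :=
      h.fst.prodMk (measurable_fst.prodMk h.snd)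
    exact h2

theorem lastTime_splitTime (s : ℝ) : ∀ (p m : ℕ) (y : Times (m + 1)),
    max (splitTime p m y).1 (lastTime s m (splitTime p m y).2) = lastTime s (m + 1) y
  | 0, _, y => rfl
  | _ + 1, 0, y => rfl
  | p + 1, m + 1, y => by
    change max (splitTime p m y.2).1 (max y.1 (lastTime s m (splitTime p m y.2).2))
      = max y.1 (lastTime s (m + 1) y.2)
    rw [← lastTime_splitTime s p m y.2, max_left_comm]

theorem splitTime_fst_le (s : ℝ) (p m : ℕ) (y : Times (m + 1)) :
    (splitTime p m y).1 ≤ lastTime s (m + 1) y := by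
  rw [← lastTime_splitTime s p m y]
  exact le_max_left _ _

theorem splitTime_fst_le_lastTime (s : ℝ) : ∀ (m p p' : ℕ), p ≤ m → p' ≤ m → p ≠ p' →
    ∀ y : Times (m + 1), (splitTime p' m y).1 ≤ lastTime s m (splitTime p m y).2
  | 0, p, p', h, h', hne, y => by omega
  | m + 1, 0, 0, h, h', hne, y => by omega
  | m + 1, 0, p' + 1, h, h', hne, y => splitTime_fst_le s p' m y.2
  | m + 1, p + 1, 0, h, h', hne, y => le_max_left _ _
  | m + 1, p + 1, p' + 1, h, h', hne, y =>
    (splitTime_fst_le_lastTime s m p p' (by omega) (by omega) (by omega) y.2).trans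
      (le_max_right _ _)

/-- The position to which the first letter of the word `l :: w` is moved. -/
def pos (l : ℕ × Bool) : {m : ℕ} → Word m → ℕ
  | _, .nil => 0
  | _, .cons a w => if l.1 + 1 < a.1 then pos l w + 1 else 0

/-- The word in normal form which arises from the word `l :: w` if `w` is in normal form. -/
def ins (l : ℕ × Bool) : {m : ℕ} → Word m → Word (m + 1)
  | _, .nil => .cons l .nil
  | _, .cons a w => if l.1 + 1 < a.1 then .cons (a.1 - 1, a.2) (ins l w) else .cons l (.cons a w)

theorem pos_le (l : ℕ × Bool) : ∀ {m : ℕ} (w : Word m), pos l w ≤ m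
  | _, .nil => le_rfl
  | _, .cons a w => by
    have := pos_le l w
    rw [pos]
    split_ifs <;> omega

/-- The inverse of `ins`, given the position. -/
def unins : {m : ℕ} → ℕ → Word (m + 1) → (ℕ × Bool) × Word m
  | _, 0, .cons l w => (l, w)
  | 0, _ + 1, .cons l w => (l, w)
  | _ + 1, p + 1, .cons l w => ((unins p w).1, .cons (l.1 + 1, l.2) (unins p w).2)

/-- Different words can have the same normal form, but the position of the inserted letter
distinguishes them. This is the injectivity behind the disjoint supports in `exists_expansion_eq`.
-/
theorem unins_ins (l : ℕ × Bool) : ∀ {m : ℕ} (w : Word m), unins (pos l w) (ins l w) = (l, w)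
  | _, .nil => rfl
  | _, .cons a w => by
    rw [pos, ins]
    split_ifs with h
    · rw [unins, unins_ins l w]
      simp only
      rw [Nat.sub_add_cancel (by omega)]
    · rfl

/-- The letters available for `K` particles. -/
def letters (K : ℕ) : Finset (ℕ × Bool) := Finset.range K ×ˢ Finset.univ

theorem mem_letters {K : ℕ} {l : ℕ × Bool} : l ∈ letters K ↔ l.1 < K := by simp [letters]

theorem Word.cons_injective {m : ℕ} (l : ℕ × Bool) : Function.Injective (Word.cons (m := m) l) :=
  fun _ _ h => (Word.cons.inj h).2

/-- The words in normal form: every letter exceeds the previous one by at most `1`. -/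
def normalWords (K : ℕ) : (m : ℕ) → Finset (Word m)
  | 0 => {.nil}
  | m + 1 => (letters K).biUnion fun l => (normalWords (l.1 + 2) m).map ⟨_, Word.cons_injective l⟩

theorem cons_mem_normalWords {K m : ℕ} {l : ℕ × Bool} {u : Word m} :
    Word.cons l u ∈ normalWords K (m + 1) ↔ l.1 < K ∧ u ∈ normalWords (l.1 + 2) m := by
  simp only [normalWords, Finset.mem_biUnion, Finset.mem_map, Function.Embedding.coeFn_mk,
    mem_letters]
  constructor
  · rintro ⟨l', hl', u', hu', he⟩
    obtain ⟨rfl, rfl⟩ := Word.cons.inj he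
    exact ⟨hl', hu'⟩
  · rintro ⟨h1, h2⟩
    exact ⟨l, h1, u, h2, rfl⟩

/-- The letter `l` moves right past every letter with which it commutes. A letter that is passed
drops by one, which compensates for the missing particle; `l` stops in front of a letter that
exceeds it by at most `1`. -/
theorem ins_mem_normalWords (l : ℕ × Bool) : ∀ {m : ℕ} (K : ℕ) (w : Word m), l.1 < K →
    w ∈ normalWords (K + 1) m → ins l w ∈ normalWords K (m + 1)
  | _, K, .nil, hl, hw => cons_mem_normalWords.2 ⟨hl, by simp [normalWords]⟩
  | _, K, .cons a w, hl, hw => by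
    rw [cons_mem_normalWords] at hw
    rw [ins]
    split_ifs with h
    · refine cons_mem_normalWords.2 ⟨by simp only; omega, ?_⟩
      simp only
      rw [show a.1 - 1 + 2 = a.1 + 1 by omega]
      exact ins_mem_normalWords l _ w (by omega) (by rw [add_assoc]; exact hw.2)
    · exact cons_mem_normalWords.2 ⟨hl, cons_mem_normalWords.2 ⟨by omega, hw.2⟩⟩

/-- The weight `2^K` makes the induction close: a first letter with number `j` leaves `2^(j+2) *
8^m` continuations, the sum of `2^j` over `j < K` is at most `2^K`, and the two sides give a factor
`2`, in total `2 * 4 = 8`. The growth in `m` is exponential instead of factorial. -/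
theorem card_normalWords_le : ∀ (m K : ℕ), (normalWords K m).card ≤ 2 ^ K * 8 ^ m
  | 0, K => by
    rw [normalWords, Finset.card_singleton, pow_zero, mul_one]
    exact Nat.one_le_two_pow
  | m + 1, K => by
    rw [normalWords]
    refine Finset.card_biUnion_le.trans ?_
    have h1 : ∀ l ∈ letters K, ((normalWords (l.1 + 2) m).map ⟨_, Word.cons_injective l⟩).card
        ≤ 2 ^ l.1 * (4 * 8 ^ m) := by
      intro l _
      rw [Finset.card_map]
      refine (card_normalWords_le m _).trans_eq ?_
      rw [pow_add]
      ring
    refine (Finset.sum_le_sum h1).trans ?_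
    rw [letters, Finset.sum_product]
    simp only [Finset.sum_const, Finset.card_univ, Fintype.card_bool, smul_eq_mul]
    rw [← Finset.mul_sum, ← Finset.sum_mul]
    have h2 : ∑ i ∈ Finset.range K, 2 ^ i ≤ 2 ^ K := by
      have := Nat.geomSum_eq (m := 2) le_rfl K
      rw [this]
      simp
    calc 2 * ((∑ i ∈ Finset.range K, 2 ^ i) * (4 * 8 ^ m)) ≤ 2 * (2 ^ K * (4 * 8 ^ m)) := by gcongr
      _ = 2 ^ K * 8 ^ (m + 1) := by ring

/-- Lebesgue measure on `[0,T]^m`. -/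
def timesMeasure (T : ℝ) : (m : ℕ) → Measure (Times m)
  | 0 => Measure.dirac (α := Unit) ()
  | m + 1 => ((tm T).prod (timesMeasure T m) : Measure (ℝ × Times m))

instance instIsFiniteMeasureTimes (T : ℝ) : (m : ℕ) → IsFiniteMeasure (timesMeasure T m)
  | 0 => inferInstanceAs (IsFiniteMeasure (Measure.dirac (α := Unit) ()))
  | m + 1 => by
    have := instIsFiniteMeasureTimes T m
    exact inferInstanceAs (IsFiniteMeasure ((tm T).prod (timesMeasure T m)))

theorem tm_univ (T : ℝ) : tm T univ = ENNReal.ofReal T := by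
  rw [tm, Measure.restrict_apply_univ, Real.volume_Icc, sub_zero]

theorem timesMeasure_univ (T : ℝ) : ∀ m, timesMeasure T m univ = ENNReal.ofReal T ^ m
  | 0 => by
    rw [pow_zero]
    exact measure_univ (μ := Measure.dirac (α := Unit) ())
  | m + 1 => by
    change ((tm T).prod (timesMeasure T m)) univ = _
    rw [← univ_prod_univ, Measure.prod_prod, tm_univ, timesMeasure_univ T m, pow_succ']

/-- The sum of the values of `v` at the given times. -/
def sumTimes (v : ℝ → ℝ≥0∞) : (m : ℕ) → Times m → ℝ≥0∞
  | 0, _ => 0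
  | m + 1, y => v y.1 + sumTimes v m y.2

theorem measurable_sumTimes {v : ℝ → ℝ≥0∞} (hv : Measurable v) : ∀ m, Measurable (sumTimes v m)
  | 0 => measurable_const
  | m + 1 => by
    have h : Measurable fun y : ℝ × Times m => v y.1 + sumTimes v m y.2 :=
      (hv.comp measurable_fst).add ((measurable_sumTimes hv m).comp measurable_snd)
    exact h

theorem lintegral_add_prod {X Y : Type*} [MeasurableSpace X] [MeasurableSpace Y] {μ : Measure X}
    {ν : Measure Y} [SFinite μ] [SFinite ν] {f : X → ℝ≥0∞} {g : Y → ℝ≥0∞} (hf : Measurable f)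
    (hg : Measurable g) :
    ∫⁻ p, (f p.1 + g p.2) ∂μ.prod ν = ν univ * ∫⁻ x, f x ∂μ + μ univ * ∫⁻ y, g y ∂ν := by
  rw [lintegral_prod _ (by fun_prop)]
  simp only [lintegral_add_right _ hg, lintegral_const, lintegral_add_right _ measurable_const]
  rw [lintegral_mul_const _ hf, mul_comm, mul_comm (μ univ)]

/-- Each of the `m` summands contributes `T^(m-1) ∫ v`. The factor `T` on the left avoids the
exponent `m - 1`, so that `m = 0` is included. -/
theorem lintegral_sumTimes (T : ℝ) {v : ℝ → ℝ≥0∞} (hv : Measurable v) : ∀ m,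
    ENNReal.ofReal T * ∫⁻ y, sumTimes v m y ∂timesMeasure T m
      = m * ENNReal.ofReal T ^ m * ∫⁻ t, v t ∂tm T
  | 0 => by simp [sumTimes]
  | m + 1 => by
    have h1 : ∫⁻ y, sumTimes v (m + 1) y ∂timesMeasure T (m + 1)
        = timesMeasure T m univ * ∫⁻ t, v t ∂tm T
          + tm T univ * ∫⁻ y, sumTimes v m y ∂timesMeasure T m :=
      lintegral_add_prod hv (measurable_sumTimes hv m)
    rw [h1, tm_univ, timesMeasure_univ, lintegral_sumTimes T hv m]
    push_cast
    ring

theorem le_sumTimes_of_lt (v : ℝ → ℝ≥0∞) (s : ℝ) : ∀ (m : ℕ) (y : Times m),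
    s < lastTime s m y → v (lastTime s m y) ≤ sumTimes v m y
  | 0, y, h => absurd h (lt_irrefl s)
  | m + 1, y, h => by
    change v (max y.1 (lastTime s m y.2)) ≤ v y.1 + sumTimes v m y.2
    rcases le_total y.1 (lastTime s m y.2) with h1 | h1
    · rw [max_eq_right h1]
      refine (le_sumTimes_of_lt v s m y.2 ?_).trans le_add_self
      have h2 : s < max y.1 (lastTime s m y.2) := h
      rwa [max_eq_right h1] at h2
    · rw [max_eq_left h1]
      exact le_self_add

end

end GPHierarchy

namespace GPHierarchy

noncomputable section

/-! ### The Duhamel expansion -/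

/-- The index of the particle which is created next to the particle of the coordinate `i`. -/
def adj {k : ℕ} (i : Fin k ⊕ Fin k) : Fin (k + 1) := (Sum.elim id id i).succ

section

variable {n : ℕ} {α : ℝ} (H : Adm n α) (T μ : ℝ)

/-- The function `(t, s) ↦ 1_{s < t} ψ(t)`. -/
def later {k : ℕ} : TestOn ℝ n k →ₗ[ℂ] TestOn (ℝ × ℝ) n k :=
  mulc (fun p : ℝ × ℝ => if p.2 < p.1 then 1 else 0)
    (Measurable.ite (measurableSet_lt measurable_snd measurable_fst) measurable_const
      measurable_const) (fun p => by split_ifs <;> simp) ∘ₗ pull Prod.fst measurable_fst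

theorem later_apply {k : ℕ} (ψ : TestOn ℝ n k) (p : ℝ × ℝ) (ξ : Conf n k) :
    (later ψ).1 p ξ = (if p.2 < p.1 then 1 else 0) * ψ.1 p.1 ξ := rfl

/-- The adjoint of the collision part of the Duhamel formula. -/
def duhamel {k : ℕ} : TestOn ℝ n k →ₗ[ℂ] TestOn ℝ n (k + 1) :=
  (Complex.I * μ) • ∑ i : Fin k ⊕ Fin k, (sgn i : ℂ) • (step H T i (adj i) ∘ₗ later)

/-- The coefficient of a letter. -/
def letterSign (l : ℕ × Bool) : ℂ := Complex.I * μ * if l.2 then 1 else -1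

theorem norm_letterSign_le (hμ : |μ| ≤ 1) (l : ℕ × Bool) : ‖letterSign μ l‖ ≤ 1 := by
  rw [letterSign, norm_mul, norm_mul, Complex.norm_I, one_mul, Complex.norm_real, Real.norm_eq_abs]
  split_ifs <;> simpa using hμ

theorem step_target {k : ℕ} {X : Type} [MeasurableSpace X] (b : Bool) (j : Fin k)
    (ψ : TestOn (ℝ × X) n k) :
    step H T (target b j) (adj (target b j)) ψ = stepL H T (j, b) ψ := by
  rw [stepL, dif_pos j.2]
  cases b <;> rfl

theorem duhamel_eq {k : ℕ} (ψ : TestOn ℝ n k) :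
    duhamel H T μ ψ = ∑ l ∈ letters k, letterSign μ l • stepL H T l (later ψ) := by
  have h1 : ∀ i : Fin k ⊕ Fin k, ∀ b j, i = target b j →
      (Complex.I * μ) • ((sgn i : ℂ) • step H T i (adj i) (later ψ))
        = letterSign μ (j, b) • stepL H T (j, b) (later ψ) := by
    rintro _ b j rfl
    rw [step_target, smul_smul, letterSign]
    cases b
    · simp only [target, sgn, Sum.elim_inr, Bool.false_eq_true, if_false]
      push_cast
      rfl
    · simp only [target, sgn, Sum.elim_inl, if_true]
      push_cast
      rfl
  rw [duhamel, LinearMap.smul_apply, LinearMap.sum_apply, Finset.smul_sum, Fintype.sum_sum_type,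
    letters, Finset.sum_product]
  simp only [Fintype.sum_bool, LinearMap.smul_apply, LinearMap.comp_apply]
  rw [Finset.sum_add_distrib, Finset.sum_range, Finset.sum_range]
  congr 1
  · exact Finset.sum_congr rfl fun j _ => h1 _ true j rfl
  · exact Finset.sum_congr rfl fun j _ => h1 _ false j rfl

/-- The terms of the Duhamel expansion at the time `s`. -/
def expansion (f : Hierarchy n) (s : ℝ) : (m k : ℕ) → TestOn ℝ n (k + 1) →ₗ[ℂ] ℂ
  | 0, k => (innerₛₗ ℂ (f k)) ∘ₗ slice s
  | m + 1, k => expansion f s m (k + 1) ∘ₗ duhamel H T μ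

/-- The integral associated with a word. -/
def pair (f : Hierarchy n) : {m : ℕ} → (k : ℕ) → Word m → TestOn (Times m) n (k + 1) →ₗ[ℂ] ℂ
  | _, k, .nil => (innerₛₗ ℂ (f k)) ∘ₗ slice (X := Unit) ()
  | _, k, .cons (m := m) l w => pair f (k + 1) w ∘ₗ stepL (X := Times m) H T l

theorem pair_cons (f : Hierarchy n) {m : ℕ} (k : ℕ) (l : ℕ × Bool) (w : Word m)
    (Ψ : TestOn (ℝ × Times m) n (k + 1)) :
    pair H T f k (.cons l w) Ψ = pair H T f (k + 1) w (stepL H T l Ψ) := rfl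

/-- Each exchange by `stepL_comm` also exchanges the two times, so the time of `l` ends in the slot
`pos l w`. `splitTime` reads it off there and restores the order of the arguments. -/
theorem pair_ins (f : Hierarchy n) (l : ℕ × Bool) : ∀ {m : ℕ} (w : Word m) (k : ℕ)
    (Ψ : TestOn (ℝ × Times m) n (k + 1)),
    pair H T f k (.cons l w) Ψ
      = pair H T f k (ins l w) (pull (splitTime (pos l w) m) (measurable_splitTime _ _) Ψ)
  | _, .nil, k, Ψ => rfl
  | _, .cons (m := m) a w, k, Ψ => by
    by_cases h : l.1 + 1 < a.1
    · have h1 : ins l (.cons a w) = .cons (a.1 - 1, a.2) (ins l w) := by rw [ins, if_pos h]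
      have h2 : pos l (.cons a w) = pos l w + 1 := by rw [pos, if_pos h]
      have h3 := pair_ins f l w (k + 1) (stepL (X := ℝ × Times m) H T (a.1 - 1, a.2)
        (pull (fun p : ℝ × (ℝ × Times m) => (p.2.1, (p.1, p.2.2)))
          (measurable_snd.fst.prodMk (measurable_fst.prodMk measurable_snd.snd)) Ψ))
      rw [h1]
      simp only [h2]
      have h4 := stepL_comm (X := Times m) H T l a h Ψ
      have h5 : pair H T f k (.cons l (.cons a w)) Ψ
        = pair H T f (k + 1 + 1) w (stepL H T a (stepL H T l Ψ)) := rfl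
      rw [h5, h4]
      refine h3.trans ?_
      rw [pull_stepL]
      rfl
    · have h1 : ins l (.cons a w) = .cons l (.cons a w) := by rw [ins, if_neg h]
      have h2 : pos l (.cons a w) = 0 := by rw [pos, if_neg h]
      rw [h1]
      simp only [h2]
      rfl

theorem enorm_inner_sq_le {k : ℕ} {X : Type} [MeasurableSpace X] (f : L2 n k) (x : X)
    (Ψ : TestOn X n k) :
    ‖inner ℂ f (slice x Ψ)‖ₑ ^ 2 ≤ ‖f‖ₑ ^ 2 * ∫⁻ ξ, ‖Ψ.1 x ξ‖ₑ ^ 2 := by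
  rw [← enorm_slice_sq, ← mul_pow]
  refine pow_le_pow_left₀ zero_le ?_ 2
  rw [← ofReal_norm, ← ofReal_norm, ← ofReal_norm, ← ENNReal.ofReal_mul (norm_nonneg _)]
  exact ENNReal.ofReal_le_ofReal (norm_inner_le_norm _ _)

theorem measurable_lintegral_sq {k : ℕ} {X : Type} [MeasurableSpace X] (Ψ : TestOn X n k) :
    Measurable fun x => ∫⁻ ξ, ‖Ψ.1 x ξ‖ₑ ^ 2 :=
  ((TestOn.measurable Ψ).enorm.pow_const 2).lintegral_prod_right'

/-- One space-time estimate per letter, then the Cauchy-Schwarz inequality against `f`. All times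
range over the full cube, so no ordering of the times is needed. -/
theorem enorm_pair_sq_le (f : Hierarchy n) : ∀ {m : ℕ} (k : ℕ) (w : Word m)
    (Ψ : TestOn (Times m) n (k + 1)),
    ‖pair H T f k w Ψ‖ₑ ^ 2 ≤ ‖f (k + m)‖ₑ ^ 2 *
      (kmConst H ^ m * ∫⁻ y, ∫⁻ ξ, ‖Ψ.1 y ξ‖ₑ ^ 2 ∂volume ∂timesMeasure T m)
  | _, k, .nil, Ψ => by
    refine (enorm_inner_sq_le (X := Unit) (f k) () Ψ).trans_eq ?_
    rw [pow_zero, one_mul, add_zero]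
    congr 1
    exact (lintegral_dirac (α := Unit) () (fun y => ∫⁻ ξ, ‖Ψ.1 y ξ‖ₑ ^ 2)).symm
  | _, k, .cons (m := m) l w, Ψ => by
    have h1 := enorm_pair_sq_le f (k + 1) w (stepL (X := Times m) H T l Ψ)
    have h2 : ∫⁻ x, ∫⁻ z, ‖(stepL (X := Times m) H T l Ψ).1 x z‖ₑ ^ 2 ∂volume ∂timesMeasure T m
        ≤ ∫⁻ x, kmConst H * ∫⁻ t, ∫⁻ ξ, ‖Ψ.1 ((t, x) : ℝ × Times m) ξ‖ₑ ^ 2 ∂volume ∂tm T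
          ∂timesMeasure T m :=
      lintegral_mono fun x => lintegral_stepL_le (X := Times m) H T l Ψ x
    have h3 : ∫⁻ y, ∫⁻ ξ, ‖Ψ.1 y ξ‖ₑ ^ 2 ∂volume ∂timesMeasure T (m + 1)
        = ∫⁻ x, ∫⁻ t, ∫⁻ ξ, ‖Ψ.1 ((t, x) : ℝ × Times m) ξ‖ₑ ^ 2 ∂volume ∂tm T
          ∂timesMeasure T m :=
      lintegral_prod_symm' (μ := tm T) (ν := timesMeasure T m)
        (fun y : ℝ × Times m => ∫⁻ ξ, ‖Ψ.1 y ξ‖ₑ ^ 2)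
        (measurable_lintegral_sq (X := ℝ × Times m) Ψ)
    have e : k + 1 + m = k + (m + 1) := by omega
    rw [e] at h1
    refine h1.trans (mul_le_mul_right ?_ _)
    rw [h3]
    refine (mul_le_mul_right h2 _).trans_eq ?_
    rw [lintegral_const_mul' _ _ ENNReal.coe_ne_top, pow_succ, mul_assoc]

/-- At most one summand is nonzero, and it has norm at most `1`. -/
theorem norm_sum_le_one {ι : Type*} (S : Finset ι) (b : ι → ℂ) (h1 : ∀ i ∈ S, ‖b i‖ ≤ 1)
    (h2 : ∀ i ∈ S, ∀ j ∈ S, b i ≠ 0 → b j ≠ 0 → i = j) : ‖∑ i ∈ S, b i‖ ≤ 1 := by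
  by_cases h : ∀ i ∈ S, b i = 0
  · rw [Finset.sum_eq_zero h, norm_zero]
    exact zero_le_one
  · push Not at h
    obtain ⟨i, hi, hb⟩ := h
    rw [Finset.sum_eq_single_of_mem i hi fun j hj hne => by
      by_contra hb'
      exact hne (h2 j hj i hi hb' hb)]
    exact h1 i hi

/-- The heart of the combinatorial argument, by induction on `m`. The time cut-offs in `later` order
the times, and the collision applied first to `ψ` carries the latest time; so `ψ` is always
evaluated at `lastTime`. Reduction to normal form permutes the times, but the latest time still
marks the slot of that collision. Hence for given times at most one summand with a given normal form
is nonzero, and the coefficients stay bounded by `1`. The support condition ensures that for `m ≠ 0`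
the time of `ψ` is one of the integration variables and not `s`. -/
theorem exists_expansion_eq (hμ : |μ| ≤ 1) (f : Hierarchy n) (s : ℝ) : ∀ m k : ℕ,
    ∃ (c : Word m → Times m → ℂ) (hc : ∀ u, Measurable (c u)) (hb : ∀ u y, ‖c u y‖ ≤ 1),
      (∀ u y, c u y ≠ 0 → m ≠ 0 → s < lastTime s m y) ∧
      ∀ ψ : TestOn ℝ n (k + 1), expansion H T μ f s m k ψ =
        ∑ u ∈ normalWords (k + 1) m,
          pair H T f k u (mulc (c u) (hc u) (hb u) (pull (lastTime s m) (measurable_lastTime s m) ψ))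
  | 0, k => by
    refine ⟨fun _ _ => 1, fun _ => measurable_const, fun _ _ => by simp, fun u y _ h => absurd rfl h,
      fun ψ => ?_⟩
    rw [normalWords, Finset.sum_singleton]
    have h1 : mulc (fun _ => 1) measurable_const (fun _ => by simp)
        (pull (Y := Times 0) (lastTime s 0) (measurable_lastTime s 0) ψ)
        = pull (lastTime s 0) (measurable_lastTime s 0) ψ := by
      apply TestOn.ext
      intro x z
      exact one_mul _
    rw [h1]
    rfl
  | m + 1, k => by
    obtain ⟨c, hc, hb, hs, he⟩ := exists_expansion_eq hμ f s m (k + 1)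
    obtain ⟨S, hS⟩ : ∃ S, S = letters (k + 1) ×ˢ normalWords (k + 2) m := ⟨_, rfl⟩
    -- The coefficient before words are identified: the sign of the new letter, the old coefficient
    -- at the remaining times, and the cut-off by which the time of the new letter is the latest.
    obtain ⟨b, hbdef⟩ : ∃ b : ((ℕ × Bool) × Word m) → Times (m + 1) → ℂ, b = fun i y =>
        letterSign μ i.1 * (c i.2 (splitTime (pos i.1 i.2) m y).2 *
          if lastTime s m (splitTime (pos i.1 i.2) m y).2 < (splitTime (pos i.1 i.2) m y).1
            then 1 else 0) := ⟨_, rfl⟩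
    have hbm : ∀ i, Measurable (b i) := by
      intro i
      have h1 := measurable_splitTime (pos i.1 i.2) m
      rw [hbdef]
      refine ((((hc i.2).comp h1.snd).mul (Measurable.ite (measurableSet_lt
        ((measurable_lastTime s m).comp h1.snd) h1.fst) measurable_const measurable_const))).const_mul _
    have hb0 : ∀ i y, b i y ≠ 0 →
        lastTime s m (splitTime (pos i.1 i.2) m y).2 < (splitTime (pos i.1 i.2) m y).1 := by
      intro i y h
      by_contra h1
      rw [hbdef] at h
      simp [h1] at h
    have hb1 : ∀ i y, ‖b i y‖ ≤ 1 := by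
      intro i y
      rw [hbdef]
      simp only [norm_mul]
      refine mul_le_one₀ (norm_letterSign_le μ hμ _) (by positivity)
        (mul_le_one₀ (hb _ _) (norm_nonneg _) ?_)
      split_ifs <;> simp
    have hlt : ∀ i y, b i y ≠ 0 → (splitTime (pos i.1 i.2) m y).1 = lastTime s (m + 1) y := by
      intro i y h
      rw [← lastTime_splitTime s (pos i.1 i.2) m y, max_eq_left (hb0 i y h).le]
    refine ⟨fun u y => ∑ i ∈ S with ins i.1 i.2 = u, b i y,
      fun u => Finset.measurable_sum _ fun i _ => hbm i, fun u y => ?_, fun u y h _ => ?_, fun ψ => ?_⟩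
    -- A nonzero coefficient forces the time in the slot `pos` to be the strict maximum, so two
    -- nonzero summands share their position; position and normal form determine letter and word by
    -- `unins_ins`.
    · refine norm_sum_le_one _ _ (fun i _ => hb1 i y) fun i hi j hj hbi hbj => ?_
      have hp : pos i.1 i.2 = pos j.1 j.2 := by
        by_contra hne
        have h1 := splitTime_fst_le_lastTime s m _ _ (pos_le i.1 i.2) (pos_le j.1 j.2) hne y
        have h2 := hb0 i y hbi
        have h3 := hlt i y hbi
        have h4 := hlt j y hbj
        linarith
      have h1 := unins_ins i.1 i.2
      have h2 := unins_ins j.1 j.2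
      rw [(Finset.mem_filter.1 hi).2] at h1
      rw [(Finset.mem_filter.1 hj).2, ← hp, h1] at h2
      exact h2
    · obtain ⟨i, hi, hne⟩ := Finset.exists_ne_zero_of_sum_ne_zero h
      rw [← hlt i y hne]
      refine lt_of_le_of_lt ?_ (hb0 i y hne)
      have : ∀ (m : ℕ) (x : Times m), s ≤ lastTime s m x := by
        intro m
        induction m with
        | zero => exact fun _ => le_rfl
        | succ m ih => exact fun x => (ih x.2).trans (le_max_right _ _)
      exact this _ _
    · obtain ⟨Φ, hΦ⟩ : ∃ Φ : ((ℕ × Bool) × Word m) → TestOn (ℝ × Times m) n (k + 1), Φ = fun i =>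
          mulc (fun p : ℝ × Times m => c i.2 p.2) ((hc i.2).comp measurable_snd) (fun p => hb _ _)
            (pull (fun p : ℝ × Times m => (p.1, lastTime s m p.2))
              (measurable_fst.prodMk ((measurable_lastTime s m).comp measurable_snd)) (later ψ)) :=
        ⟨_, rfl⟩
      have h1 : expansion H T μ f s (m + 1) k ψ
          = ∑ i ∈ S, letterSign μ i.1 • pair H T f k (ins i.1 i.2)
            (pull (splitTime (pos i.1 i.2) m) (measurable_splitTime _ _) (Φ i)) := by
        have h2 : expansion H T μ f s (m + 1) k ψ
          = expansion H T μ f s m (k + 1) (duhamel H T μ ψ) := rfl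
        rw [h2, he, hS, Finset.sum_product_right]
        refine Finset.sum_congr rfl fun w _ => ?_
        rw [duhamel_eq, map_sum, map_sum, map_sum]
        refine Finset.sum_congr rfl fun l _ => ?_
        rw [map_smul, map_smul, map_smul, pull_stepL, mulc_stepL, ← pair_cons, pair_ins, hΦ]
      have hmaps : ∀ i ∈ S, ins i.1 i.2 ∈ normalWords (k + 1) (m + 1) := by
        intro i hi
        rw [hS, Finset.mem_product] at hi
        exact ins_mem_normalWords i.1 _ i.2 (mem_letters.1 hi.1) hi.2
      rw [h1, ← Finset.sum_fiberwise_of_maps_to hmaps]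
      refine Finset.sum_congr rfl fun u _ => ?_
      have h3 : ∀ i ∈ S.filter (fun i => ins i.1 i.2 = u), letterSign μ i.1 •
          pair H T f k (ins i.1 i.2)
            (pull (splitTime (pos i.1 i.2) m) (measurable_splitTime _ _) (Φ i))
          = pair H T f k u (letterSign μ i.1 •
            (pull (splitTime (pos i.1 i.2) m) (measurable_splitTime _ _) (Φ i))) := by
        intro i hi
        rw [map_smul, (Finset.mem_filter.1 hi).2]
      rw [Finset.sum_congr rfl h3, ← map_sum]
      congr 1
      apply TestOn.ext
      intro y ξ
      rw [mulc_apply, Finset.sum_mul, AddSubmonoidClass.coe_finsetSum, Finset.sum_apply,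
        Finset.sum_apply]
      refine Finset.sum_congr rfl fun i _ => ?_
      have h4 : (letterSign μ i.1 • pull (splitTime (pos i.1 i.2) m)
          (measurable_splitTime _ _) (Φ i)).1 y ξ = b i y * ψ.1 (splitTime (pos i.1 i.2) m y).1 ξ := by
        rw [hΦ, hbdef]
        change letterSign μ i.1 * (_ * (_ * _)) = _
        simp only [mul_assoc]
        rfl
      rw [h4, pull_apply]
      by_cases h0 : b i y = 0
      · rw [h0, zero_mul, zero_mul]
      · rw [hlt i y h0]

/-- The norm of a test function in `L²([0,T] × Conf n k)`. -/
def testNorm {k : ℕ} (ψ : TestOn ℝ n k) : ℝ :=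
  √(∫⁻ t, ∫⁻ ξ, ‖ψ.1 t ξ‖ₑ ^ 2 ∂volume ∂tm T).toReal

theorem testNorm_nonneg {k : ℕ} (ψ : TestOn ℝ n k) : 0 ≤ testNorm T ψ := Real.sqrt_nonneg _

theorem lintegral_test_lt_top {k : ℕ} (ψ : TestOn ℝ n k) :
    ∫⁻ t, ∫⁻ ξ, ‖ψ.1 t ξ‖ₑ ^ 2 ∂volume ∂tm T < ⊤ := by
  obtain ⟨M, hM⟩ := TestOn.bounded_L2 ψ
  refine (lintegral_mono (g := fun _ => (M : ℝ≥0∞) ^ 2) fun t => ?_).trans_lt ?_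
  · rw [← eLpNorm_two_sq]
    exact pow_le_pow_left₀ zero_le (hM t) 2
  · rw [lintegral_const]
    exact ENNReal.mul_lt_top (ENNReal.pow_lt_top ENNReal.coe_lt_top) (measure_lt_top _ _)

/-- The constant in the estimate of the Duhamel expansion. -/
def expConst : ℝ := 16 * √(kmConst H)

theorem expConst_nonneg : 0 ≤ expConst H := by
  unfold expConst
  positivity

/-- Where `c` is nonzero, `ψ` is evaluated at one of the `m` times, so its square is at most the sum
over all of them; the integral of this sum is `m T^(m-1)` times the squared norm of `ψ`. The factor
`m ≤ (2 ^ m) ^ 2` is absorbed into the `2` of the base, and `√T` on the left makes up for the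
exponent `m - 1`. -/
theorem norm_pair_cut_le (hT : 0 ≤ T) (f : Hierarchy n) (s : ℝ) {m : ℕ} (k : ℕ)
    (u : Word m) (c : Times m → ℂ) (hc : Measurable c) (hb : ∀ y, ‖c y‖ ≤ 1)
    (hs : ∀ y, c y ≠ 0 → s < lastTime s m y) (ψ : TestOn ℝ n (k + 1)) :
    √T * ‖pair H T f k u (mulc c hc hb (pull (lastTime s m) (measurable_lastTime s m) ψ))‖
      ≤ (2 * (√(kmConst H) * √T)) ^ m * ‖f (k + m)‖ * testNorm T ψ := by
  obtain ⟨v, hv⟩ : ∃ v : ℝ → ℝ≥0∞, v = fun t => ∫⁻ ξ, ‖ψ.1 t ξ‖ₑ ^ 2 := ⟨_, rfl⟩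
  have hvm : Measurable v := by
    rw [hv]
    exact measurable_lintegral_sq ψ
  have h1 := enorm_pair_sq_le H T f k u
    (mulc c hc hb (pull (lastTime s m) (measurable_lastTime s m) ψ))
  have h2 : ∫⁻ y, ∫⁻ ξ, ‖(mulc c hc hb (pull (lastTime s m) (measurable_lastTime s m) ψ)).1 y ξ‖ₑ ^ 2
      ∂volume ∂timesMeasure T m ≤ ∫⁻ y, sumTimes v m y ∂timesMeasure T m := by
    refine lintegral_mono fun y => ?_
    by_cases h0 : c y = 0
    · simp [h0]
    · refine le_trans ?_ (le_sumTimes_of_lt v s m y (hs y h0))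
      rw [hv]
      refine lintegral_mono fun ξ => ?_
      rw [mulc_apply, pull_apply, enorm_mul]
      refine pow_le_pow_left₀ zero_le (mul_le_of_le_one_left zero_le ?_) 2
      rw [← ofReal_norm]
      exact ENNReal.ofReal_le_one.2 (hb y)
  have h3 := lintegral_sumTimes T hvm m
  obtain ⟨a, ha⟩ : ∃ a, a = pair H T f k u
    (mulc c hc hb (pull (lastTime s m) (measurable_lastTime s m) ψ)) := ⟨_, rfl⟩
  rw [← ha] at h1 ⊢
  have h4 : ENNReal.ofReal T * ‖a‖ₑ ^ 2 ≤ ‖f (k + m)‖ₑ ^ 2 *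
      (kmConst H ^ m * (m * ENNReal.ofReal T ^ m * ∫⁻ t, v t ∂tm T)) := by
    rw [← h3]
    refine (mul_le_mul_right (h1.trans (mul_le_mul_right (mul_le_mul_right h2 _) _)) _).trans_eq ?_
    ring
  have hV : ∫⁻ t, v t ∂tm T ≠ ⊤ := by
    rw [hv]
    exact (lintegral_test_lt_top T ψ).ne
  have h5 : T * ‖a‖ ^ 2 ≤ ‖f (k + m)‖ ^ 2 *
      ((kmConst H : ℝ) ^ m * (m * T ^ m * (∫⁻ t, v t ∂tm T).toReal)) := by
    have := ENNReal.toReal_mono (by finiteness) h4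
    simpa [ENNReal.toReal_mul, ENNReal.toReal_pow, ENNReal.toReal_ofReal hT] using this
  have h6 : (testNorm T ψ) ^ 2 = (∫⁻ t, v t ∂tm T).toReal := by
    rw [testNorm, Real.sq_sqrt ENNReal.toReal_nonneg, hv]
  have h7 : (m : ℝ) ≤ (2 ^ m) ^ 2 := by
    have h8 : (m : ℝ) ≤ 2 ^ m := by exact_mod_cast Nat.lt_two_pow_self.le
    have h9 : (1 : ℝ) ≤ 2 ^ m := one_le_pow₀ (by norm_num)
    nlinarith
  refine abs_le_of_sq_le_sq' ?_ ?_ |>.2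
  · rw [mul_pow, Real.sq_sqrt hT]
    refine h5.trans ?_
    rw [← h6]
    have e : ((2 * (√(kmConst H) * √T)) ^ m * ‖f (k + m)‖ * testNorm T ψ) ^ 2
        = ‖f (k + m)‖ ^ 2 * (((√(kmConst H)) ^ 2) ^ m * ((2 ^ m) ^ 2 * ((√T) ^ 2) ^ m
          * testNorm T ψ ^ 2)) := by
      rw [mul_pow 2, mul_pow (√_)]
      ring
    rw [e, Real.sq_sqrt hT, Real.sq_sqrt (NNReal.coe_nonneg _)]
    gcongr
  · have := testNorm_nonneg T ψ
    positivity

/-- There are at most `2^(k+1) * 8^m` normal words, each bounded by `norm_pair_cut_le`; the factors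
`8` and `2` give the `16` of `expConst`. -/
theorem norm_expansion_le (hμ : |μ| ≤ 1) (hT : 0 ≤ T) (f : Hierarchy n) (s : ℝ) {m : ℕ} (hm : m ≠ 0)
    (k : ℕ) (ψ : TestOn ℝ n (k + 1)) :
    √T * ‖expansion H T μ f s m k ψ‖
      ≤ 2 ^ (k + 1) * (expConst H * √T) ^ m * ‖f (k + m)‖ * testNorm T ψ := by
  obtain ⟨c, hc, hb, hs, he⟩ := exists_expansion_eq H T μ hμ f s m k
  rw [he]
  have h1 : ∀ u ∈ normalWords (k + 1) m,
      √T * ‖pair H T f k u (mulc (c u) (hc u) (hb u)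
        (pull (lastTime s m) (measurable_lastTime s m) ψ))‖
      ≤ (2 * (√(kmConst H) * √T)) ^ m * ‖f (k + m)‖ * testNorm T ψ := fun u _ =>
    norm_pair_cut_le H T hT f s k u (c u) (hc u) (hb u) (fun y h => hs u y h hm) ψ
  refine (mul_le_mul_of_nonneg_left (norm_sum_le _ _) (Real.sqrt_nonneg _)).trans ?_
  rw [Finset.mul_sum]
  refine (Finset.sum_le_card_nsmul _ _ _ h1).trans ?_
  have h2 : ((normalWords (k + 1) m).card : ℝ) ≤ 2 ^ (k + 1) * 8 ^ m := by
    exact_mod_cast card_normalWords_le m (k + 1)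
  have h3 := testNorm_nonneg T ψ
  have h4 : (expConst H * √T) ^ m = 8 ^ m * (2 * (√(kmConst H) * √T)) ^ m := by
    rw [expConst, ← mul_pow]
    ring
  rw [nsmul_eq_mul, h4]
  refine (mul_le_mul_of_nonneg_right h2 (by positivity)).trans_eq ?_
  ring

end

end

end GPHierarchy

namespace GPHierarchy

noncomputable section

/-! ### Symmetries -/

/-- Permutation of coordinates as an isometry. -/
def coordIso (n : ℕ) {k : ℕ} (e : Equiv.Perm (Fin k ⊕ Fin k)) : Conf n k ≃ₗᵢ[ℝ] Conf n k :=
  LinearIsometryEquiv.piLpCongrLeft 2 ℝ (Pt n) e.symm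

/-- `permConf` as an isometry. -/
def permIso (n : ℕ) {k : ℕ} (σ : Equiv.Perm (Fin k)) : Conf n k ≃ₗᵢ[ℝ] Conf n k :=
  coordIso n (Equiv.sumCongr σ σ)

/-- `z ↦ -swapConf z` as an isometry. -/
def flipIso (n k : ℕ) : Conf n k ≃ₗᵢ[ℝ] Conf n k :=
  (coordIso n (Equiv.sumComm (Fin k) (Fin k))).trans (LinearIsometryEquiv.neg ℝ)

theorem flipIso_eq {n k : ℕ} (z : Conf n k) : flipIso n k z = -swapConf z := rfl

theorem flipIso_apply {n k : ℕ} (z : Conf n k) (i : Fin k ⊕ Fin k) :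
    flipIso n k z i = -z i.swap := rfl

theorem energy_permIso {n k : ℕ} (σ : Equiv.Perm (Fin k)) (z : Conf n k) :
    energy (permIso n σ z) = energy z := by
  unfold energy
  rw [← Equiv.sum_comp (Equiv.sumCongr σ σ) (fun i => sgn i * (2 * Real.pi * ‖z i‖) ^ 2)]
  refine Finset.sum_congr rfl fun i _ => ?_
  rcases i with i | i <;> rfl

theorem sobolevWeight_permIso {n k : ℕ} (α : ℝ) (σ : Equiv.Perm (Fin k)) (z : Conf n k) :
    sobolevWeight α (permIso n σ z) = sobolevWeight α z := by
  rw [sobolevWeight_eq, sobolevWeight_eq,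
    ← Equiv.prod_comp (Equiv.sumCongr σ σ) (fun i => wt α (z i))]
  rfl

theorem energy_flipIso {n k : ℕ} (z : Conf n k) : energy (flipIso n k z) = -energy z := by
  unfold energy
  rw [← Equiv.sum_comp (Equiv.sumComm (Fin k) (Fin k))
    (fun i => sgn i * (2 * Real.pi * ‖z i‖) ^ 2), ← Finset.sum_neg_distrib]
  refine Finset.sum_congr rfl fun i _ => ?_
  rw [flipIso_apply, norm_neg]
  rcases i with i | i <;> simp [sgn]

theorem sobolevWeight_flipIso {n k : ℕ} (α : ℝ) (z : Conf n k) :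
    sobolevWeight α (flipIso n k z) = sobolevWeight α z := by
  rw [sobolevWeight_eq, sobolevWeight_eq,
    ← Equiv.prod_comp (Equiv.sumComm (Fin k) (Fin k)) (fun i => wt α (z i))]
  refine Finset.prod_congr rfl fun i _ => ?_
  rw [flipIso_apply, wt, wt, norm_neg]
  rfl

/-- The permutation of `k + 1` particles which maps `q'` to `q` and is given by `σ` on the
remaining particles. -/
def permExt {k : ℕ} (σ : Equiv.Perm (Fin k)) (q q' : Fin (k + 1)) : Equiv.Perm (Fin (k + 1)) :=
  (finSuccEquiv' q').trans ((Equiv.optionCongr σ).trans (finSuccEquiv' q).symm)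

theorem permExt_self {k : ℕ} (σ : Equiv.Perm (Fin k)) (q q' : Fin (k + 1)) :
    permExt σ q q' q' = q := by
  simp [permExt]

theorem permExt_succAbove {k : ℕ} (σ : Equiv.Perm (Fin k)) (q q' : Fin (k + 1)) (l : Fin k) :
    permExt σ q q' (q'.succAbove l) = q.succAbove (σ l) := by
  simp [permExt]

theorem merge_permIso {n k : ℕ} (σ : Equiv.Perm (Fin k)) (q q' : Fin (k + 1)) (i : Fin k ⊕ Fin k)
    (z : Conf n (k + 1)) :
    merge i q' (permIso n (permExt σ q q') z) = permIso n σ (merge (i.map σ σ) q z) := by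
  ext l : 1
  have h2 : permIso n σ (merge (i.map σ σ) q z) l = merge (i.map σ σ) q z (l.map σ σ) := rfl
  have h3 : l.map σ σ = i.map σ σ ↔ l = i := (Equiv.sumCongr σ σ).injective.eq_iff
  rw [h2, merge_apply, merge_apply]
  simp only [h3]
  congr 1
  · change z ((l.map _ _).map _ _) = z _
    refine congrArg z.ofLp ?_
    rcases l with l | l <;> simp [permExt_succAbove]
  · congr 1
    change z (Sum.inl _) + z (Sum.inr _) = _
    rw [permExt_self]

theorem merge_flipIso {n k : ℕ} (q : Fin (k + 1)) (i : Fin k ⊕ Fin k) (z : Conf n (k + 1)) :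
    merge i.swap q (flipIso n (k + 1) z) = flipIso n k (merge i q z) := by
  ext l : 1
  have h3 : l.swap = i ↔ l = i.swap := by
    constructor
    · rintro rfl
      simp
    · rintro rfl
      simp
  rw [flipIso_apply, merge_apply, merge_apply]
  simp only [flipIso_apply, h3]
  rw [neg_add]
  congr 1
  · rcases l with l | l <;> rfl
  · split_ifs
    · simp [add_comm]
    · simp

section

variable {X : Type} [MeasurableSpace X] {n k : ℕ}

/-- Composition of test functions with an isometry. -/
def compIso (A : Conf n k ≃ₗᵢ[ℝ] Conf n k) : TestOn X n k →ₗ[ℂ] TestOn X n k where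
  toFun ψ := ⟨fun x ξ => ψ.1 x (A ξ), (TestOn.measurable ψ).comp
      (measurable_fst.prodMk (A.continuous.measurable.comp measurable_snd)),
    (TestOn.bounded ψ).imp fun M hM x ξ => hM _ _,
    (TestOn.bounded_L2 ψ).imp fun M hM x => by
      have h := eLpNorm_comp_measurePreserving (p := 2)
        (TestOn.measurable_slice ψ x).aestronglyMeasurable A.measurePreserving
      exact h.trans_le (hM x)⟩
  map_add' ψ φ := rfl
  map_smul' c ψ := rfl

/-- Complex conjugation of test functions. -/
def conjTest : TestOn X n k →ₛₗ[starRingEnd ℂ] TestOn X n k where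
  toFun ψ := ⟨fun x ξ => (starRingEnd ℂ) (ψ.1 x ξ),
    Complex.continuous_conj.measurable.comp (TestOn.measurable ψ),
    (TestOn.bounded ψ).imp fun M hM x ξ => (RCLike.norm_conj _).trans_le (hM _ _),
    (TestOn.bounded_L2 ψ).imp fun M hM x =>
      (eLpNorm_congr_norm_ae (Eventually.of_forall fun ξ => RCLike.norm_conj _)).trans_le (hM x)⟩
  map_add' ψ φ := by
    apply TestOn.ext
    intro x z
    exact map_add _ _ _
  map_smul' c ψ := by
    apply TestOn.ext
    intro x z
    exact map_mul _ _ _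

@[simp] theorem compIso_apply (A : Conf n k ≃ₗᵢ[ℝ] Conf n k) (ψ : TestOn X n k) (x : X)
    (ξ : Conf n k) : (compIso A ψ).1 x ξ = ψ.1 x (A ξ) := rfl

@[simp] theorem conjTest_apply (ψ : TestOn X n k) (x : X) (ξ : Conf n k) :
    (conjTest ψ).1 x ξ = (starRingEnd ℂ) (ψ.1 x ξ) := rfl

variable {α : ℝ} (H : Adm n α) (T : ℝ)

/-- The energy and the Sobolev weight are invariant under permutations, so only `merge` feels them.
The case `σ = 1` changes nothing but the place `q` of the new particle. -/
theorem step_permIso (σ : Equiv.Perm (Fin k)) (q q' : Fin (k + 1)) (i : Fin k ⊕ Fin k)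
    (ψ : TestOn (ℝ × X) n k) :
    step H T (i.map σ σ) q (compIso (permIso n σ) ψ)
      = compIso (permIso n (permExt σ q q')) (step H T i q' ψ) := by
  apply TestOn.ext
  intro x z
  rw [compIso_apply, step_apply, step_apply, stepFun, stepFun]
  have h1 := merge_permIso σ q q' i z
  simp only [kern, phase, compIso_apply, h1, energy_permIso, sobolevWeight_permIso]

/-- Exchanging the two sides changes the sign of the energy, and complex conjugation changes the
sign of the exponent; together they leave the oscillating factor unchanged. -/
theorem step_flipIso (q : Fin (k + 1)) (i : Fin k ⊕ Fin k) (ψ : TestOn (ℝ × X) n k) :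
    step H T i q (conjTest (compIso (flipIso n k) ψ))
      = conjTest (compIso (flipIso n (k + 1)) (step H T i.swap q ψ)) := by
  apply TestOn.ext
  intro x z
  rw [conjTest_apply, compIso_apply, step_apply, step_apply, stepFun, stepFun]
  have h1 := merge_flipIso q i z
  rw [map_mul, ← integral_conj, Complex.conj_ofReal]
  simp only [kern, phase, h1, energy_flipIso, sobolevWeight_flipIso]
  congr 1
  refine integral_congr_ae (Eventually.of_forall fun t => ?_)
  simp only [conjTest_apply, compIso_apply, map_mul, ← Complex.exp_conj, Complex.conj_ofReal,
    Complex.conj_I]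
  congr 2
  push_cast
  ring

variable (μ : ℝ)

/-- Invariance under permutations of the particles. -/
def PermInvariant (f : L2 n k) : Prop := ∀ σ : Equiv.Perm (Fin k), ∀ᵐ z, f z = f (permConf σ z)

/-- The Hermitian symmetry on the side of the Fourier transform. -/
def FlipInvariant (f : L2 n k) : Prop := ∀ᵐ z, f z = (starRingEnd ℂ) (f (flipIso n k z))

theorem inner_slice (f : L2 n k) (x : X) (ψ : TestOn X n k) :
    inner ℂ f (slice x ψ) = ∫ z, (starRingEnd ℂ) (f z) * ψ.1 x z := by
  rw [L2.inner_def]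
  refine integral_congr_ae ?_
  filter_upwards [coeFn_slice x ψ] with z hz
  rw [hz, RCLike.inner_apply, mul_comm]

theorem integral_comp_iso (A : Conf n k ≃ₗᵢ[ℝ] Conf n k) (F : Conf n k → ℂ) :
    ∫ z, F (A z) = ∫ z, F z :=
  A.measurePreserving.integral_comp A.toHomeomorph.measurableEmbedding F

theorem inner_slice_permIso {f : L2 n k} (hf : PermInvariant f) (σ : Equiv.Perm (Fin k)) (x : X)
    (ψ : TestOn X n k) : inner ℂ f (slice x (compIso (permIso n σ) ψ)) = inner ℂ f (slice x ψ) := by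
  rw [inner_slice, inner_slice,
    ← integral_comp_iso (permIso n σ) fun z => (starRingEnd ℂ) (f z) * ψ.1 x z]
  refine integral_congr_ae ?_
  filter_upwards [hf σ] with z hz
  rw [hz]
  rfl

theorem inner_slice_flipIso {f : L2 n k} (hf : FlipInvariant f) (x : X) (ψ : TestOn X n k) :
    inner ℂ f (slice x (conjTest (compIso (flipIso n k) ψ)))
      = (starRingEnd ℂ) (inner ℂ f (slice x ψ)) := by
  rw [inner_slice, inner_slice, ← integral_conj,
    ← integral_comp_iso (flipIso n k) fun z => (starRingEnd ℂ) ((starRingEnd ℂ) (f z) * ψ.1 x z)]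
  refine integral_congr_ae ?_
  filter_upwards [hf] with z hz
  rw [hz]
  simp

theorem later_comp (A : Conf n k ≃ₗᵢ[ℝ] Conf n k) (ψ : TestOn ℝ n k) :
    later (compIso A ψ) = compIso A (later ψ) := rfl

theorem later_conj (ψ : TestOn ℝ n k) : later (conjTest ψ) = conjTest (later ψ) := by
  apply TestOn.ext
  intro x z
  rw [conjTest_apply, later_apply, later_apply, map_mul]
  split_ifs <;> simp

theorem expansion_permIso {f : Hierarchy n} (hf : ∀ k, PermInvariant (f k)) (s : ℝ) : ∀ (m k : ℕ)
    (σ : Equiv.Perm (Fin (k + 1))) (ψ : TestOn ℝ n (k + 1)),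
    expansion H T μ f s m k (compIso (permIso n σ) ψ) = expansion H T μ f s m k ψ
  | 0, k, σ, ψ => inner_slice_permIso (hf k) σ s ψ
  | m + 1, k, σ, ψ => by
    change expansion H T μ f s m (k + 1) (duhamel H T μ _)
      = expansion H T μ f s m (k + 1) (duhamel H T μ _)
    rw [duhamel, LinearMap.smul_apply, LinearMap.smul_apply, map_smul, map_smul,
      LinearMap.sum_apply, LinearMap.sum_apply, map_sum, map_sum]
    congr 1
    rw [← Equiv.sum_comp (Equiv.sumCongr σ σ)]
    refine Finset.sum_congr rfl fun i _ => ?_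
    have h1 : sgn (Equiv.sumCongr σ σ i) = sgn i := by rcases i with i | i <;> rfl
    rw [h1, LinearMap.smul_apply, LinearMap.smul_apply, map_smul, map_smul, LinearMap.comp_apply,
      LinearMap.comp_apply, later_comp]
    congr 1
    refine (congrArg _ (step_permIso H T σ (adj (i.map σ σ)) (adj i) i (later ψ))).trans ?_
    exact expansion_permIso hf s m (k + 1) _ _

/-- In every collision step the exchange of the sides reverses `sgn` and conjugation reverses
`Complex.I`; the two signs cancel. -/
theorem expansion_flipIso {f : Hierarchy n} (hf : ∀ k, FlipInvariant (f k)) (s : ℝ) : ∀ (m k : ℕ)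
    (ψ : TestOn ℝ n (k + 1)),
    expansion H T μ f s m k (conjTest (compIso (flipIso n (k + 1)) ψ))
      = (starRingEnd ℂ) (expansion H T μ f s m k ψ)
  | 0, k, ψ => inner_slice_flipIso (hf k) s ψ
  | m + 1, k, ψ => by
    change expansion H T μ f s m (k + 1) (duhamel H T μ _)
      = (starRingEnd ℂ) (expansion H T μ f s m (k + 1) (duhamel H T μ _))
    rw [duhamel, LinearMap.smul_apply, LinearMap.smul_apply, map_smul, map_smul,
      LinearMap.sum_apply, LinearMap.sum_apply, map_sum, map_sum, smul_eq_mul, smul_eq_mul, map_mul,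
      map_sum, Finset.mul_sum, Finset.mul_sum, ← Equiv.sum_comp (Equiv.sumComm (Fin (k + 1)) (Fin (k + 1)))]
    refine Finset.sum_congr rfl fun i _ => ?_
    have h1 : sgn (Equiv.sumComm (Fin (k + 1)) (Fin (k + 1)) i) = -sgn i := by
      rcases i with i | i <;> simp [sgn]
    have h2 : adj i.swap = adj i := by rcases i with i | i <;> rfl
    rw [h1, LinearMap.smul_apply, LinearMap.smul_apply, map_smul, map_smul, LinearMap.comp_apply,
      LinearMap.comp_apply, later_conj, later_comp, Equiv.sumComm_apply, step_flipIso, Sum.swap_swap,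
      h2, expansion_flipIso hf s m (k + 1)]
    simp only [smul_eq_mul, map_mul, Complex.conj_I, Complex.conj_ofReal]
    push_cast
    ring

/-- Against a permutation invariant `f` the place of the new particle is irrelevant. This reconciles
the last particle, used in the collision operator, with the adjacent one, used in the normal forms.
-/
theorem inner_slice_step {f : L2 n (k + 1)} (hf : PermInvariant f) (i : Fin k ⊕ Fin k)
    (q q' : Fin (k + 1)) (ψ : TestOn (ℝ × X) n k) (x : X) :
    inner ℂ f (slice x (step H T i q ψ)) = inner ℂ f (slice x (step H T i q' ψ)) := by
  have h := step_permIso H T 1 q q' i ψ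
  have h1 : i.map (1 : Equiv.Perm (Fin k)) (1 : Equiv.Perm (Fin k)) = i := by
    rcases i with i | i <;> rfl
  have h2 : compIso (permIso n 1) ψ = ψ := by
    apply TestOn.ext
    intro y z
    rw [compIso_apply]
    refine congrArg (ψ.1 y) ?_
    ext l : 1
    change z (l.map _ _) = z l
    rcases l with l | l <;> rfl
  rw [h1, h2] at h
  rw [h, inner_slice_permIso hf]

end

end

end GPHierarchy

namespace GPHierarchy

noncomputable section

/-! ### Measurability -/

instance instSecondCountableL2 (n k : ℕ) : SecondCountableTopology (L2 n k) := by
  have : Fact ((2 : ℝ≥0∞) ≠ ⊤) := ⟨by norm_num⟩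
  have h1 : MeasurableSpace.CountablyGenerated (Conf n k) := inferInstance
  have h2 : SFinite (volume : Measure (Conf n k)) := inferInstance
  have : MeasureTheory.IsSeparable (volume : Measure (Conf n k)) := inferInstance
  exact Lp.SecondCountableTopology

theorem exists_seq_tendsto_of_denseRange {ι E : Type*} [PseudoMetricSpace E] {f : ι → E}
    (h : DenseRange f) (c : E) : ∃ a : ℕ → ι, Tendsto (fun j => f (a j)) atTop (𝓝 c) := by
  obtain ⟨u, hu, hlim⟩ := mem_closure_iff_seq_limit.1 (h c)
  choose a ha using hu
  exact ⟨a, by simpa only [ha] using hlim⟩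

/-- Every open set is a countable union of balls, whose preimages are sublevel sets of distance
functions. For `slice` the distance to a fixed element is a parameter integral, hence measurable. -/
theorem stronglyMeasurable_of_dist {X E : Type*} [MeasurableSpace X] [MetricSpace E]
    [SecondCountableTopology E] {f : X → E} (h : ∀ c, Measurable fun x => dist (f x) c) :
    StronglyMeasurable f := by
  borelize E
  refine Measurable.stronglyMeasurable (measurable_of_isOpen fun U hU => ?_)
  choose! r hr hrU using fun x (hx : x ∈ U) => Metric.isOpen_iff.1 hU x hx
  obtain ⟨S, hSU, hSc, hS⟩ := TopologicalSpace.isOpen_biUnion_countable U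
    (fun x => Metric.ball x (r x)) fun x _ => Metric.isOpen_ball
  have h1 : U = ⋃ x ∈ S, Metric.ball x (r x) := by
    rw [hS]
    refine Subset.antisymm (fun x hx => mem_biUnion hx (Metric.mem_ball_self (hr x hx))) ?_
    exact iUnion₂_subset hrU
  rw [h1, preimage_iUnion₂]
  exact MeasurableSet.biUnion hSc fun x _ => (h x) measurableSet_Iio

section

variable {X : Type} [MeasurableSpace X] {n k : ℕ}

theorem stronglyMeasurable_slice (ψ : TestOn X n k) : StronglyMeasurable fun x => slice x ψ := by
  refine stronglyMeasurable_of_dist fun f => ?_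
  have h1 : ∀ x, dist (slice x ψ) f
      = ((∫⁻ ξ, ‖ψ.1 x ξ - f ξ‖ₑ ^ 2) ^ (1 / 2 : ℝ)).toReal := by
    intro x
    have h2 : eLpNorm (slice x ψ - f : L2 n k) 2 volume = eLpNorm (fun ξ => ψ.1 x ξ - f ξ) 2 volume := by
      refine eLpNorm_congr_ae ?_
      filter_upwards [Lp.coeFn_sub (slice x ψ) f, coeFn_slice x ψ] with ξ h3 h4
      rw [h3, Pi.sub_apply, h4]
    rw [dist_eq_norm, Lp.norm_def, h2, ← eLpNorm_two_sq, ← ENNReal.rpow_natCast, ← ENNReal.rpow_mul]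
    norm_num
  simp_rw [h1]
  have h2 : Measurable fun p : X × Conf n k => ‖ψ.1 p.1 p.2 - f p.2‖ₑ ^ 2 :=
    (((TestOn.measurable ψ)).sub ((Lp.stronglyMeasurable f).measurable.comp
      measurable_snd)).enorm.pow_const 2
  exact (h2.lintegral_prod_right'.pow_const _).ennreal_toReal

theorem exists_norm_slice_le (ψ : TestOn X n k) : ∃ M : ℝ, ∀ x, ‖slice x ψ‖ ≤ M := by
  obtain ⟨M, hM⟩ := TestOn.bounded_L2 ψ
  refine ⟨M, fun x => ?_⟩
  have h : ‖slice x ψ‖ = (eLpNorm (ψ.1 x) 2 volume).toReal :=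
    Lp.norm_toLp _ (TestOn.memLp ψ x)
  rw [h]
  exact ENNReal.toReal_mono ENNReal.coe_ne_top (hM x)

theorem integrable_inner_slice {ν : Measure X} {r : X → L2 n k} (hr : Integrable r ν)
    (ψ : TestOn X n k) : Integrable (fun x => inner ℂ (r x) (slice x ψ)) ν := by
  obtain ⟨M, hM⟩ := exists_norm_slice_le ψ
  refine (hr.norm.mul_const M).mono' (hr.aestronglyMeasurable.inner
    (stronglyMeasurable_slice ψ).aestronglyMeasurable) (Eventually.of_forall fun x => ?_)
  exact (norm_inner_le_norm _ _).trans (mul_le_mul_of_nonneg_left (hM x) (norm_nonneg _))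

/-- Products of an indicator function in the parameter with a simple function in `ξ` are test
functions. They show that `r` is almost everywhere orthogonal to any given simple function, and
these are dense. -/
theorem ae_eq_zero_of_test {ν : Measure X} [IsFiniteMeasure ν] {r : X → L2 n k} (hr : Integrable r ν)
    (h : ∀ ψ : TestOn X n k, ∫ x, inner ℂ (r x) (slice x ψ) ∂ν = 0) : r =ᵐ[ν] 0 := by
  have h1 : ∀ c : Lp.simpleFunc ℂ 2 (volume : Measure (Conf n k)),
      (fun x => inner ℂ (r x) (c : L2 n k)) =ᵐ[ν] 0 := by
    intro c
    refine Integrable.ae_eq_zero_of_forall_setIntegral_eq_zero (hr.inner_const _) fun A hA _ => ?_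
    obtain ⟨φ, hφ⟩ : ∃ φ, φ = Lp.simpleFunc.toSimpleFunc c := ⟨_, rfl⟩
    have hφL : MemLp φ 2 volume := by
      rw [hφ]
      exact Lp.simpleFunc.memLp c
    have hφc : hφL.toLp φ = (c : L2 n k) := by
      subst hφ
      have h3 := congrArg Subtype.val (Lp.simpleFunc.toLp_toSimpleFunc c)
      exact h3
    obtain ⟨M, hM⟩ := φ.exists_forall_norm_le
    obtain ⟨ψ, hψ⟩ : ∃ ψ : TestOn X n k, ψ.1 = fun x ξ => A.indicator (fun _ => φ ξ) x := by
      refine ⟨⟨fun x ξ => A.indicator (fun _ => φ ξ) x, ?_, ⟨M, fun x ξ => ?_⟩, ?_⟩, rfl⟩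
      · have e : Function.uncurry (fun x ξ => A.indicator (fun _ => φ ξ) x)
            = (Prod.fst ⁻¹' A).indicator (fun p : X × Conf n k => φ p.2) := by
          ext ⟨x, ξ⟩
          by_cases hx : x ∈ A
          · rw [indicator_of_mem (show (x, ξ) ∈ Prod.fst ⁻¹' A from hx)]
            simp [hx]
          · rw [indicator_of_notMem (show (x, ξ) ∉ Prod.fst ⁻¹' A from hx)]
            simp [hx]
        rw [e]
        exact (φ.measurable.comp measurable_snd).indicator (measurable_fst hA)
      · refine (norm_indicator_le_norm_self _ _).trans (hM ξ)
      · refine ⟨(eLpNorm φ 2 volume).toNNReal, fun x => ?_⟩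
        rw [ENNReal.coe_toNNReal hφL.eLpNorm_ne_top]
        refine eLpNorm_mono fun ξ => ?_
        exact norm_indicator_le_norm_self _ _
    have h2 := h ψ
    rw [← integral_indicator hA, ← h2]
    refine integral_congr_ae (Eventually.of_forall fun x => ?_)
    by_cases hx : x ∈ A
    · have : slice x ψ = (c : L2 n k) := by
        rw [← hφc]
        refine (MemLp.toLp_eq_toLp_iff (TestOn.memLp ψ x) hφL).2 (Eventually.of_forall fun ξ => ?_)
        rw [hψ]
        simp [hx]
      simp [hx, this]
    · have : slice x ψ = 0 := by
        refine (Lp.eq_zero_iff_ae_eq_zero (f := slice x ψ)).2 ((coeFn_slice x ψ).trans ?_)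
        refine Eventually.of_forall fun ξ => ?_
        rw [hψ]
        simp [hx]
      simp [hx, this]
  refine ae_eq_zero_of_forall_inner (𝕜 := ℂ) fun c => ?_
  have hd : DenseRange ((↑) : Lp.simpleFunc ℂ 2 (volume : Measure (Conf n k)) → L2 n k) :=
    Lp.simpleFunc.denseRange (by norm_num)
  obtain ⟨a, hlim⟩ := exists_seq_tendsto_of_denseRange hd c
  have h2 : ∀ᵐ x ∂ν, ∀ j, inner ℂ (r x) (a j : L2 n k) = 0 := ae_all_iff.2 fun j => h1 (a j)
  filter_upwards [h2] with x hx
  have h3 : Tendsto (fun j => inner ℂ (r x) (a j : L2 n k)) atTop (𝓝 (inner ℂ (r x) c)) :=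
    ((innerSL ℂ (r x)).continuous.tendsto c).comp hlim
  simp_rw [hx] at h3
  have h5 : inner ℂ (r x) c = 0 := (tendsto_nhds_unique h3 tendsto_const_nhds)
  exact inner_eq_zero_symm.1 h5

end

section

variable {n k : ℕ} (T : ℝ)

theorem memLp_slice (ψ : TestOn ℝ n k) : MemLp (fun t => slice t ψ) 2 (tm T) := by
  obtain ⟨M, hM⟩ := exists_norm_slice_le ψ
  exact MemLp.of_bound (stronglyMeasurable_slice ψ).aestronglyMeasurable M (Eventually.of_forall hM)

/-- Test functions as elements of `L²([0,T]; L²)`. -/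
def testLp : TestOn ℝ n k →ₗ[ℂ] Lp (L2 n k) 2 (tm T) where
  toFun ψ := (memLp_slice T ψ).toLp _
  map_add' _ _ := rfl
  map_smul' _ _ := rfl

theorem coeFn_testLp (ψ : TestOn ℝ n k) : testLp T ψ =ᵐ[tm T] fun t => slice t ψ :=
  (memLp_slice T ψ).coeFn_toLp

theorem enorm_sq_lp {X E : Type*} [MeasurableSpace X] {μ : Measure X} [NormedAddCommGroup E]
    (f : Lp E 2 μ) : ‖f‖ₑ ^ 2 = ∫⁻ x, ‖f x‖ₑ ^ 2 ∂μ := by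
  rw [Lp.enorm_def, eLpNorm_eq_lintegral_rpow_enorm_toReal (by norm_num) (by norm_num),
    ← ENNReal.rpow_natCast, ← ENNReal.rpow_mul]
  norm_num

theorem norm_testLp (ψ : TestOn ℝ n k) : ‖testLp T ψ‖ = testNorm T ψ := by
  have h1 : ‖testLp T ψ‖ₑ ^ 2 = ∫⁻ t, ∫⁻ ξ, ‖ψ.1 t ξ‖ₑ ^ 2 ∂volume ∂tm T := by
    rw [enorm_sq_lp]
    refine lintegral_congr_ae ?_
    filter_upwards [coeFn_testLp T ψ] with t ht
    rw [ht, enorm_slice_sq]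
  rw [testNorm, ← h1, ENNReal.toReal_pow, toReal_enorm, Real.sqrt_sq (norm_nonneg _)]

/-- The Riesz representation theorem for functionals on test functions. -/
theorem exists_riesz {L : TestOn ℝ n k →ₗ[ℂ] ℂ} {c : ℝ} (hc : 0 ≤ c)
    (hL : ∀ ψ, ‖L ψ‖ ≤ c * testNorm T ψ) :
    ∃ R : Lp (L2 n k) 2 (tm T), ‖R‖ ≤ c ∧ ∀ ψ, L ψ = ∫ t, inner ℂ (R t) (slice t ψ) ∂tm T := by
  have hker : LinearMap.ker (testLp T) ≤ LinearMap.ker L := by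
    intro ψ hψ
    rw [LinearMap.mem_ker] at hψ ⊢
    have := hL ψ
    rw [← norm_testLp, hψ, norm_zero, mul_zero] at this
    exact norm_le_zero_iff.1 this
  obtain ⟨G, hG⟩ : ∃ G : LinearMap.range (testLp (n := n) (k := k) T) →ₗ[ℂ] ℂ,
      ∀ ψ, G ⟨testLp T ψ, LinearMap.mem_range_self _ ψ⟩ = L ψ := by
    refine ⟨(LinearMap.ker (testLp T)).liftQ L hker ∘ₗ
      (LinearMap.quotKerEquivRange (testLp T)).symm.toLinearMap, fun ψ => ?_⟩
    have : (LinearMap.quotKerEquivRange (testLp T)).symm ⟨testLp T ψ, LinearMap.mem_range_self _ ψ⟩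
        = Submodule.Quotient.mk ψ := by
      rw [LinearEquiv.symm_apply_eq]
      rfl
    rw [LinearMap.comp_apply, LinearEquiv.coe_coe, this]
    rfl
  have hGb : ∀ y, ‖G y‖ ≤ c * ‖y‖ := by
    rintro ⟨_, ψ, rfl⟩
    rw [hG]
    refine (hL ψ).trans_eq ?_
    rw [← norm_testLp]
    rfl
  -- The functional is defined only on the image of the test functions, which need not be closed, so
  -- it is extended with the same norm before the Riesz theorem is applied.
  obtain ⟨g, hg, hgn⟩ := exists_extension_norm_eq _ (G.mkContinuous c hGb)
  refine ⟨(InnerProductSpace.toDual ℂ _).symm g, ?_, fun ψ => ?_⟩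
  · rw [LinearIsometryEquiv.norm_map, hgn]
    exact LinearMap.mkContinuous_norm_le _ hc _
  · have h1 : inner ℂ ((InnerProductSpace.toDual ℂ _).symm g) (testLp T ψ) = g (testLp T ψ) :=
      InnerProductSpace.toDual_symm_apply
    have h2 := hg ⟨testLp T ψ, LinearMap.mem_range_self _ ψ⟩
    simp only at h2
    rw [← hG, ← LinearMap.mkContinuous_apply (f := G) c hGb, ← h2, ← h1, L2.inner_def]
    refine integral_congr_ae ?_
    filter_upwards [coeFn_testLp T ψ] with t ht
    rw [ht]

/-- Cauchy-Schwarz in time. The factor `√T` cancels the `(√T)⁻¹` in the bound of the expansion, so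
that the `L¹` norm is controlled by `majorant` itself. -/
theorem lintegral_enorm_le_of_norm_le (hT : 0 ≤ T) (R : Lp (L2 n k) 2 (tm T)) :
    ∫⁻ t, ‖R t‖ₑ ∂tm T ≤ ENNReal.ofReal (√T * ‖R‖) := by
  have h := eLpNorm_le_eLpNorm_mul_rpow_measure_univ (p := 1) (q := 2) (by norm_num)
    (Lp.aestronglyMeasurable R)
  rw [eLpNorm_one_eq_lintegral_enorm, tm_univ] at h
  refine h.trans_eq ?_
  rw [← Lp.enorm_def, ← ofReal_norm, mul_comm, ENNReal.ofReal_mul (Real.sqrt_nonneg _)]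
  congr 1
  rw [ENNReal.ofReal_rpow_of_nonneg hT (by norm_num), Real.sqrt_eq_rpow]
  norm_num

end

end

end GPHierarchy

namespace GPHierarchy

noncomputable section

/-! ### The hierarchy in the interaction picture -/

section

variable {n : ℕ} {α : ℝ} (H : Adm n α) (T μ : ℝ)

/-- The collision terms `r` of a solution of the hierarchy with initial data `g`, in the interaction
picture on the side of the Fourier transform. -/
structure IsInteraction (g : Hierarchy n) (r : ℝ → Hierarchy n) : Prop where
  integrable : ∀ k, Integrable (fun t => r t k) (tm T)
  eq : ∀ (k : ℕ) (ψ : TestOn ℝ n (k + 1)),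
    ∫ t, inner ℂ (r t k) (slice t ψ) ∂tm T = expansion H T μ g 0 1 k ψ
      + ∫ t, inner ℂ (r t (k + 1)) (slice t (duhamel H T μ ψ)) ∂tm T

variable {H T μ}

theorem expansion_sub (f g : Hierarchy n) (s : ℝ) : ∀ (m k : ℕ) (ψ : TestOn ℝ n (k + 1)),
    expansion H T μ (f - g) s m k ψ = expansion H T μ f s m k ψ - expansion H T μ g s m k ψ
  | 0, k, ψ => inner_sub_left (𝕜 := ℂ) (f k) (g k) (slice s ψ)
  | m + 1, k, ψ => expansion_sub f g s m (k + 1) (duhamel H T μ ψ)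

theorem IsInteraction.sub {g g' : Hierarchy n} {r r' : ℝ → Hierarchy n}
    (h : IsInteraction H T μ g r) (h' : IsInteraction H T μ g' r') :
    IsInteraction H T μ (g - g') (r - r') where
  integrable k := (h.integrable k).sub (h'.integrable k)
  eq k ψ := by
    have e : ∀ (j : ℕ) (φ : TestOn ℝ n (j + 1)),
        ∫ t, inner ℂ ((r - r') t j) (slice t φ) ∂tm T
          = ∫ t, inner ℂ (r t j) (slice t φ) ∂tm T - ∫ t, inner ℂ (r' t j) (slice t φ) ∂tm T := by
      intro j φ
      rw [← integral_sub (integrable_inner_slice (h.integrable j) φ)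
        (integrable_inner_slice (h'.integrable j) φ)]
      refine integral_congr_ae (Eventually.of_forall fun t => ?_)
      exact inner_sub_left (𝕜 := ℂ) (r t j) (r' t j) (slice t φ)
    rw [e, e, h.eq, h'.eq, expansion_sub]
    ring

/-- The remainder is an expansion with data `r t` given at time `t`, integrated over `t`. For its
sake `expansion` has the starting time `s` as an argument. -/
theorem IsInteraction.iterate {g : Hierarchy n} {r : ℝ → Hierarchy n}
    (h : IsInteraction H T μ g r) : ∀ (M k : ℕ) (ψ : TestOn ℝ n (k + 1)),
    ∫ t, inner ℂ (r t k) (slice t ψ) ∂tm T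
      = ∑ m ∈ Finset.range M, expansion H T μ g 0 (m + 1) k ψ
        + ∫ t, expansion H T μ (r t) t M k ψ ∂tm T
  | 0, k, ψ => by
    rw [Finset.sum_range_zero, zero_add]
    rfl
  | M + 1, k, ψ => by
    have e := h.iterate M (k + 1) (duhamel H T μ ψ)
    rw [h.eq, e, Finset.sum_range_succ']
    have e2 : ∀ m s f, expansion H T μ f s m (k + 1) (duhamel H T μ ψ)
        = expansion H T μ f s (m + 1) k ψ := fun _ _ _ => rfl
    simp only [e2]
    ring

/-- The majorant of the collision terms. -/
def majorant (H : Adm n α) (T : ℝ) (a : ℕ → ℝ≥0∞) (k : ℕ) : ℝ≥0∞ :=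
  2 ^ (k + 1) * ∑' m : ℕ, ENNReal.ofReal (expConst H * √T) ^ (m + 1) * a (k + m + 1)

theorem le_of_geomSum_lt_top {a : ℕ → ℝ≥0∞} {l : ℝ} (hl : 0 < l) (k : ℕ) :
    a k ≤ geomSum a l * ENNReal.ofReal l ^ (k + 1) := by
  have h1 : a k / ENNReal.ofReal (l ^ (k + 1)) ≤ geomSum a l := ENNReal.le_tsum k
  rw [ENNReal.div_le_iff_le_mul (Or.inl (by positivity)) (Or.inl ENNReal.ofReal_ne_top),
    ENNReal.ofReal_pow hl.le] at h1
  exact h1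

theorem majorant_lt_top {a : ℕ → ℝ≥0∞} {l : ℝ} (hl : 0 < l) (ha : geomSum a l < ⊤)
    (hTl : expConst H * √T * l < 1) (k : ℕ) : majorant H T a k < ⊤ := by
  have hD : 0 ≤ expConst H * √T := mul_nonneg (expConst_nonneg H) (Real.sqrt_nonneg _)
  refine ENNReal.mul_lt_top (by finiteness) ?_
  have h1 : ∀ m : ℕ, ENNReal.ofReal (expConst H * √T) ^ (m + 1) * a (k + m + 1)
      ≤ geomSum a l * ENNReal.ofReal l ^ (k + 1) * ENNReal.ofReal (expConst H * √T * l) ^ (m + 1) := by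
    intro m
    refine (mul_le_mul_right (le_of_geomSum_lt_top hl (k + m + 1)) _).trans_eq ?_
    rw [ENNReal.ofReal_mul hD, mul_pow]
    ring
  refine (ENNReal.tsum_le_tsum h1).trans_lt ?_
  rw [ENNReal.tsum_mul_left]
  refine ENNReal.mul_lt_top (ENNReal.mul_lt_top ha (by finiteness)) ?_
  have h2 : ENNReal.ofReal (expConst H * √T * l) < 1 := by
    rw [← ENNReal.ofReal_one]
    exact (ENNReal.ofReal_lt_ofReal_iff one_pos).2 hTl
  simp_rw [pow_succ]
  rw [ENNReal.tsum_mul_right, ENNReal.tsum_geometric]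
  refine ENNReal.mul_lt_top ?_ ENNReal.ofReal_lt_top
  rw [ENNReal.inv_lt_top]
  exact tsub_pos_of_lt h2

theorem summable_expansion_bound {g : Hierarchy n} {k : ℕ}
    (hfin : majorant H T (fun j => ‖g j‖ₑ) k < ⊤) :
    Summable (fun m => (expConst H * √T) ^ (m + 1) * ‖g (k + m + 1)‖) ∧
      2 ^ (k + 1) * ∑' m, (expConst H * √T) ^ (m + 1) * ‖g (k + m + 1)‖
        = (majorant H T (fun j => ‖g j‖ₑ) k).toReal := by
  have hD : 0 ≤ expConst H * √T := mul_nonneg (expConst_nonneg H) (Real.sqrt_nonneg _)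
  have h1 : ∀ m, (expConst H * √T) ^ (m + 1) * ‖g (k + m + 1)‖
      = (ENNReal.ofReal (expConst H * √T) ^ (m + 1) * ‖g (k + m + 1)‖ₑ).toReal := by
    intro m
    rw [ENNReal.toReal_mul, ENNReal.toReal_pow, ENNReal.toReal_ofReal hD, toReal_enorm]
  have h2 : ∑' m : ℕ, ENNReal.ofReal (expConst H * √T) ^ (m + 1) * ‖g (k + m + 1)‖ₑ ≠ ⊤ := by
    intro h
    rw [majorant, h, ENNReal.mul_top (by positivity)] at hfin
    exact lt_irrefl _ hfin
  simp_rw [h1]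
  refine ⟨ENNReal.summable_toReal h2, ?_⟩
  rw [← ENNReal.tsum_toReal_eq (fun m => by finiteness), majorant, ENNReal.toReal_mul]
  norm_num

theorem norm_expansion_succ_le (hμ : |μ| ≤ 1) (hT : 0 < T) (f : Hierarchy n) (s : ℝ) (m k : ℕ)
    (ψ : TestOn ℝ n (k + 1)) :
    ‖expansion H T μ f s (m + 1) k ψ‖
      ≤ (√T)⁻¹ * testNorm T ψ * 2 ^ (k + 1) * ((expConst H * √T) ^ (m + 1) * ‖f (k + m + 1)‖) := by
  have h1 := norm_expansion_le H T μ hμ hT.le f s (Nat.succ_ne_zero m) k ψ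
  have h2 : 0 < √T := Real.sqrt_pos.2 hT
  rw [← le_div_iff₀' h2] at h1
  refine h1.trans_eq ?_
  rw [Nat.succ_eq_add_one, ← add_assoc]
  field_simp

theorem summable_expansion (hμ : |μ| ≤ 1) (hT : 0 < T) {g : Hierarchy n} {k : ℕ}
    (hfin : majorant H T (fun j => ‖g j‖ₑ) k < ⊤) (ψ : TestOn ℝ n (k + 1)) :
    Summable fun m => expansion H T μ g 0 (m + 1) k ψ :=
  ((summable_expansion_bound hfin).1.mul_left _).of_norm_bounded
    fun m => norm_expansion_succ_le hμ hT g 0 m k ψ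

theorem norm_tsum_expansion_le (hμ : |μ| ≤ 1) (hT : 0 < T) {g : Hierarchy n} {k : ℕ}
    (hfin : majorant H T (fun j => ‖g j‖ₑ) k < ⊤) (ψ : TestOn ℝ n (k + 1)) :
    ‖∑' m, expansion H T μ g 0 (m + 1) k ψ‖
      ≤ (√T)⁻¹ * (majorant H T (fun j => ‖g j‖ₑ) k).toReal * testNorm T ψ := by
  have h1 := summable_expansion_bound hfin
  refine (tsum_of_norm_bounded (h1.1.mul_left _).hasSum
    fun m => norm_expansion_succ_le hμ hT g 0 m k ψ).trans_eq ?_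
  rw [tsum_mul_left, ← h1.2]
  ring

/-- The remainder after `M + 1` collisions carries `(D √T)^(M+1)` and the `L¹` norm of `r_(k+M+1)`,
which grows at most like `l^(k+M+2)`. It decays geometrically as `D √T l < 1`, so `r` is determined
by `g`. -/
theorem IsInteraction.eq_tsum (hμ : |μ| ≤ 1) (hT : 0 < T) {g : Hierarchy n} {r : ℝ → Hierarchy n}
    (h : IsInteraction H T μ g r) {l : ℝ} (hl : 0 < l) (hTl : expConst H * √T * l < 1)
    (hg : geomSum (fun k => ‖g k‖ₑ) l < ⊤)
    (hr : geomSum (fun k => ∫⁻ t, ‖r t k‖ₑ ∂tm T) l < ⊤) (k : ℕ) (ψ : TestOn ℝ n (k + 1)) :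
    ∫ t, inner ℂ (r t k) (slice t ψ) ∂tm T = ∑' m, expansion H T μ g 0 (m + 1) k ψ := by
  have hD : 0 ≤ expConst H * √T := mul_nonneg (expConst_nonneg H) (Real.sqrt_nonneg _)
  have h1 := (summable_expansion hμ hT (majorant_lt_top hl hg hTl k) ψ).hasSum.tendsto_sum_nat
  obtain ⟨c, hc⟩ : ∃ c, c = (√T)⁻¹ * testNorm T ψ * 2 ^ (k + 1) := ⟨_, rfl⟩
  have hc0 : 0 ≤ c := by
    have := testNorm_nonneg T ψ
    rw [hc]
    positivity
  obtain ⟨S, hS⟩ : ∃ S, S = (geomSum (fun k => ∫⁻ t, ‖r t k‖ₑ ∂tm T) l).toReal := ⟨_, rfl⟩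
  have h2 : ∀ M, ‖∫ t, expansion H T μ (r t) t (M + 1) k ψ ∂tm T‖
      ≤ c * (S * l ^ (k + 1)) * (expConst H * √T * l) ^ (M + 1) := by
    intro M
    have h3 : ‖∫ t, expansion H T μ (r t) t (M + 1) k ψ ∂tm T‖
        ≤ ∫ t, c * (expConst H * √T) ^ (M + 1) * ‖r t (k + M + 1)‖ ∂tm T := by
      refine norm_integral_le_of_norm_le ((h.integrable _).norm.const_mul _)
        (Eventually.of_forall fun t => ?_)
      refine (norm_expansion_succ_le hμ hT (r t) t M k ψ).trans_eq ?_
      rw [hc]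
      ring
    have h4 : ∫ t, ‖r t (k + M + 1)‖ ∂tm T ≤ S * l ^ (k + M + 1 + 1) := by
      rw [integral_norm_eq_lintegral_enorm (h.integrable _).aestronglyMeasurable]
      have := ENNReal.toReal_mono (by finiteness)
        (le_of_geomSum_lt_top (a := fun k => ∫⁻ t, ‖r t k‖ₑ ∂tm T) hl (k + M + 1))
      rwa [ENNReal.toReal_mul, ENNReal.toReal_pow, ENNReal.toReal_ofReal hl.le, ← hS] at this
    rw [integral_const_mul] at h3
    refine h3.trans ((mul_le_mul_of_nonneg_left h4 (by positivity)).trans_eq ?_)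
    ring
  have h5 : Tendsto (fun M => ∫ t, expansion H T μ (r t) t (M + 1) k ψ ∂tm T) atTop (𝓝 0) := by
    refine squeeze_zero_norm h2 ?_
    have h6 := (tendsto_pow_atTop_nhds_zero_of_lt_one (by positivity) hTl).comp (tendsto_add_atTop_nat 1)
    simpa using h6.const_mul (c * (S * l ^ (k + 1)))
  have h7 := ((tendsto_add_atTop_iff_nat 1).2 h1).add h5
  rw [add_zero] at h7
  refine tendsto_nhds_unique ?_ h7
  have h8 : ∀ M, ∑ m ∈ Finset.range (M + 1), expansion H T μ g 0 (m + 1) k ψ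
      + ∫ t, expansion H T μ (r t) t (M + 1) k ψ ∂tm T = ∫ t, inner ℂ (r t k) (slice t ψ) ∂tm T :=
    fun M => (h.iterate (M + 1) k ψ).symm
  simp_rw [h8]
  exact tendsto_const_nhds

/-- The sum of the Duhamel expansion, as a functional on test functions. -/
def expansionSum (hμ : |μ| ≤ 1) (hT : 0 < T) {g : Hierarchy n} {k : ℕ}
    (hfin : majorant H T (fun j => ‖g j‖ₑ) k < ⊤) : TestOn ℝ n (k + 1) →ₗ[ℂ] ℂ where
  toFun ψ := ∑' m, expansion H T μ g 0 (m + 1) k ψ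
  map_add' ψ φ := by
    simp_rw [map_add]
    exact (summable_expansion hμ hT hfin ψ).tsum_add (summable_expansion hμ hT hfin φ)
  map_smul' c ψ := by
    simp_rw [map_smul, smul_eq_mul, tsum_mul_left]
    rfl

theorem exists_expansion_riesz (hμ : |μ| ≤ 1) (hT : 0 < T) {g : Hierarchy n} {k : ℕ}
    (hfin : majorant H T (fun j => ‖g j‖ₑ) k < ⊤) :
    ∃ R : Lp (L2 n (k + 1)) 2 (tm T), ∫⁻ t, ‖R t‖ₑ ∂tm T ≤ majorant H T (fun j => ‖g j‖ₑ) k ∧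
      ∀ ψ : TestOn ℝ n (k + 1), ∑' m, expansion H T μ g 0 (m + 1) k ψ
        = ∫ t, inner ℂ (R t) (slice t ψ) ∂tm T := by
  obtain ⟨R, hR, hψ⟩ := exists_riesz T (L := expansionSum hμ hT hfin)
    (c := (√T)⁻¹ * (majorant H T (fun j => ‖g j‖ₑ) k).toReal) (by positivity)
    fun ψ => norm_tsum_expansion_le hμ hT hfin ψ
  refine ⟨R, (lintegral_enorm_le_of_norm_le T hT.le R).trans ?_, hψ⟩
  refine ENNReal.ofReal_le_of_le_toReal ?_
  have h2 : 0 < √T := Real.sqrt_pos.2 hT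
  refine (mul_le_mul_of_nonneg_left hR h2.le).trans_eq ?_
  field_simp

theorem integrable_of_lp {E : Type*} [NormedAddCommGroup E] {p : ℝ≥0∞} (hp : 1 ≤ p)
    (R : Lp E p (tm T)) : Integrable R (tm T) :=
  memLp_one_iff_integrable.1 ((Lp.memLp R).mono_exponent hp)

theorem ae_eq_of_test {k : ℕ} {r r' : ℝ → L2 n k} (hr : Integrable r (tm T))
    (hr' : Integrable r' (tm T)) (h : ∀ ψ : TestOn ℝ n k,
      ∫ t, inner ℂ (r t) (slice t ψ) ∂tm T = ∫ t, inner ℂ (r' t) (slice t ψ) ∂tm T) :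
    r =ᵐ[tm T] r' := by
  have h2 : (fun t => r t - r' t) =ᵐ[tm T] 0 := by
    refine ae_eq_zero_of_test (hr.sub hr') fun ψ => ?_
    simp only [inner_sub_left]
    rw [integral_sub (integrable_inner_slice hr ψ) (integrable_inner_slice hr' ψ), h, sub_self]
  filter_upwards [h2] with t ht
  exact sub_eq_zero.1 ht

theorem IsInteraction.lintegral_le (hμ : |μ| ≤ 1) (hT : 0 < T) {g : Hierarchy n}
    {r : ℝ → Hierarchy n} (h : IsInteraction H T μ g r) {l : ℝ} (hl : 0 < l)
    (hTl : expConst H * √T * l < 1) (hg : geomSum (fun k => ‖g k‖ₑ) l < ⊤)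
    (hr : geomSum (fun k => ∫⁻ t, ‖r t k‖ₑ ∂tm T) l < ⊤) (k : ℕ) :
    ∫⁻ t, ‖r t k‖ₑ ∂tm T ≤ majorant H T (fun j => ‖g j‖ₑ) k := by
  obtain ⟨R, hR, hψ⟩ := exists_expansion_riesz hμ hT (majorant_lt_top hl hg hTl k)
  have h1 := integrable_of_lp one_le_two R
  have h2 : (fun t => r t k) =ᵐ[tm T] R :=
    ae_eq_of_test (h.integrable k) h1 fun ψ => by rw [← hψ, h.eq_tsum hμ hT hl hTl hg hr]
  refine le_trans (le_of_eq (lintegral_congr_ae ?_)) hR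
  filter_upwards [h2] with t ht
  rw [ht]

/-- Composition with an isometry, on `L²`. -/
def compL2 {k : ℕ} (A : Conf n k ≃ₗᵢ[ℝ] Conf n k) : L2 n k →ₗᵢ[ℂ] L2 n k :=
  Lp.compMeasurePreservingₗᵢ ℂ A A.measurePreserving

theorem coeFn_compL2 {k : ℕ} (A : Conf n k ≃ₗᵢ[ℝ] Conf n k) (f : L2 n k) :
    compL2 A f =ᵐ[volume] fun z => f (A z) :=
  Lp.coeFn_compMeasurePreserving f A.measurePreserving

theorem dist_star_L2 {k : ℕ} (f g : L2 n k) : dist (star f) (star g) = dist f g := by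
  rw [dist_eq_norm, dist_eq_norm, Lp.norm_def, Lp.norm_def]
  congr 1
  refine eLpNorm_congr_norm_ae ?_
  filter_upwards [Lp.coeFn_sub (star f) (star g), Lp.coeFn_sub f g, Lp.coeFn_star f,
    Lp.coeFn_star g] with z h1 h2 h3 h4
  rw [h1, h2, Pi.sub_apply, Pi.sub_apply, h3, h4, Pi.star_apply, Pi.star_apply, ← star_sub, norm_star]

theorem norm_star_L2 {k : ℕ} (f : L2 n k) : ‖star f‖ = ‖f‖ := by
  rw [Lp.norm_def, Lp.norm_def]
  congr 1
  refine eLpNorm_congr_norm_ae ?_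
  filter_upwards [Lp.coeFn_star f] with z h1
  rw [h1, Pi.star_apply, norm_star]

theorem continuous_star_L2 (n k : ℕ) : Continuous (star : L2 n k → L2 n k) :=
  (Isometry.of_dist_eq dist_star_L2).continuous

theorem permIso_symm {k : ℕ} (σ : Equiv.Perm (Fin k)) : (permIso n σ).symm = permIso n σ.symm := by
  refine LinearIsometryEquiv.ext fun z => ?_
  rw [LinearIsometryEquiv.symm_apply_eq]
  ext l : 1
  change z l = z ((l.map σ σ).map σ.symm σ.symm)
  rcases l with l | l <;> simp

theorem flipIso_symm {k : ℕ} : (flipIso n k).symm = flipIso n k := by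
  refine LinearIsometryEquiv.ext fun z => ?_
  rw [LinearIsometryEquiv.symm_apply_eq]
  ext l : 1
  rw [flipIso_apply, flipIso_apply, Sum.swap_swap, neg_neg]

theorem inner_compL2 {k : ℕ} (A : Conf n k ≃ₗᵢ[ℝ] Conf n k) (f : L2 n k) (t : ℝ)
    (ψ : TestOn ℝ n k) :
    inner ℂ (compL2 A f) (slice t ψ) = inner ℂ f (slice t (compIso A.symm ψ)) := by
  rw [inner_slice, inner_slice,
    ← integral_comp_iso A fun z => (starRingEnd ℂ) (f z) * (compIso A.symm ψ).1 t z]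
  refine integral_congr_ae ?_
  filter_upwards [coeFn_compL2 A f] with z hz
  rw [hz, compIso_apply, LinearIsometryEquiv.symm_apply_apply]

theorem inner_star_compL2 {k : ℕ} (A : Conf n k ≃ₗᵢ[ℝ] Conf n k) (f : L2 n k) (t : ℝ)
    (ψ : TestOn ℝ n k) :
    inner ℂ (star (compL2 A f)) (slice t ψ)
      = (starRingEnd ℂ) (inner ℂ f (slice t (conjTest (compIso A.symm ψ)))) := by
  rw [inner_slice, inner_slice, ← integral_conj, ← integral_comp_iso A fun z =>
    (starRingEnd ℂ) ((starRingEnd ℂ) (f z) * (conjTest (compIso A.symm ψ)).1 t z)]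
  refine integral_congr_ae ?_
  filter_upwards [coeFn_compL2 A f, Lp.coeFn_star (compL2 A f)] with z hz hz'
  rw [hz', Pi.star_apply, hz, conjTest_apply, compIso_apply, LinearIsometryEquiv.symm_apply_apply]
  simp

theorem permInvariant_iff {k : ℕ} {f : L2 n k} :
    PermInvariant f ↔ ∀ σ, compL2 (permIso n σ) f = f := by
  refine forall_congr' fun σ => ⟨fun h => Lp.ext ?_, fun h => ?_⟩
  · filter_upwards [coeFn_compL2 (permIso n σ) f, h] with z h1 h2
    rw [h1, h2]
    rfl
  · filter_upwards [coeFn_compL2 (permIso n σ) f] with z h1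
    rw [h] at h1
    exact h1

theorem flipInvariant_iff {k : ℕ} {f : L2 n k} :
    FlipInvariant f ↔ star (compL2 (flipIso n k) f) = f := by
  refine ⟨fun h => Lp.ext ?_, fun h => ?_⟩
  · filter_upwards [coeFn_compL2 (flipIso n k) f, h, Lp.coeFn_star (compL2 (flipIso n k) f)]
      with z h1 h2 h3
    rw [h3, h2, Pi.star_apply, h1]
    rfl
  · filter_upwards [coeFn_compL2 (flipIso n k) f, Lp.coeFn_star (compL2 (flipIso n k) f)]
      with z h1 h3
    rw [h, Pi.star_apply, h1] at h3
    exact h3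

/-- The candidate represents the sum of the expansion. Splitting off the first term of the series
for `k` leaves the series for `k + 1` applied to `duhamel H T μ ψ`, which is the equation. The terms
of the expansion inherit the symmetries of `g`, and the representing function is unique. -/
theorem exists_isInteraction (hμ : |μ| ≤ 1) (hT : 0 < T) {g : Hierarchy n} {l : ℝ} (hl : 0 < l)
    (hTl : expConst H * √T * l < 1) (hg : geomSum (fun k => ‖g k‖ₑ) l < ⊤) :
    ∃ r : ℝ → Hierarchy n, IsInteraction H T μ g r ∧
      (∀ k, StronglyMeasurable fun t => r t k) ∧
      (∀ k, ∫⁻ t, ‖r t k‖ₑ ∂tm T ≤ majorant H T (fun j => ‖g j‖ₑ) k) ∧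
      ((∀ k, PermInvariant (g k)) → (∀ k, FlipInvariant (g k)) →
        ∀ᵐ t ∂tm T, ∀ k, PermInvariant (r t k) ∧ FlipInvariant (r t k)) := by
  choose R hR hψ using fun k => exists_expansion_riesz (μ := μ) hμ hT (majorant_lt_top hl hg hTl k)
  have hint : ∀ k, Integrable (R k) (tm T) := fun k => integrable_of_lp one_le_two (R k)
  refine ⟨fun t k => R k t, ⟨hint, fun k ψ => ?_⟩, fun k => Lp.stronglyMeasurable (R k), hR, ?_⟩
  · rw [← hψ, ← hψ, (summable_expansion hμ hT (majorant_lt_top hl hg hTl k) ψ).tsum_eq_zero_add]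
    rfl
  · intro hp hf
    have h1 : ∀ k (σ : Equiv.Perm (Fin (k + 1))),
        (fun t => compL2 (permIso n σ) (R k t)) =ᵐ[tm T] R k := by
      intro k σ
      refine ae_eq_of_test ((compL2 (permIso n σ)).toContinuousLinearMap.integrable_comp (hint k))
        (hint k) fun ψ => ?_
      simp only [inner_compL2, permIso_symm]
      rw [← hψ, ← hψ]
      exact tsum_congr fun m => expansion_permIso H T μ hp 0 (m + 1) k σ.symm ψ
    have h2 : ∀ k, (fun t => star (compL2 (flipIso n (k + 1)) (R k t))) =ᵐ[tm T] R k := by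
      intro k
      have h3 := (compL2 (flipIso n (k + 1))).toContinuousLinearMap.integrable_comp (hint k)
      refine ae_eq_of_test (h3.mono ((continuous_star_L2 n (k + 1)).comp_aestronglyMeasurable
        h3.aestronglyMeasurable) (Eventually.of_forall fun t => (norm_star_L2 _).le)) (hint k) fun ψ => ?_
      simp only [inner_star_compL2, flipIso_symm]
      rw [integral_conj, ← hψ, ← hψ, Complex.conj_tsum]
      refine tsum_congr fun m => ?_
      rw [expansion_flipIso H T μ hf, Complex.conj_conj]
    have h3 : ∀ᵐ t ∂tm T, ∀ k (σ : Equiv.Perm (Fin (k + 1))), compL2 (permIso n σ) (R k t) = R k t :=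
      ae_all_iff.2 fun k => ae_all_iff.2 fun σ => h1 k σ
    have h4 : ∀ᵐ t ∂tm T, ∀ k, star (compL2 (flipIso n (k + 1)) (R k t)) = R k t :=
      ae_all_iff.2 fun k => h2 k
    filter_upwards [h3, h4] with t h5 h6 k
    exact ⟨permInvariant_iff.2 (h5 k), flipInvariant_iff.2 (h6 k)⟩

end

end

end GPHierarchy

namespace GPHierarchy

noncomputable section

/-! ### Quasi-norms -/

theorem geomSum_mono {a b : ℕ → ℝ≥0∞} (h : ∀ k, a k ≤ b k) (l : ℝ) : geomSum a l ≤ geomSum b l :=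
  ENNReal.tsum_le_tsum fun k => ENNReal.div_le_div_right (h k) _

/-- The exponents start at `1`, so every term gains at least one factor `c`. -/
theorem geomSum_mul_le {a : ℕ → ℝ≥0∞} {l c : ℝ} (hl : 0 < l) (hc : 1 ≤ c) :
    geomSum a (c * l) ≤ (ENNReal.ofReal c)⁻¹ * geomSum a l := by
  rw [geomSum, geomSum, ← ENNReal.tsum_mul_left]
  refine ENNReal.tsum_le_tsum fun k => ?_
  have hc0 : 0 < c := by linarith
  have h1 : (ENNReal.ofReal ((c * l) ^ (k + 1)))⁻¹
      ≤ (ENNReal.ofReal c)⁻¹ * (ENNReal.ofReal (l ^ (k + 1)))⁻¹ := by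
    rw [← ENNReal.mul_inv (Or.inr ENNReal.ofReal_ne_top) (Or.inl ENNReal.ofReal_ne_top),
      ← ENNReal.ofReal_mul hc0.le]
    refine ENNReal.inv_le_inv.2 (ENNReal.ofReal_le_ofReal ?_)
    rw [mul_pow]
    exact mul_le_mul_of_nonneg_right (le_self_pow₀ hc (Nat.succ_ne_zero k)) (by positivity)
  rw [div_eq_mul_inv, div_eq_mul_inv, mul_left_comm]
  exact mul_le_mul_right h1 _

theorem geomSum_antitone {a : ℕ → ℝ≥0∞} {l l' : ℝ} (hl : 0 < l) (h : l ≤ l') :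
    geomSum a l' ≤ geomSum a l := by
  have h1 := geomSum_mul_le (a := a) hl ((one_le_div hl).2 h)
  rw [div_mul_cancel₀ _ hl.ne'] at h1
  refine h1.trans (mul_le_of_le_one_left zero_le ?_)
  rw [ENNReal.inv_le_one, ← ENNReal.ofReal_one]
  exact ENNReal.ofReal_le_ofReal ((one_le_div hl).2 h)

theorem geomSum_add (a b : ℕ → ℝ≥0∞) (l : ℝ) :
    geomSum (fun k => a k + b k) l = geomSum a l + geomSum b l := by
  rw [geomSum, geomSum, geomSum, ← ENNReal.tsum_add]
  exact tsum_congr fun k => ENNReal.add_div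

theorem GeomBounded.exists_le_one {a : ℕ → ℝ≥0∞} (h : GeomBounded a) :
    ∃ l : ℝ, 0 < l ∧ geomSum a l ≤ 1 := by
  obtain ⟨l, hl, ha⟩ := h
  have hc : 1 ≤ max 1 (geomSum a l).toReal := le_max_left _ _
  refine ⟨max 1 (geomSum a l).toReal * l, by positivity, (geomSum_mul_le hl hc).trans ?_⟩
  rw [mul_comm, ← div_eq_mul_inv]
  refine ENNReal.div_le_of_le_mul ?_
  rw [one_mul]
  conv_lhs => rw [← ENNReal.ofReal_toReal ha.ne]
  exact ENNReal.ofReal_le_ofReal (le_max_right _ _)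

theorem GeomBounded.mono {a b : ℕ → ℝ≥0∞} (h : ∀ k, a k ≤ b k) (hb : GeomBounded b) :
    GeomBounded a :=
  hb.imp fun l hl => ⟨hl.1, (geomSum_mono h l).trans_lt hl.2⟩

theorem GeomBounded.add {a b : ℕ → ℝ≥0∞} (ha : GeomBounded a) (hb : GeomBounded b) :
    GeomBounded fun k => a k + b k := by
  obtain ⟨l, hl, ha⟩ := ha
  obtain ⟨l', hl', hb⟩ := hb
  refine ⟨max l l', lt_max_of_lt_left hl, ?_⟩
  rw [geomSum_add]
  exact ENNReal.add_lt_top.2 ⟨(geomSum_antitone hl (le_max_left _ _)).trans_lt ha,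
    (geomSum_antitone hl' (le_max_right _ _)).trans_lt hb⟩

theorem quasiNorm_nonneg (a : ℕ → ℝ≥0∞) : 0 ≤ quasiNorm a :=
  mul_nonneg (by norm_num) (Real.sInf_nonneg fun l hl => hl.1.le)

theorem two_mul_quasiNorm (a : ℕ → ℝ≥0∞) :
    2 * quasiNorm a = sInf {l : ℝ | 0 < l ∧ geomSum a l ≤ 1} := by
  rw [quasiNorm]
  ring

theorem two_mul_quasiNorm_le {a : ℕ → ℝ≥0∞} {l : ℝ} (hl : 0 < l) (h : geomSum a l ≤ 1) :
    2 * quasiNorm a ≤ l := by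
  rw [two_mul_quasiNorm]
  exact csInf_le ⟨0, fun x hx => hx.1.le⟩ ⟨hl, h⟩

theorem quasiNorm_mono {a b : ℕ → ℝ≥0∞} (h : ∀ k, a k ≤ b k) (hb : GeomBounded b) :
    quasiNorm a ≤ quasiNorm b := by
  have h1 : 2 * quasiNorm a ≤ 2 * quasiNorm b := by
    rw [two_mul_quasiNorm b]
    refine le_csInf hb.exists_le_one fun l hl => ?_
    exact two_mul_quasiNorm_le hl.1 ((geomSum_mono h l).trans hl.2)
  linarith

theorem exists_rate {a : ℕ → ℝ≥0∞} (ha : GeomBounded a) {L : ℝ} (hL : 2 * quasiNorm a < L) :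
    ∃ l, 0 < l ∧ geomSum a l ≤ 1 ∧ l < L := by
  rw [two_mul_quasiNorm] at hL
  obtain ⟨l, hl, hlt⟩ := exists_lt_of_csInf_lt ha.exists_le_one hL
  exact ⟨l, hl.1, hl.2, hlt⟩

/-- The infimum in `quasiNorm` need not be attained, so the comparison is required at all admissible
rates below some `L` above the infimum. Only such rates are small enough for the smallness condition
on `T`. -/
theorem quasiNorm_le_mul {a b : ℕ → ℝ≥0∞} (ha : GeomBounded a) {L c : ℝ} (hc : 0 < c)
    (hL : 2 * quasiNorm a < L)
    (h : ∀ l, 0 < l → geomSum a l ≤ 1 → l < L → geomSum b (c * l) ≤ 1) :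
    quasiNorm b ≤ c * quasiNorm a := by
  have h1 : ∀ ε > 0, 2 * quasiNorm b ≤ c * (2 * quasiNorm a + ε) := by
    intro ε hε
    obtain ⟨l, hl, h2, h3⟩ := exists_rate ha (L := min L (2 * quasiNorm a + ε))
      (lt_min hL (by linarith))
    refine (two_mul_quasiNorm_le (mul_pos hc hl) (h l hl h2 (h3.trans_le (min_le_left _ _)))).trans ?_
    exact mul_le_mul_of_nonneg_left (h3.le.trans (min_le_right _ _)) hc.le
  have h2 : 2 * quasiNorm b ≤ c * (2 * quasiNorm a) := by
    refine le_of_forall_pos_le_add fun ε hε => ?_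
    refine (h1 (ε / c) (by positivity)).trans_eq ?_
    field_simp
  linarith

section

variable {n : ℕ} {α : ℝ} (H : Adm n α) {T : ℝ}

/-- The hypothesis gives `a k ≤ l^(k+1)`, and with `D √T l ≤ 1/2` the series in `m` sums to at most
`l^(k+1)`. Hence the majorant is at most `(2 l)^(k+1)`, and at the rate `12 l` there remains a
geometric series of ratio `1/6`, with sum `1/5`. The cruder bound `1/2` is what the stability
estimate needs. -/
theorem geomSum_majorant_le {a : ℕ → ℝ≥0∞} {l : ℝ} (hl : 0 < l) (ha : geomSum a l ≤ 1)
    (hTl : expConst H * √T * l ≤ 1 / 2) : geomSum (majorant H T a) (12 * l) ≤ 1 / 2 := by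
  have hD : 0 ≤ expConst H * √T := mul_nonneg (expConst_nonneg H) (Real.sqrt_nonneg _)
  have h1 : ∀ k, majorant H T a k ≤ 2 ^ (k + 1) * ENNReal.ofReal l ^ (k + 1) := by
    intro k
    rw [majorant]
    refine mul_le_mul_right ?_ _
    have h2 : ∀ m : ℕ, ENNReal.ofReal (expConst H * √T) ^ (m + 1) * a (k + m + 1)
        ≤ ENNReal.ofReal l ^ (k + 1) * (2⁻¹) ^ (m + 1) := by
      intro m
      have h3 : a (k + m + 1) ≤ ENNReal.ofReal l ^ (k + m + 1 + 1) := by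
        refine (le_of_geomSum_lt_top hl (k + m + 1)).trans (mul_le_of_le_one_left zero_le ha)
      have h4 : ENNReal.ofReal (expConst H * √T) * ENNReal.ofReal l ≤ 2⁻¹ := by
        rw [← ENNReal.ofReal_mul hD]
        refine (ENNReal.ofReal_le_ofReal hTl).trans_eq ?_
        rw [one_div, ENNReal.ofReal_inv_of_pos two_pos, ENNReal.ofReal_ofNat]
      refine (mul_le_mul_right h3 _).trans ?_
      have h5 : ENNReal.ofReal (expConst H * √T) ^ (m + 1) * ENNReal.ofReal l ^ (k + m + 1 + 1)
          = ENNReal.ofReal l ^ (k + 1)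
            * (ENNReal.ofReal (expConst H * √T) * ENNReal.ofReal l) ^ (m + 1) := by
        rw [mul_pow]
        ring
      rw [h5]
      gcongr
    refine (ENNReal.tsum_le_tsum h2).trans_eq ?_
    rw [ENNReal.tsum_mul_left, ENNReal.tsum_geometric_add_one, ENNReal.one_sub_inv_two, inv_inv,
      ENNReal.inv_mul_cancel (by norm_num) (by norm_num), mul_one]
  have h2 : ∀ k, majorant H T a k / ENNReal.ofReal ((12 * l) ^ (k + 1)) ≤ (6⁻¹ : ℝ≥0∞) ^ (k + 1) := by
    intro k
    refine ENNReal.div_le_of_le_mul ((h1 k).trans_eq ?_)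
    rw [ENNReal.ofReal_pow (by positivity), ENNReal.ofReal_mul (by norm_num), ← mul_pow, ← mul_pow,
      ← mul_assoc, ENNReal.ofReal_ofNat]
    congr 2
    rw [show (12 : ℝ≥0∞) = 6 * 2 by norm_num, ← mul_assoc,
      ENNReal.inv_mul_cancel (by norm_num) (by norm_num), one_mul]
  refine (ENNReal.tsum_le_tsum h2).trans ?_
  rw [ENNReal.tsum_geometric_add_one]
  have h3 : (1 - (6 : ℝ≥0∞)⁻¹)⁻¹ ≤ 2 := by
    rw [ENNReal.inv_le_iff_inv_le, ← ENNReal.one_sub_inv_two]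
    refine tsub_le_tsub_left (ENNReal.inv_le_inv.2 (by norm_num)) _
  refine (mul_le_mul_right h3 _).trans ?_
  rw [mul_comm, ← div_eq_mul_inv, one_div]
  refine ENNReal.div_le_of_le_mul ?_
  rw [show (6 : ℝ≥0∞) = 2 * 3 by norm_num, ← mul_assoc,
      ENNReal.inv_mul_cancel (by norm_num) (by norm_num), one_mul]
  norm_num

variable {a b : ℕ → ℝ≥0∞}

/-- The gap between `1/3` and `1/2` leaves room for a rate strictly above the infimum `2 N`. The
denominator `X + 1` covers `X = 0`. -/
theorem exists_rate_bound {X : ℝ} (hX : 0 ≤ X) {N : ℝ} (h : X * (2 * N) ≤ 1 / 3) :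
    ∃ L, 2 * N < L ∧ X * L ≤ 1 / 2 := by
  refine ⟨2 * N + 1 / (6 * (X + 1)), lt_add_of_pos_right _ (by positivity), ?_⟩
  have : X * (1 / (6 * (X + 1))) ≤ 1 / 6 := by
    rw [mul_one_div, div_le_div_iff₀ (by positivity) (by norm_num)]
    linarith
  linarith

theorem GeomBounded.of_le_majorant (ha : GeomBounded a)
    (hT : expConst H * √T * (2 * quasiNorm a) ≤ 1 / 3) (hb : ∀ k, b k ≤ majorant H T a k) :
    GeomBounded b := by
  have hD : 0 ≤ expConst H * √T := mul_nonneg (expConst_nonneg H) (Real.sqrt_nonneg _)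
  obtain ⟨L, hL, hXL⟩ := exists_rate_bound hD hT
  obtain ⟨l, hl, h1, h2⟩ := exists_rate ha hL
  refine ⟨12 * l, by positivity, (geomSum_mono hb _).trans_lt ((geomSum_majorant_le H hl h1 ?_).trans_lt
    (by norm_num))⟩
  exact (mul_le_mul_of_nonneg_left h2.le hD).trans hXL

theorem quasiNorm_le_of_le_majorant (ha : GeomBounded a)
    (hT : expConst H * √T * (2 * quasiNorm a) ≤ 1 / 3) (hb : ∀ k, b k ≤ majorant H T a k) :
    quasiNorm b ≤ 12 * quasiNorm a := by
  have hD : 0 ≤ expConst H * √T := mul_nonneg (expConst_nonneg H) (Real.sqrt_nonneg _)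
  obtain ⟨L, hL, hXL⟩ := exists_rate_bound hD hT
  refine quasiNorm_le_mul ha (by norm_num) hL fun l hl h1 h2 => ?_
  refine (geomSum_mono hb _).trans ((geomSum_majorant_le H hl h1 ?_).trans (by
    rw [one_div]
    exact ENNReal.inv_le_one.2 one_le_two))
  exact (mul_le_mul_of_nonneg_left h2.le hD).trans hXL

/-- At the rate `13 l` the sum of `a` is at most `1/13` and that of the majorant at most `1/2`; each
takes one half of the permitted `1`. -/
theorem quasiNorm_le_of_le_add_majorant (ha : GeomBounded a)
    (hT : expConst H * √T * (2 * quasiNorm a) ≤ 1 / 3) (hb : ∀ k, b k ≤ a k + majorant H T a k) :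
    quasiNorm b ≤ 13 * quasiNorm a := by
  have hD : 0 ≤ expConst H * √T := mul_nonneg (expConst_nonneg H) (Real.sqrt_nonneg _)
  obtain ⟨L, hL, hXL⟩ := exists_rate_bound hD hT
  refine quasiNorm_le_mul ha (by norm_num) hL fun l hl h1 h2 => ?_
  have h3 := geomSum_majorant_le H hl h1 ((mul_le_mul_of_nonneg_left h2.le hD).trans hXL)
  refine (geomSum_mono hb _).trans ?_
  rw [geomSum_add, ← ENNReal.add_halves 1]
  refine add_le_add ?_ ((geomSum_antitone (by positivity) (by linarith)).trans h3)
  refine (geomSum_mul_le hl (by norm_num)).trans ?_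
  rw [one_div, ENNReal.ofReal_ofNat]
  exact (mul_le_of_le_one_right zero_le h1).trans (ENNReal.inv_le_inv.2 (by norm_num))

end

end

end GPHierarchy

namespace GPHierarchy

noncomputable section

/-! ### Multiplication operators -/

section

variable {n k : ℕ}

theorem memLp_mul {m : Conf n k → ℂ} (hm : Measurable m) {c : ℝ≥0} (hb : ∀ z, ‖m z‖ ≤ c)
    (f : L2 n k) : MemLp (fun z => m z * f z) 2 volume := by
  refine ((Lp.memLp f).const_mul (c : ℂ)).mono
    (hm.aestronglyMeasurable.mul (Lp.aestronglyMeasurable f)) (Eventually.of_forall fun z => ?_)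
  rw [norm_mul, norm_mul]
  refine mul_le_mul_of_nonneg_right ((hb z).trans_eq ?_) (norm_nonneg _)
  simp

/-- Multiplication by a bounded function. -/
def mulL2 (m : Conf n k → ℂ) (hm : Measurable m) (c : ℝ≥0) (hb : ∀ z, ‖m z‖ ≤ c) :
    L2 n k →L[ℂ] L2 n k :=
  LinearMap.mkContinuous
    { toFun := fun f => (memLp_mul hm hb f).toLp _
      map_add' := fun f g => by
        refine Lp.ext ?_
        filter_upwards [(memLp_mul hm hb (f + g)).coeFn_toLp, (memLp_mul hm hb f).coeFn_toLp,
          (memLp_mul hm hb g).coeFn_toLp, Lp.coeFn_add f g,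
          Lp.coeFn_add ((memLp_mul hm hb f).toLp _) ((memLp_mul hm hb g).toLp _)]
          with z h1 h2 h3 h4 h5
        rw [h1, h5, Pi.add_apply, h2, h3, h4, Pi.add_apply, mul_add]
      map_smul' := fun a f => by
        refine Lp.ext ?_
        filter_upwards [(memLp_mul hm hb (a • f)).coeFn_toLp, (memLp_mul hm hb f).coeFn_toLp,
          Lp.coeFn_smul a f, Lp.coeFn_smul a ((memLp_mul hm hb f).toLp _)] with z h1 h2 h3 h4
        rw [h1, RingHom.id_apply, h4, Pi.smul_apply, h2, h3, Pi.smul_apply, smul_eq_mul, smul_eq_mul,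
          mul_left_comm] } c fun f => by
    refine Lp.norm_le_mul_norm_of_ae_le_mul ?_
    filter_upwards [(memLp_mul hm hb f).coeFn_toLp] with z h1
    refine (congrArg _ h1).trans_le ?_
    rw [norm_mul]
    exact mul_le_mul_of_nonneg_right (hb z) (norm_nonneg _)

theorem coeFn_mulL2 {m : Conf n k → ℂ} (hm : Measurable m) {c : ℝ≥0} (hb : ∀ z, ‖m z‖ ≤ c)
    (f : L2 n k) : mulL2 m hm c hb f =ᵐ[volume] fun z => m z * f z :=
  (memLp_mul hm hb f).coeFn_toLp

theorem norm_mulL2_le {m : Conf n k → ℂ} (hm : Measurable m) {c : ℝ≥0} (hb : ∀ z, ‖m z‖ ≤ c)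
    (f : L2 n k) : ‖mulL2 m hm c hb f‖ ≤ c * ‖f‖ :=
  LinearMap.mkContinuous_norm_le _ c.2 _ |>.trans' (le_refl _) |> fun h =>
    (ContinuousLinearMap.le_opNorm _ f).trans (mul_le_mul_of_nonneg_right h (norm_nonneg _))

theorem compL2_mulL2 (A : Conf n k ≃ₗᵢ[ℝ] Conf n k) {m : Conf n k → ℂ} (hm : Measurable m) {c : ℝ≥0}
    (hb : ∀ z, ‖m z‖ ≤ c) (hA : ∀ z, m (A z) = m z) (f : L2 n k) :
    compL2 A (mulL2 m hm c hb f) = mulL2 m hm c hb (compL2 A f) := by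
  refine Lp.ext ?_
  filter_upwards [coeFn_compL2 A (mulL2 m hm c hb f), coeFn_mulL2 hm hb (compL2 A f),
    coeFn_compL2 A f, A.measurePreserving.quasiMeasurePreserving.ae (coeFn_mulL2 hm hb f)]
    with z h1 h2 h3 h4
  rw [h1, h2, h3, h4, hA]

theorem star_compL2_mulL2 (A : Conf n k ≃ₗᵢ[ℝ] Conf n k) {m : Conf n k → ℂ} (hm : Measurable m)
    {c : ℝ≥0} (hb : ∀ z, ‖m z‖ ≤ c) (hA : ∀ z, (starRingEnd ℂ) (m (A z)) = m z) (f : L2 n k) :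
    star (compL2 A (mulL2 m hm c hb f)) = mulL2 m hm c hb (star (compL2 A f)) := by
  refine Lp.ext ?_
  filter_upwards [coeFn_compL2 A (mulL2 m hm c hb f), coeFn_mulL2 hm hb (star (compL2 A f)),
    coeFn_compL2 A f, A.measurePreserving.quasiMeasurePreserving.ae (coeFn_mulL2 hm hb f),
    Lp.coeFn_star (compL2 A (mulL2 m hm c hb f)), Lp.coeFn_star (compL2 A f)]
    with z h1 h2 h3 h4 h5 h6
  rw [h5, Pi.star_apply, h1, h2, h6, Pi.star_apply, h3, h4, star_mul', ← hA z]
  rfl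

theorem tendsto_mulL2 {ι : Type*} {F : Filter ι} [F.IsCountablyGenerated] {m : ι → Conf n k → ℂ}
    (hm : ∀ i, Measurable (m i)) {c : ℝ≥0} (hb : ∀ i z, ‖m i z‖ ≤ c)
    (hlim : ∀ z, Tendsto (fun i => m i z) F (𝓝 1)) (f : L2 n k) :
    Tendsto (fun i => mulL2 (m i) (hm i) c (hb i) f) F (𝓝 f) := by
  have h1 : ∀ i, ‖mulL2 (m i) (hm i) c (hb i) f - f‖ₑ ^ 2 = ∫⁻ z, ‖m i z - 1‖ₑ ^ 2 * ‖f z‖ₑ ^ 2 := by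
    intro i
    rw [enorm_sq_lp]
    refine lintegral_congr_ae ?_
    filter_upwards [Lp.coeFn_sub (mulL2 (m i) (hm i) c (hb i) f) f, coeFn_mulL2 (hm i) (hb i) f]
      with z h1 h2
    rw [h1, Pi.sub_apply, h2, ← mul_pow, ← enorm_mul, sub_mul, one_mul]
  have h2 : Tendsto (fun i => ∫⁻ z, ‖m i z - 1‖ₑ ^ 2 * ‖f z‖ₑ ^ 2) F (𝓝 (∫⁻ _z : Conf n k, 0)) := by
    refine tendsto_lintegral_filter_of_dominated_convergence
      (fun z => ((c : ℝ≥0∞) + 1) ^ 2 * ‖f z‖ₑ ^ 2) ?_ ?_ ?_ ?_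
    · exact Eventually.of_forall fun i => (((hm i).sub_const 1).enorm.pow_const 2).mul
        ((Lp.stronglyMeasurable f).measurable.enorm.pow_const 2)
    · refine Eventually.of_forall fun i => Eventually.of_forall fun z => ?_
      refine mul_le_mul_left (pow_le_pow_left₀ zero_le ?_ 2) _
      refine (enorm_sub_le).trans (add_le_add ?_ (by simp))
      rw [← ofReal_norm]
      refine (ENNReal.ofReal_le_ofReal (hb i z)).trans_eq ENNReal.ofReal_coe_nnreal
    · rw [lintegral_const_mul' _ _ (by finiteness), ← enorm_sq_lp]
      finiteness
    · refine Eventually.of_forall fun z => ?_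
      have h3 : Tendsto (fun i => ‖m i z - 1‖ₑ ^ 2) F (𝓝 (‖(1 : ℂ) - 1‖ₑ ^ 2)) :=
        (ENNReal.continuous_pow 2).continuousAt.tendsto.comp
          (continuous_enorm.continuousAt.tendsto.comp ((hlim z).sub_const 1))
      rw [sub_self, enorm_zero, zero_pow two_ne_zero] at h3
      have h4 := ENNReal.Tendsto.mul_const (b := ‖f z‖ₑ ^ 2) h3 (Or.inr (by finiteness))
      rwa [zero_mul] at h4
  simp_rw [← h1, lintegral_zero] at h2
  rw [tendsto_iff_norm_sub_tendsto_zero]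
  have h3 := (Real.continuous_sqrt.tendsto _).comp ((ENNReal.tendsto_toReal ENNReal.zero_ne_top).comp h2)
  rw [ENNReal.toReal_zero, Real.sqrt_zero] at h3
  refine h3.congr fun i => ?_
  rw [Function.comp_apply, Function.comp_apply, ENNReal.toReal_pow, toReal_enorm,
    Real.sqrt_sq (norm_nonneg _)]

end

end

end GPHierarchy

namespace GPHierarchy

noncomputable section

/-! ### The interaction picture -/

section

variable {n k : ℕ}

theorem integrable_memLp_of_simpleFunc (c : Lp.simpleFunc ℂ 2 (volume : Measure (Conf n k))) :
    ∃ (f : Conf n k → ℂ) (_ : Integrable f) (h : MemLp f 2 volume), h.toLp f = (c : L2 n k) := by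
  have hφL : MemLp (Lp.simpleFunc.toSimpleFunc c) 2 volume := Lp.simpleFunc.memLp c
  have hi : Integrable (Lp.simpleFunc.toSimpleFunc c) volume :=
    (SimpleFunc.memLp_iff_integrable (by norm_num) (by norm_num)).1 hφL
  exact ⟨_, hi, hφL, congrArg Subtype.val (Lp.simpleFunc.toLp_toSimpleFunc c)⟩

/-- Continuous maps on `L²` agree if they agree on `L¹ ∩ L²`. -/
theorem eq_of_eq_on_integrable {Y : Type*} [TopologicalSpace Y] [T2Space Y] {P Q : L2 n k → Y}
    (hP : Continuous P) (hQ : Continuous Q)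
    (h : ∀ (f : Conf n k → ℂ) (_ : Integrable f) (hf : MemLp f 2 volume),
      P (hf.toLp f) = Q (hf.toLp f)) (f : L2 n k) : P f = Q f := by
  have hd : DenseRange ((↑) : Lp.simpleFunc ℂ 2 (volume : Measure (Conf n k)) → L2 n k) :=
    Lp.simpleFunc.denseRange (by norm_num)
  refine congrFun (hd.equalizer hP hQ (funext fun c => ?_)) f
  obtain ⟨f, h1, h2, h3⟩ := integrable_memLp_of_simpleFunc c
  have := h f h1 h2
  rw [h3] at this
  exact this

/-- The inverse Fourier transform on `L²`. -/
def invFT (n k : ℕ) : L2 n k ≃ₗᵢ[ℂ] L2 n k := (Lp.fourierTransformₗᵢ (Conf n k) ℂ).symm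

theorem invFT_symm_eq (f : L2 n k) : (invFT n k).symm f = (𝓕 f : L2 n k) := rfl

theorem coeFn_invFT_toLp {f : Conf n k → ℂ} (h1 : Integrable f) (h2 : MemLp f 2 volume) :
    invFT n k (h2.toLp f) =ᵐ[volume] 𝓕⁻ f :=
  fourierInv_toLp_ae_eq h1 h2

/-- For `g` in `L¹ ∩ L²` this is Fubini. Both sides are continuous in `g`, so it extends by density;
this moves the test function, not the solution, through the Fourier transform. -/
theorem integral_mul_invFT {F : Conf n k → ℂ} (h1 : Integrable F) (h2 : MemLp F 2 volume)
    (g : L2 n k) : ∫ z, F z * invFT n k g z = ∫ ξ, 𝓕⁻ F ξ * g ξ := by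
  have key : ∀ {G : Conf n k → ℂ} (hG : MemLp G 2 volume),
      (fun g : L2 n k => ∫ z, G z * g z) = fun g => inner ℂ (hG.star.toLp _) g := by
    intro G hG
    funext g
    rw [L2.inner_def]
    refine integral_congr_ae ?_
    filter_upwards [hG.star.coeFn_toLp] with z hz
    rw [hz, RCLike.inner_apply]
    simp [mul_comm]
  have h3 : MemLp (𝓕⁻ F) 2 volume :=
    (memLp_congr_ae (fourierInv_toLp_ae_eq h1 h2)).1 (Lp.memLp _)
  refine eq_of_eq_on_integrable (P := fun g => ∫ z, F z * invFT n k g z)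
    (Q := fun g => ∫ ξ, 𝓕⁻ F ξ * g ξ) ?_ ?_ (fun f hf1 hf2 => ?_) g
  · refine (Continuous.comp ?_ (invFT n k).continuous : Continuous ((fun g : L2 n k => ∫ z, F z * g z) ∘ invFT n k))
    rw [key h2]
    fun_prop
  · rw [key h3]
    fun_prop
  · have e1 : ∫ z, F z * invFT n k (hf2.toLp f) z = ∫ z, F z * 𝓕⁻ f z := by
      refine integral_congr_ae ?_
      filter_upwards [coeFn_invFT_toLp hf1 hf2] with z hz
      rw [hz]
    have e2 : ∫ z, 𝓕⁻ F z * (hf2.toLp f) z = ∫ z, 𝓕⁻ F z * f z := by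
      refine integral_congr_ae ?_
      filter_upwards [hf2.coeFn_toLp] with z hz
      rw [hz]
    rw [e1, e2, integral_fourierInv_mul_eq h1 hf1]

theorem compL2_toLp (A : Conf n k ≃ₗᵢ[ℝ] Conf n k) {f : Conf n k → ℂ} (h2 : MemLp f 2 volume) :
    compL2 A (h2.toLp f)
      = (h2.comp_measurePreserving A.measurePreserving).toLp (f ∘ A) := rfl

theorem invFT_compL2 (A : Conf n k ≃ₗᵢ[ℝ] Conf n k) (f : L2 n k) :
    invFT n k (compL2 A f) = compL2 A (invFT n k f) := by
  refine eq_of_eq_on_integrable (P := fun f => invFT n k (compL2 A f))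
    (Q := fun f => compL2 A (invFT n k f)) ?_ ?_ (fun f h1 h2 => ?_) f
  · exact (invFT n k).continuous.comp (compL2 A).continuous
  · exact (compL2 A).continuous.comp (invFT n k).continuous
  · rw [compL2_toLp]
    refine Lp.ext ?_
    have h3 : Integrable (f ∘ A) :=
      (A.measurePreserving.integrable_comp_emb A.toHomeomorph.measurableEmbedding).2 h1
    filter_upwards [coeFn_invFT_toLp h3 (h2.comp_measurePreserving A.measurePreserving),
      coeFn_compL2 A (invFT n k (h2.toLp f)),
      A.measurePreserving.quasiMeasurePreserving.ae (coeFn_invFT_toLp h1 h2)] with z e1 e2 e3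
    rw [e1, e2, e3, Real.fourierInv_comp_linearIsometry]

theorem fourierInv_conj (f : Conf n k → ℂ) (z : Conf n k) :
    𝓕⁻ (fun x => (starRingEnd ℂ) (f x)) z = (starRingEnd ℂ) (𝓕⁻ f (-z)) := by
  rw [Real.fourierInv_eq', Real.fourierInv_eq', ← integral_conj]
  refine integral_congr_ae (Eventually.of_forall fun x => ?_)
  simp only [smul_eq_mul, map_mul, ← Complex.exp_conj]
  have h2 : (starRingEnd ℂ) (2 : ℂ) = 2 := map_ofNat _ 2
  simp [h2]

theorem invFT_star (f : L2 n k) :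
    invFT n k (star f) = star (compL2 (LinearIsometryEquiv.neg ℝ) (invFT n k f)) := by
  refine eq_of_eq_on_integrable (P := fun f => invFT n k (star f))
    (Q := fun f => star (compL2 (LinearIsometryEquiv.neg ℝ) (invFT n k f))) ?_ ?_
    (fun f h1 h2 => ?_) f
  · exact (invFT n k).continuous.comp (continuous_star_L2 n k)
  · exact (continuous_star_L2 n k).comp ((compL2 _).continuous.comp (invFT n k).continuous)
  · have h3 : Integrable (fun x => (starRingEnd ℂ) (f x)) :=
      (LinearIsometryEquiv.integrable_comp_iff Complex.conjLIE).2 h1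
    have h4 : MemLp (fun x => (starRingEnd ℂ) (f x)) 2 volume := h2.star
    have e : star (h2.toLp f) = h4.toLp _ := by
      refine Lp.ext ?_
      filter_upwards [Lp.coeFn_star (h2.toLp f), h2.coeFn_toLp, h4.coeFn_toLp] with z e1 e2 e3
      rw [e1, Pi.star_apply, e2, e3]
      rfl
    rw [e]
    refine Lp.ext ?_
    filter_upwards [coeFn_invFT_toLp h3 h4,
      Lp.coeFn_star (compL2 (LinearIsometryEquiv.neg ℝ) (invFT n k (h2.toLp f))),
      coeFn_compL2 (LinearIsometryEquiv.neg ℝ) (invFT n k (h2.toLp f)),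
      (LinearIsometryEquiv.neg ℝ (E := Conf n k)).measurePreserving.quasiMeasurePreserving.ae
        (coeFn_invFT_toLp h1 h2)] with z e1 e2 e3 e4
    rw [e1, e2, Pi.star_apply, e3, e4, fourierInv_conj]
    rfl

/-- The inverse Fourier transform commutes with permutations of coordinates, but turns conjugation
into conjugation composed with `z ↦ -z`. This explains the sign in `flipIso`. -/
theorem isSymm_invFT {f : L2 n k} : IsSymm (invFT n k f) ↔ PermInvariant f ∧ FlipInvariant f := by
  have h1 : PermInvariant (invFT n k f) ↔ PermInvariant f := by
    rw [permInvariant_iff, permInvariant_iff]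
    refine forall_congr' fun σ => ?_
    rw [← invFT_compL2, (invFT n k).injective.eq_iff]
  have h2 : (∀ᵐ z : Conf n k, invFT n k f z = (starRingEnd ℂ) (invFT n k f (swapConf z)))
      ↔ FlipInvariant f := by
    rw [flipInvariant_iff, ← (invFT n k).injective.eq_iff, invFT_star, invFT_compL2]
    obtain ⟨u, hu⟩ : ∃ u, u = invFT n k f := ⟨_, rfl⟩
    rw [← hu]
    have e : ((star (compL2 (LinearIsometryEquiv.neg ℝ) (compL2 (flipIso n k) u)) : L2 n k)
        : Conf n k → ℂ) =ᵐ[volume] fun z => (starRingEnd ℂ) (u (swapConf z)) := by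
      filter_upwards [Lp.coeFn_star (compL2 (LinearIsometryEquiv.neg ℝ) (compL2 (flipIso n k) u)),
        coeFn_compL2 (LinearIsometryEquiv.neg ℝ) (compL2 (flipIso n k) u),
        (LinearIsometryEquiv.neg ℝ (E := Conf n k)).measurePreserving.quasiMeasurePreserving.ae
          (coeFn_compL2 (flipIso n k) u)] with z e1 e2 e3
      rw [e1, Pi.star_apply, e2, e3]
      have : flipIso n k (LinearIsometryEquiv.neg ℝ z) = swapConf z := by
        rw [LinearIsometryEquiv.coe_neg, map_neg, flipIso_eq, neg_neg]
      rw [this]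
      rfl
    constructor
    · intro h
      refine Lp.ext ?_
      filter_upwards [e, h] with z e1 e2
      rw [e1, e2]
    · intro h
      have := e
      rw [h] at this
      exact this
  rw [IsSymm, and_comm, h2]
  exact and_congr_left' h1

end

end

end GPHierarchy

/-! ### The free evolution as a multiplier, and passage to and from the interaction picture -/

namespace GPHierarchy

noncomputable section

section

variable {n k : ℕ}

theorem continuous_freePhase (t : ℝ) : Continuous (freePhase (n := n) (k := k) t) := by
  unfold freePhase
  fun_prop

theorem norm_freePhase (t : ℝ) (z : Conf n k) : ‖freePhase t z‖ = 1 :=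
  Complex.norm_exp_ofReal_mul_I _

theorem freePhase_add (s t : ℝ) (z : Conf n k) :
    freePhase (s + t) z = freePhase s z * freePhase t z := by
  rw [freePhase_eq, freePhase_eq, freePhase_eq, ← Complex.exp_add]
  congr 1
  push_cast
  ring

theorem freePhase_zero (z : Conf n k) : freePhase 0 z = 1 := by simp [freePhase]

theorem freePhase_ne_zero (t : ℝ) (z : Conf n k) : freePhase t z ≠ 0 := Complex.exp_ne_zero _

theorem conj_freePhase (t : ℝ) (z : Conf n k) :
    (starRingEnd ℂ) (freePhase t z) = freePhase (-t) z := by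
  rw [freePhase_eq, freePhase_eq, ← Complex.exp_conj]
  simp

/-- The free evolution on the side of the Fourier transform. -/
def propagator (n k : ℕ) (t : ℝ) : L2 n k →L[ℂ] L2 n k :=
  mulL2 (freePhase t) (continuous_freePhase t).measurable 1 fun z => (norm_freePhase t z).le

theorem coeFn_propagator (t : ℝ) (f : L2 n k) :
    propagator n k t f =ᵐ[volume] fun z => freePhase t z * f z :=
  coeFn_mulL2 _ _ f

theorem freeEvol_eq (t : ℝ) (f : L2 n k) :
    freeEvol t f = invFT n k (propagator n k t ((invFT n k).symm f)) := rfl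

theorem propagator_add (s t : ℝ) (f : L2 n k) :
    propagator n k (s + t) f = propagator n k s (propagator n k t f) := by
  refine Lp.ext ?_
  filter_upwards [coeFn_propagator (s + t) f, coeFn_propagator s (propagator n k t f),
    coeFn_propagator t f] with z h1 h2 h3
  rw [h1, h2, h3, freePhase_add, mul_assoc]

theorem propagator_zero (f : L2 n k) : propagator n k 0 f = f := by
  refine Lp.ext ?_
  filter_upwards [coeFn_propagator 0 f] with z h1
  rw [h1, freePhase_zero, one_mul]

theorem norm_propagator (t : ℝ) (f : L2 n k) : ‖propagator n k t f‖ = ‖f‖ := by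
  rw [Lp.norm_def, Lp.norm_def]
  congr 1
  refine eLpNorm_congr_norm_ae ?_
  filter_upwards [coeFn_propagator t f] with z h1
  rw [h1, norm_mul, norm_freePhase, one_mul]

theorem tendsto_propagator (f : L2 n k) : Tendsto (fun t => propagator n k t f) (𝓝 0) (𝓝 f) := by
  refine tendsto_mulL2 (c := 1) (fun t => (continuous_freePhase t).measurable)
    (fun t z => (norm_freePhase t z).le) (fun z => ?_) f
  have h : Continuous fun t => freePhase t z := by
    unfold freePhase
    fun_prop
  have := h.tendsto 0
  rwa [freePhase_zero] at this

theorem continuous_propagator : Continuous fun p : ℝ × L2 n k => propagator n k p.1 p.2 := by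
  refine continuous_iff_continuousAt.2 fun p => ?_
  rw [ContinuousAt, tendsto_iff_norm_sub_tendsto_zero]
  have e : ∀ q : ℝ × L2 n k, ‖propagator n k q.1 q.2 - propagator n k p.1 p.2‖
      ≤ ‖q.2 - p.2‖ + ‖propagator n k (q.1 - p.1) p.2 - p.2‖ := by
    intro q
    have h1 : propagator n k q.1 q.2 - propagator n k p.1 p.2
        = propagator n k q.1 (q.2 - p.2)
          + propagator n k p.1 (propagator n k (q.1 - p.1) p.2 - p.2) := by
      rw [map_sub, map_sub, ← propagator_add, add_sub_cancel]
      abel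
    rw [h1]
    refine (norm_add_le _ _).trans_eq ?_
    rw [norm_propagator, norm_propagator]
  refine squeeze_zero (fun _ => norm_nonneg _) e ?_
  have h2 : Tendsto (fun q : ℝ × L2 n k => ‖q.2 - p.2‖) (𝓝 p) (𝓝 0) := by
    have : Continuous fun q : ℝ × L2 n k => ‖q.2 - p.2‖ := by fun_prop
    simpa using this.tendsto p
  have h3 : Tendsto (fun q : ℝ × L2 n k => q.1 - p.1) (𝓝 p) (𝓝 0) := by
    have : Continuous fun q : ℝ × L2 n k => q.1 - p.1 := by fun_prop
    simpa using this.tendsto p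
  have h4 := tendsto_iff_norm_sub_tendsto_zero.1 ((tendsto_propagator p.2).comp h3)
  simpa using h2.add h4

variable {α : ℝ} (H : Adm n α)

/-- The multiplier relating a function and its representation in the interaction picture. -/
def intMult (α t : ℝ) (z : Conf n k) : ℂ := freePhase t z * ((sobolevWeight α z)⁻¹ : ℝ)

theorem measurable_intMult (α t : ℝ) : Measurable (intMult (n := n) (k := k) α t) :=
  ((continuous_freePhase t).measurable).mul
    (Complex.measurable_ofReal.comp (continuous_sobolevWeight α).measurable.inv)

theorem intMult_ne_zero (α t : ℝ) (z : Conf n k) : intMult α t z ≠ 0 :=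
  mul_ne_zero (freePhase_ne_zero t z)
    (Complex.ofReal_ne_zero.2 (inv_ne_zero (sobolevWeight_pos α z).ne'))

include H in
theorem norm_intMult_le (t : ℝ) (z : Conf n k) : ‖intMult α t z‖ ≤ (1 : ℝ≥0) := by
  rw [intMult, norm_mul, norm_freePhase, one_mul, Complex.norm_real, Real.norm_eq_abs, NNReal.coe_one,
    abs_of_pos (inv_pos.2 (sobolevWeight_pos α z))]
  exact inv_le_one_of_one_le₀ (one_le_sobolevWeight H.nonneg z)

theorem intMult_permIso (α t : ℝ) (σ : Equiv.Perm (Fin k)) (z : Conf n k) :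
    intMult α t (permIso n σ z) = intMult α t z := by
  rw [intMult, intMult, freePhase_eq, freePhase_eq, energy_permIso, sobolevWeight_permIso]

theorem intMult_flipIso (α t : ℝ) (z : Conf n k) :
    (starRingEnd ℂ) (intMult α t (flipIso n k z)) = intMult α t z := by
  rw [intMult, intMult, map_mul, conj_freePhase, freePhase_eq, freePhase_eq, energy_flipIso,
    sobolevWeight_flipIso, Complex.conj_ofReal, neg_mul_neg]

/-- The function at time `t` represented by `g` in the interaction picture. -/
def fromInt (k : ℕ) (t : ℝ) : L2 n k →L[ℂ] L2 n k :=
  (invFT n k).toContinuousLinearEquiv.toContinuousLinearMap ∘L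
    mulL2 (intMult α t) (measurable_intMult α t) 1 (norm_intMult_le H t)

theorem fromInt_apply (t : ℝ) (g : L2 n k) : fromInt H k t g
    = invFT n k (mulL2 (intMult α t) (measurable_intMult α t) 1 (norm_intMult_le H t) g) := rfl

theorem symm_fromInt (t : ℝ) (g : L2 n k) :
    (invFT n k).symm (fromInt H k t g) =ᵐ[volume] fun z => intMult α t z * g z := by
  rw [fromInt_apply, LinearIsometryEquiv.symm_apply_apply]
  exact coeFn_mulL2 _ _ _

theorem mulL2_injective {m : Conf n k → ℂ} (hm : Measurable m) {c : ℝ≥0} (hb : ∀ z, ‖m z‖ ≤ c)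
    (h0 : ∀ z, m z ≠ 0) : Function.Injective (mulL2 m hm c hb) := by
  intro f g hfg
  refine Lp.ext ?_
  have h1 := coeFn_mulL2 hm hb f
  rw [hfg] at h1
  filter_upwards [h1, coeFn_mulL2 hm hb g] with z h1 h2
  exact mul_left_cancel₀ (h0 z) (h1.symm.trans h2)

theorem fromInt_injective (t : ℝ) : Function.Injective (fromInt H k t) :=
  (invFT n k).injective.comp (mulL2_injective _ _ (intMult_ne_zero α t))

theorem isSymm_fromInt (t : ℝ) {g : L2 n k} :
    IsSymm (fromInt H k t g) ↔ PermInvariant g ∧ FlipInvariant g := by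
  have hi := mulL2_injective (measurable_intMult (n := n) (k := k) α t) (norm_intMult_le H t)
    (intMult_ne_zero α t)
  rw [fromInt_apply, isSymm_invFT, permInvariant_iff, permInvariant_iff, flipInvariant_iff,
    flipInvariant_iff, star_compL2_mulL2 _ _ _ (intMult_flipIso α t), hi.eq_iff]
  refine and_congr_left' (forall_congr' fun σ => ?_)
  rw [compL2_mulL2 _ _ _ (intMult_permIso α t σ), hi.eq_iff]

/-- The multiplier `intMult` is a phase divided by the Sobolev weight, so the Sobolev norm becomes
the norm of `L²`, at every time `t`. -/
theorem sobolevNorm_fromInt (t : ℝ) (g : L2 n k) : sobolevNorm α (fromInt H k t g) = ‖g‖ₑ := by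
  rw [sobolevNorm, Lp.enorm_def]
  refine eLpNorm_congr_norm_ae ?_
  filter_upwards [symm_fromInt H t g] with z h1
  rw [invFT_symm_eq] at h1
  rw [h1, intMult, norm_mul, norm_mul, norm_mul, norm_freePhase, one_mul, Complex.norm_real,
    Complex.norm_real, norm_inv, ← mul_assoc,
    mul_inv_cancel₀ (norm_ne_zero_iff.2 (sobolevWeight_pos α z).ne'), one_mul]

theorem exists_fromInt_eq (t : ℝ) {f : L2 n k} (hf : sobolevNorm α f < ⊤) :
    ∃ g, fromInt H k t g = f := by
  have hc : Measurable fun z : Conf n k => freePhase (-t) z * (sobolevWeight α z : ℂ) :=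
    ((continuous_freePhase _).mul (Complex.continuous_ofReal.comp
      (continuous_sobolevWeight α))).measurable
  have h1 : MemLp (fun z : Conf n k => freePhase (-t) z * (sobolevWeight α z : ℂ)
      * (𝓕 f : L2 n k) z) 2 volume := by
    refine ⟨hc.aestronglyMeasurable.mul (Lp.aestronglyMeasurable _), ?_⟩
    refine (eLpNorm_congr_norm_ae (Eventually.of_forall fun z => ?_)).trans_lt hf
    rw [norm_mul, norm_mul, norm_mul, norm_freePhase, one_mul]
  refine ⟨h1.toLp _, ?_⟩
  rw [fromInt_apply, ← LinearIsometryEquiv.eq_symm_apply]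
  refine Lp.ext ?_
  filter_upwards [coeFn_mulL2 (measurable_intMult α t) (norm_intMult_le H t) (h1.toLp _),
    h1.coeFn_toLp] with z e1 e2
  rw [e1, e2, intMult, invFT_symm_eq]
  have e3 : freePhase t z * freePhase (-t) z = 1 := by
    rw [← freePhase_add, add_neg_cancel, freePhase_zero]
  have e4 : (((sobolevWeight α z)⁻¹ : ℝ) : ℂ) * (sobolevWeight α z : ℂ) = 1 := by
    rw [← Complex.ofReal_mul, inv_mul_cancel₀ (sobolevWeight_pos α z).ne', Complex.ofReal_one]
  calc _ = (freePhase t z * freePhase (-t) z) * ((((sobolevWeight α z)⁻¹ : ℝ) : ℂ)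
        * (sobolevWeight α z : ℂ)) * (𝓕 f : L2 n k) z := by ring
    _ = _ := by rw [e3, e4, one_mul, one_mul]

/-- The free evolution only shifts the time label. This turns Duhamel's formula into integration
without a propagator. -/
theorem freeEvol_fromInt (s t : ℝ) (g : L2 n k) :
    freeEvol t (fromInt H k s g) = fromInt H k (t + s) g := by
  rw [freeEvol_eq, fromInt_apply, fromInt_apply, LinearIsometryEquiv.symm_apply_apply]
  congr 1
  refine Lp.ext ?_
  filter_upwards [coeFn_propagator t (mulL2 (intMult α s) (measurable_intMult α s) 1
    (norm_intMult_le H s) g), coeFn_mulL2 (measurable_intMult α s) (norm_intMult_le H s) g,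
    coeFn_mulL2 (measurable_intMult α (t + s)) (norm_intMult_le H (t + s)) g] with z e1 e2 e3
  rw [e1, e2, e3, intMult, intMult, freePhase_add]
  ring

theorem fromInt_add (s t : ℝ) (g : L2 n k) :
    fromInt H k (s + t) g = fromInt H k t (propagator n k s g) := by
  rw [fromInt_apply, fromInt_apply]
  congr 1
  refine Lp.ext ?_
  filter_upwards [coeFn_mulL2 (measurable_intMult α t) (norm_intMult_le H t) (propagator n k s g),
    coeFn_mulL2 (measurable_intMult α (s + t)) (norm_intMult_le H (s + t)) g,
    coeFn_propagator s g] with z e1 e2 e3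
  rw [e1, e2, e3, intMult, intMult, freePhase_add]
  ring

/-- The representation in the interaction picture of a function at time `t`. -/
def toInt (k : ℕ) (t : ℝ) (f : L2 n k) : L2 n k := Function.invFun (fromInt H k t) f

theorem fromInt_toInt (t : ℝ) {f : L2 n k} (hf : sobolevNorm α f < ⊤) :
    fromInt H k t (toInt H k t f) = f :=
  Function.invFun_eq (exists_fromInt_eq H t hf)

theorem toInt_fromInt (t : ℝ) (g : L2 n k) : toInt H k t (fromInt H k t g) = g :=
  Function.leftInverse_invFun (fromInt_injective H t) g

theorem enorm_toInt (t : ℝ) {f : L2 n k} (hf : sobolevNorm α f < ⊤) :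
    ‖toInt H k t f‖ₑ = sobolevNorm α f := by
  rw [← sobolevNorm_fromInt H t, fromInt_toInt H t hf]

theorem toInt_sub (t : ℝ) {f g : L2 n k} (hf : sobolevNorm α f < ⊤) (hg : sobolevNorm α g < ⊤) :
    toInt H k t (f - g) = toInt H k t f - toInt H k t g := by
  conv_lhs => rw [← fromInt_toInt H t hf, ← fromInt_toInt H t hg, ← map_sub, toInt_fromInt]

theorem map_toInt_sub (t : ℝ) {f g : L2 n k} (hf : sobolevNorm α f < ⊤)
    (hg : sobolevNorm α g < ⊤) : fromInt H k t (toInt H k t (f - g)) = f - g := by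
  rw [toInt_sub H t hf hg, map_sub, fromInt_toInt H t hf, fromInt_toInt H t hg]

theorem aestronglyMeasurable_propagator {ν : Measure ℝ} {a : ℝ → ℝ} {r : ℝ → L2 n k}
    (ha : AEStronglyMeasurable a ν) (hr : AEStronglyMeasurable r ν) :
    AEStronglyMeasurable (fun t => propagator n k (a t) (r t)) ν := by
  obtain ⟨P, hP⟩ : ∃ P : ℝ × L2 n k → L2 n k, P = fun p => propagator n k p.1 p.2 := ⟨_, rfl⟩
  have hc : Continuous P := hP ▸ continuous_propagator
  have e : (fun t => propagator n k (a t) (r t)) = fun t => P (a t, r t) := by rw [hP]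
  rw [e]
  exact hc.comp_aestronglyMeasurable (ha.prodMk hr)

theorem aestronglyMeasurable_fromInt {ν : Measure ℝ} {r : ℝ → L2 n k}
    (hr : AEStronglyMeasurable r ν) : AEStronglyMeasurable (fun t => fromInt H k t (r t)) ν := by
  have e : ∀ t, fromInt H k t (r t) = fromInt H k 0 (propagator n k t (r t)) := by
    intro t
    rw [← fromInt_add, add_zero]
  simp_rw [e]
  have hp : AEStronglyMeasurable (fun t => propagator n k t (r t)) ν :=
    aestronglyMeasurable_propagator aestronglyMeasurable_id hr
  exact (fromInt H k 0).continuous.comp_aestronglyMeasurable hp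

/-- `toInt` multiplies by the unbounded Sobolev weight `w`. It is the pointwise limit of the bounded
multipliers obtained from `w` and the cut-offs `(N + 1) / (N + 1 + w)`, which tend to `1`. -/
theorem aestronglyMeasurable_toInt {ν : Measure ℝ} {f : ℝ → L2 n k}
    (hf : AEStronglyMeasurable f ν) (hs : ∀ᵐ t ∂ν, sobolevNorm α (f t) < ⊤) :
    AEStronglyMeasurable (fun t => toInt H k t (f t)) ν := by
  obtain ⟨c, hc⟩ : ∃ c : ℕ → Conf n k → ℂ, c = fun (N : ℕ) z =>
    (((N + 1 : ℝ) / (N + 1 + sobolevWeight α z) : ℝ) : ℂ) := ⟨_, rfl⟩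
  have hw : ∀ (N : ℕ) (z : Conf n k), 0 < (N + 1 : ℝ) + sobolevWeight α z := fun N z => by
    have := sobolevWeight_pos α z
    positivity
  have hcm : ∀ N, Measurable (c N) := by
    intro N
    rw [hc]
    exact Complex.measurable_ofReal.comp (measurable_const.div
      ((continuous_sobolevWeight α).measurable.const_add _))
  have hcb : ∀ N z, ‖c N z‖ ≤ (1 : ℝ≥0) := by
    intro N z
    rw [hc]
    simp only
    rw [Complex.norm_real, Real.norm_eq_abs, NNReal.coe_one,
      abs_of_nonneg (div_nonneg (by positivity) (hw N z).le), div_le_one (hw N z)]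
    linarith [sobolevWeight_pos α z]
  have hcl : ∀ z, Tendsto (fun N => c N z) atTop (𝓝 1) := by
    intro z
    rw [hc]
    have h1 : Tendsto (fun N : ℕ => 1 - sobolevWeight α z / (N + 1 + sobolevWeight α z)) atTop
        (𝓝 (1 - 0)) := by
      refine tendsto_const_nhds.sub (Tendsto.div_atTop tendsto_const_nhds ?_)
      exact tendsto_atTop_add_const_right _ _ (tendsto_atTop_add_const_right _ _
        tendsto_natCast_atTop_atTop)
    rw [sub_zero] at h1
    have h2 := (Complex.continuous_ofReal.tendsto _).comp h1
    rw [Complex.ofReal_one] at h2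
    refine h2.congr fun N => ?_
    simp only [Function.comp_apply]
    congr 1
    field_simp [(hw N z).ne']
    ring
  obtain ⟨d, hd⟩ : ∃ d : ℕ → Conf n k → ℂ, d = fun N z => c N z * (sobolevWeight α z : ℂ) := ⟨_, rfl⟩
  have hdm : ∀ N, Measurable (d N) := by
    intro N
    rw [hd]
    exact (hcm N).mul (Complex.measurable_ofReal.comp (continuous_sobolevWeight α).measurable)
  have hdb : ∀ (N : ℕ) z, ‖d N z‖ ≤ ((N + 1 : ℝ≥0) : ℝ) := by
    intro N z
    rw [hd, hc]
    simp only
    rw [← Complex.ofReal_mul, Complex.norm_real, Real.norm_eq_abs, div_mul_eq_mul_div,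
      abs_of_nonneg (div_nonneg (mul_nonneg (by positivity) (sobolevWeight_pos α z).le) (hw N z).le),
      div_le_iff₀ (hw N z)]
    push_cast
    have : (0 : ℝ) < N + 1 := by positivity
    nlinarith [sobolevWeight_pos α z]
  refine aestronglyMeasurable_of_tendsto_ae atTop (f := fun N t =>
    propagator n k (-t) (mulL2 (d N) (hdm N) _ (hdb N) ((invFT n k).symm (f t)))) (fun N => ?_) ?_
  · have h1 : AEStronglyMeasurable (fun t => (invFT n k).symm (f t)) ν :=
      (invFT n k).symm.continuous.comp_aestronglyMeasurable hf
    have h2 : AEStronglyMeasurable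
        (fun t => mulL2 (d N) (hdm N) _ (hdb N) ((invFT n k).symm (f t))) ν :=
      (mulL2 (d N) (hdm N) _ (hdb N)).continuous.comp_aestronglyMeasurable h1
    exact aestronglyMeasurable_propagator aestronglyMeasurable_id.neg h2
  · filter_upwards [hs] with t ht
    obtain ⟨g, hg⟩ := exists_fromInt_eq H t ht
    rw [← hg, toInt_fromInt]
    refine (tendsto_mulL2 hcm hcb hcl g).congr fun N => ?_
    refine Lp.ext ?_
    filter_upwards [coeFn_mulL2 (hcm N) (hcb N) g, coeFn_propagator (-t) (mulL2 (d N) (hdm N) _ (hdb N)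
      ((invFT n k).symm (fromInt H k t g))), coeFn_mulL2 (hdm N) (hdb N)
      ((invFT n k).symm (fromInt H k t g)), symm_fromInt H t g] with z e1 e2 e3 e4
    rw [e1, e2, e3, e4, hd, intMult]
    have e3 : freePhase (-t) z * freePhase t z = 1 := by
      rw [← freePhase_add, neg_add_cancel, freePhase_zero]
    have e4 : (sobolevWeight α z : ℂ) * (((sobolevWeight α z)⁻¹ : ℝ) : ℂ) = 1 := by
      rw [← Complex.ofReal_mul, mul_inv_cancel₀ (sobolevWeight_pos α z).ne', Complex.ofReal_one]
    calc _ = (freePhase (-t) z * freePhase t z) * ((sobolevWeight α z : ℂ)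
          * (((sobolevWeight α z)⁻¹ : ℝ) : ℂ)) * (c N z * g z) := by rw [e3, e4, one_mul, one_mul]
      _ = _ := by ring

end

end

end GPHierarchy

namespace GPHierarchy

noncomputable section

/-! ### The Fourier transform of the mollified collision operator -/

section

variable {n k : ℕ}

/-- The coordinates `u = x_i - x_{k+1}` and `u' = x_{k+1} - x'_{k+1}` relative to a collision. -/
def shear (i : Fin k ⊕ Fin k) (p : Conf n k × (Pt n × Pt n)) : Conf n k × (Pt n × Pt n) :=
  (p.1, (p.1 i - p.2.1, p.1 i - p.2.1 - p.2.2))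

theorem continuous_shear (i : Fin k ⊕ Fin k) : Continuous (shear (n := n) i) := by
  unfold shear
  fun_prop

theorem shear_injective (i : Fin k ⊕ Fin k) : Function.Injective (shear (n := n) i) := by
  rintro ⟨x, u, u'⟩ ⟨y, v, v'⟩ h
  simp only [shear, Prod.mk.injEq] at h
  obtain ⟨rfl, h1, h2⟩ := h
  have h3 : u = v := sub_right_injective h1
  subst h3
  rw [sub_right_injective h2]

theorem measurePreserving_shear (i : Fin k ⊕ Fin k) :
    MeasurePreserving (shear (n := n) i) volume volume := by
  have h1 : ∀ c : Pt n, MeasurePreserving (fun q : Pt n × Pt n => (c - q.1, c - q.1 - q.2))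
      (volume.prod volume) (volume.prod volume) := by
    intro c
    refine (Measure.measurePreserving_sub_left volume c).skew_product
      (g := fun u u' => c - u - u') (by fun_prop) (Eventually.of_forall fun u => ?_)
    exact (Measure.measurePreserving_sub_left volume (c - u)).map_eq
  refine (MeasurePreserving.id (volume : Measure (Conf n k))).skew_product
    (g := fun (x : Conf n k) (q : Pt n × Pt n) => (x i - q.1, x i - q.1 - q.2)) (by fun_prop) (Eventually.of_forall fun x => ?_)
  exact (h1 (x i)).map_eq

/-- The pairing of the mollified collision operator with `F`, as a function on `Conf n (k + 1)`. -/
def collisionKernel (a : Pt n → ℝ) (i : Fin k ⊕ Fin k) (F : Conf n k → ℂ) (Z : Conf n (k + 1)) : ℂ :=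
  F (delConf (Fin.last k) Z) * ((a (Z (Sum.inl (Fin.last k)) - Z (Sum.inr (Fin.last k)))
    * a (delConf (Fin.last k) Z i - Z (Sum.inl (Fin.last k))) : ℝ) : ℂ)

theorem collisionKernel_insConf (a : Pt n → ℝ) (i : Fin k ⊕ Fin k) (F : Conf n k → ℂ)
    (p : Conf n k × (Pt n × Pt n)) : collisionKernel a i F (insConf (Fin.last k) p)
      = F p.1 * ((a (p.2.1 - p.2.2) * a (p.1 i - p.2.1) : ℝ) : ℂ) := by
  rw [collisionKernel, delConf_insConf, insConf_inl, insConf_inr]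

theorem collisionKernel_shear (a : Pt n → ℝ) (i : Fin k ⊕ Fin k) (F : Conf n k → ℂ)
    (p : Conf n k × (Pt n × Pt n)) : collisionKernel a i F (insConf (Fin.last k) (shear i p))
      = F p.1 * ((a p.2.1 : ℂ) * (a p.2.2 : ℂ)) := by
  rw [collisionKernel_insConf]
  simp only [shear, sub_sub_cancel, Complex.ofReal_mul]
  ring

theorem measurePreserving_insConf_shear (i : Fin k ⊕ Fin k) :
    MeasurePreserving (fun p => insConf (n := n) (Fin.last k) (shear i p)) volume volume :=
  (measurePreserving_insEquiv (n := n) (Fin.last k)).comp (measurePreserving_shear i)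

theorem measurableEmbedding_insConf_shear (i : Fin k ⊕ Fin k) :
    MeasurableEmbedding (fun p => insConf (n := n) (Fin.last k) (shear i p)) :=
  (insEquiv n (Fin.last k)).measurableEmbedding.comp
    ((continuous_shear i).measurableEmbedding (shear_injective i))

variable {a : Pt n → ℝ} {F : Conf n k → ℂ}

theorem continuous_collisionKernel (ha : Continuous a) (hF : Continuous F) (i : Fin k ⊕ Fin k) :
    Continuous (collisionKernel a i F) := by
  have h : Continuous (delConf (n := n) (Fin.last k)) :=
    (PiLp.continuous_toLp 2 _).comp (by fun_prop)
  unfold collisionKernel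
  fun_prop

theorem lintegral_enorm_collisionKernel_pow (m : ℕ) (ha : Measurable a) (hF : Measurable F)
    (i : Fin k ⊕ Fin k) : ∫⁻ Z, ‖collisionKernel a i F Z‖ₑ ^ m
      = (∫⁻ z, ‖F z‖ₑ ^ m) * ((∫⁻ u, ‖a u‖ₑ ^ m) * ∫⁻ u, ‖a u‖ₑ ^ m) := by
  rw [← (measurePreserving_insConf_shear i).lintegral_comp_emb (measurableEmbedding_insConf_shear i)]
  have e : ∀ p : Conf n k × (Pt n × Pt n),
      ‖collisionKernel a i F (insConf (Fin.last k) (shear i p))‖ₑ ^ m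
        = ‖F p.1‖ₑ ^ m * (‖a p.2.1‖ₑ ^ m * ‖a p.2.2‖ₑ ^ m) := by
    intro p
    have e2 : ∀ x : ℝ, ‖(x : ℂ)‖ₑ = ‖x‖ₑ := fun x => by
      rw [← ofReal_norm, ← ofReal_norm, Complex.norm_real]
    rw [collisionKernel_shear, enorm_mul, enorm_mul, mul_pow, mul_pow, e2, e2]
  simp_rw [e]
  rw [← lintegral_prod_mul (ha.enorm.pow_const m).aemeasurable (ha.enorm.pow_const m).aemeasurable]
  exact lintegral_prod_mul (hF.enorm.pow_const m).aemeasurable (((ha.comp measurable_fst).enorm.pow_const m).mul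
    ((ha.comp measurable_snd).enorm.pow_const m)).aemeasurable

theorem memLp_two_of_lintegral {V : Type*} [MeasurableSpace V] {ν : Measure V} {f : V → ℂ}
    (hf : AEStronglyMeasurable f ν) (h : ∫⁻ x, ‖f x‖ₑ ^ 2 ∂ν < ⊤) : MemLp f 2 ν := by
  refine ⟨hf, ?_⟩
  rw [← eLpNorm_two_sq] at h
  exact (ENNReal.pow_lt_top_iff.1 h).resolve_right two_ne_zero

theorem inner_insConf (q : Fin (k + 1)) (p : Conf n k × (Pt n × Pt n)) (Z : Conf n (k + 1)) :
    inner ℝ (insConf q p) Z = inner ℝ p.1 (delConf q Z) + inner ℝ p.2.1 (Z (Sum.inl q))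
      + inner ℝ p.2.2 (Z (Sum.inr q)) := by
  simp only [PiLp.inner_apply, Fintype.sum_sum_type, Fin.sum_univ_succAbove _ q, insConf_inl,
    insConf_inr, insConf_inl_succAbove, insConf_inr_succAbove, delConf_apply, Sum.map_inl, Sum.map_inr]
  ring

theorem inner_merge (i : Fin k ⊕ Fin k) (q : Fin (k + 1)) (x : Conf n k) (Z : Conf n (k + 1)) :
    inner ℝ x (merge i q Z)
      = inner ℝ x (delConf q Z) + inner ℝ (x i) (Z (Sum.inl q) + Z (Sum.inr q)) := by
  rw [merge, inner_add_right]
  congr 1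
  rw [PiLp.inner_apply, Finset.sum_eq_single i]
  · simp
  · intro j _ hj
    simp [hj]
  · simp

theorem inner_insConf_shear (i : Fin k ⊕ Fin k) (p : Conf n k × (Pt n × Pt n)) (Z : Conf n (k + 1)) :
    inner ℝ (insConf (Fin.last k) (shear i p)) Z = inner ℝ p.1 (merge i (Fin.last k) Z)
      + (-inner ℝ p.2.1 (Z (Sum.inl (Fin.last k)) + Z (Sum.inr (Fin.last k)))
        + -inner ℝ p.2.2 (Z (Sum.inr (Fin.last k)))) := by
  rw [inner_insConf, inner_merge]
  simp only [shear, inner_sub_left, inner_add_right]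
  ring

/-- In the coordinates of `shear` the kernel is a product, and the phase splits accordingly
(`inner_insConf_shear`): the frequency dual to the remaining particles is the merged one, and each
mollifier contributes its own Fourier transform. As the parameter of the mollifier tends to `0`
these factors tend to `1`. -/
theorem fourierInv_collisionKernel (i : Fin k ⊕ Fin k) (Z : Conf n (k + 1)) :
    𝓕⁻ (collisionKernel a i F) Z = 𝓕⁻ F (merge i (Fin.last k) Z)
      * (𝓕 (fun u => (a u : ℂ)) (Z (Sum.inl (Fin.last k)) + Z (Sum.inr (Fin.last k)))
        * 𝓕 (fun u => (a u : ℂ)) (Z (Sum.inr (Fin.last k)))) := by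
  rw [Real.fourierInv_eq', Real.fourierInv_eq', Real.fourier_eq', Real.fourier_eq',
    ← (measurePreserving_insConf_shear i).integral_comp (measurableEmbedding_insConf_shear i),
    ← integral_prod_mul, ← integral_prod_mul]
  refine integral_congr_ae (Eventually.of_forall fun p => ?_)
  simp only [smul_eq_mul]
  rw [collisionKernel_shear, inner_insConf_shear]
  rw [mul_mul_mul_comm (Complex.exp _) (a p.2.1 : ℂ), mul_mul_mul_comm (Complex.exp _) (F p.1),
    ← Complex.exp_add, ← Complex.exp_add]
  congr 2
  push_cast
  ring

/-- The multiplier by which mollification changes the collision operator. -/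
def mollFactor (h : Pt n → ℝ) (ε : ℝ) (Z : Conf n (k + 1)) : ℂ :=
  𝓕 (fun u => (h u : ℂ)) (ε • (Z (Sum.inl (Fin.last k)) + Z (Sum.inr (Fin.last k))))
    * 𝓕 (fun u => (h u : ℂ)) (ε • Z (Sum.inr (Fin.last k)))

theorem fourier_rescale (h : Pt n → ℝ) {ε : ℝ} (hε : 0 < ε) (η : Pt n) :
    𝓕 (fun u => (rescale h ε u : ℂ)) η = 𝓕 (fun u => (h u : ℂ)) (ε • η) := by
  rw [Real.fourier_eq', Real.fourier_eq']
  have e := Measure.integral_comp_inv_smul_of_nonneg (volume : Measure (Pt n))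
    (fun u : Pt n => (((ε ^ n)⁻¹ : ℝ) : ℂ) * (Complex.exp (((-2 * Real.pi * inner ℝ u (ε • η) : ℝ) : ℂ)
      * Complex.I) • (h u : ℂ))) hε.le
  rw [finrank_euclideanSpace_fin, integral_const_mul (L := ℂ) (μ := (volume : Measure (Pt n)))
    (((ε ^ n)⁻¹ : ℝ) : ℂ) (fun u : Pt n => Complex.exp (((-2 * Real.pi * inner ℝ u (ε • η) : ℝ) : ℂ)
      * Complex.I) • (h u : ℂ))] at e
  have hn : ε ^ n ≠ 0 := (pow_pos hε n).ne'
  have e2 : ∀ w : ℂ, ε ^ n • ((((ε ^ n)⁻¹ : ℝ) : ℂ) * w) = w := by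
    intro w
    rw [Complex.real_smul, ← mul_assoc, ← Complex.ofReal_mul, mul_inv_cancel₀ hn, Complex.ofReal_one,
      one_mul]
  rw [e2] at e
  rw [← e]
  refine integral_congr_ae (Eventually.of_forall fun u => ?_)
  simp only [smul_eq_mul]
  rw [real_inner_smul_left, real_inner_smul_right, inv_mul_cancel_left₀ hε.ne', rescale]
  push_cast
  ring

theorem norm_mollFactor_le (h : Pt n → ℝ) (ε : ℝ) (Z : Conf n (k + 1)) :
    ‖mollFactor h ε Z‖ ≤ (((∫ u, ‖h u‖) * ∫ u, ‖h u‖).toNNReal : ℝ≥0) := by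
  rw [Real.coe_toNNReal _ (by positivity), mollFactor, norm_mul]
  have e : ∀ η, ‖𝓕 (fun u => (h u : ℂ)) η‖ ≤ ∫ u, ‖h u‖ := by
    intro η
    have := VectorFourier.norm_fourierIntegral_le_integral_norm Real.fourierChar volume (innerₗ (Pt n))
      (fun u => (h u : ℂ)) η
    simp only [Complex.norm_real] at this
    exact this
  exact mul_le_mul (e _) (e _) (norm_nonneg _) (integral_nonneg fun _ => norm_nonneg _)

theorem fourierInv_collisionKernel_rescale (h : Pt n → ℝ) {ε : ℝ} (hε : 0 < ε) (i : Fin k ⊕ Fin k)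
    (Z : Conf n (k + 1)) : 𝓕⁻ (collisionKernel (rescale h ε) i F) Z
      = 𝓕⁻ F (merge i (Fin.last k) Z) * mollFactor h ε Z := by
  rw [fourierInv_collisionKernel, fourier_rescale h hε, fourier_rescale h hε]
  rfl

section

variable {h : Pt n → ℝ} (hh : IsMollifier h)

include hh

theorem IsMollifier.integrable : Integrable h :=
  hh.smooth.continuous.integrable_of_hasCompactSupport hh.compact

theorem IsMollifier.continuous_fourier : Continuous (𝓕 (fun u => (h u : ℂ))) :=
  VectorFourier.fourierIntegral_continuous Real.continuous_fourierChar
    (by exact continuous_fst.inner continuous_snd) hh.integrable.ofReal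

theorem continuous_mollFactor (ε : ℝ) : Continuous (mollFactor (k := k) h ε) := by
  have := hh.continuous_fourier
  unfold mollFactor
  fun_prop

theorem tendsto_mollFactor (Z : Conf n (k + 1)) :
    Tendsto (fun ε => mollFactor h ε Z) (𝓝 0) (𝓝 1) := by
  have h1 : 𝓕 (fun u => (h u : ℂ)) (0 : Pt n) = 1 := by
    rw [Real.fourier_eq']
    simp only [inner_zero_right, mul_zero, Complex.ofReal_zero, zero_mul, Complex.exp_zero, one_smul]
    rw [integral_complex_ofReal, hh.integral, Complex.ofReal_one]
  have h2 : Continuous fun ε => mollFactor h ε Z := by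
    have := hh.continuous_fourier
    unfold mollFactor
    fun_prop
  have h3 := h2.tendsto 0
  rwa [mollFactor, zero_smul, zero_smul, h1, one_mul] at h3

theorem IsMollifier.continuous_rescale (ε : ℝ) : Continuous (rescale h ε) := by
  have := hh.smooth.continuous
  unfold rescale
  fun_prop

theorem IsMollifier.hasCompactSupport_rescale {ε : ℝ} (hε : 0 < ε) :
    HasCompactSupport (rescale h ε) :=
  (hh.compact.comp_homeomorph (Homeomorph.smulOfNeZero ε⁻¹ (inv_ne_zero hε.ne'))).mul_left


end

theorem lintegral_enorm_pow_lt_top {V E : Type*} [TopologicalSpace V] [MeasurableSpace V]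
    [OpensMeasurableSpace V] [NormedAddCommGroup E] {ν : Measure V} [IsFiniteMeasureOnCompacts ν]
    {f : V → E} (hf : Continuous f) (hs : HasCompactSupport f) {m : ℕ} (hm : m ≠ 0) :
    ∫⁻ x, ‖f x‖ₑ ^ m ∂ν < ⊤ := by
  have h1 : Continuous fun x => ‖f x‖ ^ m := by fun_prop
  have h2 : HasCompactSupport fun x => ‖f x‖ ^ m :=
    hs.comp_left (g := fun v => ‖v‖ ^ m) (by simp [hm])
  have h3 := (h1.integrable_of_hasCompactSupport (μ := ν) h2).2
  rw [HasFiniteIntegral] at h3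
  refine (lintegral_congr fun x => ?_).trans_lt h3
  rw [enorm_pow, enorm_norm]

theorem memLp_collisionKernel (ha : Continuous a) (has : HasCompactSupport a) (hF : Continuous F)
    (hFs : HasCompactSupport F) (i : Fin k ⊕ Fin k) : MemLp (collisionKernel a i F) 2 volume := by
  refine memLp_two_of_lintegral (continuous_collisionKernel ha hF i).aestronglyMeasurable ?_
  rw [lintegral_enorm_collisionKernel_pow 2 ha.measurable hF.measurable]
  have e := lintegral_enorm_pow_lt_top (ν := volume) ha has two_ne_zero
  exact ENNReal.mul_lt_top (lintegral_enorm_pow_lt_top hF hFs two_ne_zero) (ENNReal.mul_lt_top e e)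

theorem integral_mul_collision (ha : Continuous a) (has : HasCompactSupport a) (hF : Continuous F)
    (hFs : HasCompactSupport F) (i : Fin k ⊕ Fin k) (f : L2 n (k + 1)) :
    Integrable (fun z => F z * ∫ p : Pt n × Pt n, ((a (p.1 - p.2) * a (z i - p.1) : ℝ) : ℂ)
      * f (extend z p.1 p.2)) ∧
    ∫ z, F z * ∫ p : Pt n × Pt n, ((a (p.1 - p.2) * a (z i - p.1) : ℝ) : ℂ)
      * f (extend z p.1 p.2) = ∫ Z, collisionKernel a i F Z * f Z := by
  have h1 : Integrable (fun Z => collisionKernel a i F Z * f Z) :=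
    (memLp_collisionKernel ha has hF hFs i).integrable_mul (Lp.memLp f)
  have h2 := ((measurePreserving_insEquiv (n := n) (Fin.last k)).integrable_comp_emb
    (insEquiv n (Fin.last k)).measurableEmbedding).2 h1
  have e : ∀ z, ∫ p : Pt n × Pt n, collisionKernel a i F (insConf (Fin.last k) (z, p))
      * f (insConf (Fin.last k) (z, p)) = F z * ∫ p : Pt n × Pt n,
        ((a (p.1 - p.2) * a (z i - p.1) : ℝ) : ℂ) * f (extend z p.1 p.2) := by
    intro z
    rw [← integral_const_mul]
    refine integral_congr_ae (Eventually.of_forall fun p => ?_)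
    simp only
    rw [collisionKernel_insConf, extend_eq_insConf, mul_assoc]
  refine ⟨?_, ?_⟩
  · have h3 := h2.integral_prod_left
    refine h3.congr (Eventually.of_forall fun z => ?_)
    exact e z
  · rw [← (measurePreserving_insEquiv (n := n) (Fin.last k)).integral_comp
      (insEquiv n (Fin.last k)).measurableEmbedding]
    refine Eq.trans ?_ (integral_prod _ h2).symm
    refine integral_congr_ae (Eventually.of_forall fun z => ?_)
    exact (e z).symm

theorem integral_mul_mollifiedB {h : Pt n → ℝ} (hh : IsMollifier h) {ε : ℝ} (hε : 0 < ε)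
    (hF : Continuous F) (hFs : HasCompactSupport F) (f : L2 n (k + 1)) :
    ∫ z, F z * mollifiedB h ε f z = ∑ i : Fin k ⊕ Fin k, (sgn i : ℂ)
      * ∫ Z, collisionKernel (rescale h ε) i F Z * f Z := by
  have h1 := fun i => integral_mul_collision (hh.continuous_rescale ε)
    (hh.hasCompactSupport_rescale hε) hF hFs i f
  have h3 : ∀ z, F z * mollifiedB h ε f z
      = ∑ i : Fin k ⊕ Fin k, (sgn i : ℂ) * (F z * ∫ p : Pt n × Pt n, ((rescale h ε (p.1 - p.2)
        * rescale h ε (z i - p.1) : ℝ) : ℂ) * f (extend z p.1 p.2)) := by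
    intro z
    rw [mollifiedB, Fintype.sum_sum_type, Finset.sum_sub_distrib, mul_sub, Finset.mul_sum,
      Finset.mul_sum, sub_eq_add_neg, ← Finset.sum_neg_distrib]
    simp [sgn]
  simp_rw [h3]
  rw [integral_finsetSum _ fun i _ => (h1 i).1.const_mul _]
  refine Finset.sum_congr rfl fun i _ => ?_
  rw [integral_const_mul, (h1 i).2]

end

end

end GPHierarchy

namespace GPHierarchy

noncomputable section

/-! ### Test functions in the interaction picture -/

section

variable {n k : ℕ} {α : ℝ} (H : Adm n α)

/-- Functions on `ℝ × Conf n k` whose slices are bounded in `L¹` and in `L²`. -/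
structure Admissible (Φ : ℝ × Conf n k → ℂ) : Prop where
  measurable : Measurable Φ
  bound : ∀ m : ℕ, m ≠ 0 → ∃ M : ℝ≥0, ∀ t, ∫⁻ z, ‖Φ (t, z)‖ₑ ^ m ≤ M

theorem Admissible.integrable {Φ : ℝ × Conf n k → ℂ} (hΦ : Admissible Φ) (t : ℝ) :
    Integrable fun z => Φ (t, z) := by
  obtain ⟨M, hM⟩ := hΦ.bound 1 one_ne_zero
  refine ⟨(hΦ.measurable.comp measurable_prodMk_left).aestronglyMeasurable, ?_⟩
  rw [HasFiniteIntegral]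
  have := hM t
  simp only [pow_one] at this
  exact this.trans_lt ENNReal.coe_lt_top

theorem Admissible.memLp {Φ : ℝ × Conf n k → ℂ} (hΦ : Admissible Φ) (t : ℝ) :
    MemLp (fun z => Φ (t, z)) 2 volume := by
  obtain ⟨M, hM⟩ := hΦ.bound 2 two_ne_zero
  exact memLp_two_of_lintegral (hΦ.measurable.comp measurable_prodMk_left).aestronglyMeasurable
    ((hM t).trans_lt ENNReal.coe_lt_top)

theorem admissible_of_continuous {Φ : ℝ × Conf n k → ℂ} (hc : Continuous Φ)
    (hs : HasCompactSupport Φ) : Admissible Φ := by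
  refine ⟨hc.measurable, fun m hm => ?_⟩
  obtain ⟨C, hC⟩ := hs.exists_bound_of_continuous hc
  obtain ⟨L, hL⟩ : ∃ L : Set (Conf n k), L = Prod.snd '' tsupport Φ := ⟨_, rfl⟩
  have hLc : IsCompact L := by
    rw [hL]
    exact hs.isCompact.image continuous_snd
  have hfin : ENNReal.ofReal C ^ m * volume L < ⊤ :=
    ENNReal.mul_lt_top (by finiteness) hLc.measure_lt_top
  refine ⟨(ENNReal.ofReal C ^ m * volume L).toNNReal, fun t => ?_⟩
  rw [ENNReal.coe_toNNReal hfin.ne]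
  refine (lintegral_mono fun z => ?_).trans_eq (lintegral_indicator_const hLc.measurableSet _)
  by_cases hz : z ∈ L
  · rw [indicator_of_mem hz, ← ofReal_norm]
    exact pow_le_pow_left₀ zero_le (ENNReal.ofReal_le_ofReal (hC _)) m
  · have h0 : Φ (t, z) = 0 := by
      refine image_eq_zero_of_notMem_tsupport fun h => hz ?_
      rw [hL]
      exact ⟨_, h, rfl⟩
    rw [indicator_of_notMem hz, h0, enorm_zero, zero_pow hm]

theorem measurable_fourierInv_slice {Φ : ℝ × Conf n k → ℂ} (hΦ : Measurable Φ) :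
    Measurable fun p : ℝ × Conf n k => 𝓕⁻ (fun z => Φ (p.1, z)) p.2 := by
  simp_rw [Real.fourierInv_eq', smul_eq_mul]
  have h : Measurable fun w : (ℝ × Conf n k) × Conf n k =>
      Complex.exp (((2 * Real.pi * inner ℝ w.2 w.1.2 : ℝ) : ℂ) * Complex.I) * Φ (w.1.1, w.2) := by
    refine Measurable.mul ?_ (hΦ.comp (measurable_fst.fst.prodMk measurable_snd))
    have : Continuous fun w : (ℝ × Conf n k) × Conf n k =>
      Complex.exp (((2 * Real.pi * inner ℝ w.2 w.1.2 : ℝ) : ℂ) * Complex.I) := by fun_prop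
    exact this.measurable
  exact h.stronglyMeasurable.integral_prod_right.measurable

theorem measurable_intMult_uncurry (α : ℝ) :
    Measurable fun p : ℝ × Conf n k => intMult α p.1 p.2 := by
  have h1 : Continuous fun p : ℝ × Conf n k => freePhase p.1 p.2 := by
    unfold freePhase
    fun_prop
  exact h1.measurable.mul (Complex.measurable_ofReal.comp
    ((continuous_sobolevWeight α).measurable.comp measurable_snd).inv)

/-- The test function which pairs with the interaction picture as `Φ` pairs with the functions that
are represented. -/
def fourierTest {Φ : ℝ × Conf n k → ℂ} (hΦ : Admissible Φ) : TestOn ℝ n k :=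
  ⟨fun t ξ => (starRingEnd ℂ) (𝓕⁻ (fun z => Φ (t, z)) ξ * intMult α t ξ), by
    have hle : ∀ t ξ, ‖(starRingEnd ℂ) (𝓕⁻ (fun z => Φ (t, z)) ξ * intMult α t ξ)‖
        ≤ ‖𝓕⁻ (fun z => Φ (t, z)) ξ‖ := by
      intro t ξ
      rw [RCLike.norm_conj, norm_mul]
      exact mul_le_of_le_one_right (norm_nonneg _) (norm_intMult_le H t ξ)
    refine ⟨?_, ?_, ?_⟩
    · exact Complex.continuous_conj.measurable.comp
        ((measurable_fourierInv_slice hΦ.measurable).mul (measurable_intMult_uncurry α))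
    · obtain ⟨M, hM⟩ := hΦ.bound 1 one_ne_zero
      refine ⟨M, fun t ξ => (hle t ξ).trans ((norm_fourierInv_le _ ξ).trans ?_)⟩
      rw [integral_norm_eq_lintegral_enorm (hΦ.integrable t).aestronglyMeasurable]
      refine ENNReal.toReal_le_of_le_ofReal M.2 ?_
      have := hM t
      simp only [pow_one] at this
      exact this.trans_eq (by simp)
    · obtain ⟨M, hM⟩ := hΦ.bound 2 two_ne_zero
      refine ⟨NNReal.sqrt M, fun t => ?_⟩
      refine (eLpNorm_mono fun ξ => hle t ξ).trans ?_
      rw [← ENNReal.pow_le_pow_left_iff two_ne_zero, eLpNorm_two_sq,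
        lintegral_enorm_fourierInv_sq (hΦ.integrable t) (hΦ.memLp t), ← ENNReal.coe_pow, NNReal.sq_sqrt]
      exact hM t⟩

theorem fourierTest_apply {Φ : ℝ × Conf n k → ℂ} (hΦ : Admissible Φ) (t : ℝ) (ξ : Conf n k) :
    (fourierTest H hΦ).1 t ξ
      = (starRingEnd ℂ) (𝓕⁻ (fun z => Φ (t, z)) ξ * intMult α t ξ) := rfl

theorem inner_fourierTest {Φ : ℝ × Conf n k → ℂ} (hΦ : Admissible Φ) (t : ℝ) (g : L2 n k) :
    inner ℂ g (slice t (fourierTest H hΦ))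
      = (starRingEnd ℂ) (∫ z, Φ (t, z) * fromInt H k t g z) := by
  rw [inner_slice, fromInt_apply, integral_mul_invFT (hΦ.integrable t) (hΦ.memLp t), ← integral_conj]
  refine integral_congr_ae ?_
  filter_upwards [coeFn_mulL2 (measurable_intMult α t) (norm_intMult_le H t) g] with z hz
  rw [hz, fourierTest_apply]
  simp only [map_mul]
  ring

section

variable {h : Pt n → ℝ} (hh : IsMollifier h)

include hh

theorem admissible_collisionKernel {ε : ℝ} (hε : 0 < ε) {Φ : ℝ × Conf n k → ℂ} (hΦ : Admissible Φ)
    (i : Fin k ⊕ Fin k) :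
    Admissible fun p : ℝ × Conf n (k + 1) =>
      collisionKernel (rescale h ε) i (fun z => Φ (p.1, z)) p.2 := by
  have hc := hh.continuous_rescale ε
  refine ⟨?_, fun m hm => ?_⟩
  · have h1 : Measurable (delConf (n := n) (Fin.last k)) :=
      ((PiLp.continuous_toLp 2 _).comp (by fun_prop)).measurable
    unfold collisionKernel
    refine (hΦ.measurable.comp (measurable_fst.prodMk (h1.comp measurable_snd))).mul ?_
    have h2 : Continuous fun Z : Conf n (k + 1) =>
        (((rescale h ε (Z (Sum.inl (Fin.last k)) - Z (Sum.inr (Fin.last k)))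
          * rescale h ε (delConf (Fin.last k) Z i - Z (Sum.inl (Fin.last k))) : ℝ)) : ℂ) := by
      have : Continuous (delConf (n := n) (Fin.last k)) :=
        (PiLp.continuous_toLp 2 _).comp (by fun_prop)
      fun_prop
    exact h2.measurable.comp measurable_snd
  · obtain ⟨M, hM⟩ := hΦ.bound m hm
    have h1 : ∫⁻ u, ‖rescale h ε u‖ₑ ^ m < ⊤ :=
      lintegral_enorm_pow_lt_top hc (hh.hasCompactSupport_rescale hε) hm
    refine ⟨M * ((∫⁻ u, ‖rescale h ε u‖ₑ ^ m).toNNReal * (∫⁻ u, ‖rescale h ε u‖ₑ ^ m).toNNReal),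
      fun t => ?_⟩
    have e := lintegral_enorm_collisionKernel_pow (F := fun z => Φ (t, z)) m hc.measurable
      (hΦ.measurable.comp measurable_prodMk_left) i
    refine e.trans_le ?_
    push_cast
    rw [ENNReal.coe_toNNReal h1.ne]
    exact mul_le_mul_left (hM t) _

theorem integral_mul_mollifiedB_fromInt {ε : ℝ} (hε : 0 < ε) {Φ : ℝ × Conf n k → ℂ}
    (hc : Continuous Φ) (hs : HasCompactSupport Φ) (t : ℝ) (g : L2 n (k + 1)) :
    ∫ z, Φ (t, z) * mollifiedB h ε (fromInt H (k + 1) t g) z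
      = ∑ i : Fin k ⊕ Fin k, (sgn i : ℂ) * (starRingEnd ℂ) (inner ℂ g (slice t (fourierTest H
        (admissible_collisionKernel hh hε (admissible_of_continuous hc hs) i)))) := by
  have h1 : Continuous fun z => Φ (t, z) := by fun_prop
  have h2 : HasCompactSupport fun z => Φ (t, z) := by
    refine HasCompactSupport.intro (hs.isCompact.image continuous_snd) fun z hz => ?_
    exact image_eq_zero_of_notMem_tsupport fun h' => hz ⟨_, h', rfl⟩
  rw [integral_mul_mollifiedB hh hε h1 h2]
  refine Finset.sum_congr rfl fun i _ => ?_
  rw [inner_fourierTest, Complex.conj_conj]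

end

/-- This is the origin of `kern` and `phase`: they are what remains when the multiplier for `k + 1`
particles is compared with the one for `k` particles at the merged frequency. -/
theorem conj_intMult (t : ℝ) (i : Fin k ⊕ Fin k) (q : Fin (k + 1)) (Z : Conf n (k + 1)) :
    (starRingEnd ℂ) (intMult α t Z) = (kern α i q Z : ℂ)
      * (Complex.exp ((t * phase i q Z : ℝ) * Complex.I)
        * (starRingEnd ℂ) (intMult α t (merge i q Z))) := by
  have h1 := (sobolevWeight_pos α (merge i q Z)).ne'
  have h2 := (sobolevWeight_pos α Z).ne'
  simp only [intMult, map_mul, conj_freePhase, Complex.conj_ofReal, kern, phase]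
  rw [freePhase_eq, freePhase_eq]
  have e : Complex.exp (((-(-t * energy Z) : ℝ) : ℂ) * Complex.I)
      = Complex.exp (((t * (energy Z - energy (merge i q Z)) : ℝ) : ℂ) * Complex.I)
        * Complex.exp (((-(-t * energy (merge i q Z)) : ℝ) : ℂ) * Complex.I) := by
    rw [← Complex.exp_add]
    congr 1
    push_cast
    ring
  rw [e]
  have e2 : (((sobolevWeight α Z)⁻¹ : ℝ) : ℂ)
      = ((sobolevWeight α (merge i q Z) / sobolevWeight α Z : ℝ) : ℂ)
        * (((sobolevWeight α (merge i q Z))⁻¹ : ℝ) : ℂ) := by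
    rw [← Complex.ofReal_mul]
    congr 1
    field_simp
  rw [e2]
  ring

/-- The mollified collision, seen by a test function, is the exact collision step times a multiplier
that does not depend on time. Passing to the limit in `ε` thus becomes dominated convergence for a
bounded multiplier. -/
theorem integral_later_fourierTest (T : ℝ) {h : Pt n → ℝ} (hh : IsMollifier h) {ε : ℝ} (hε : 0 < ε)
    {Φ : ℝ × Conf n k → ℂ} (hΦ : Admissible Φ) (i : Fin k ⊕ Fin k) (s : ℝ) (Z : Conf n (k + 1)) :
    ∫ t, (later (fourierTest H (admissible_collisionKernel hh hε hΦ i))).1 (t, s) Z ∂tm T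
      = (starRingEnd ℂ) (mollFactor h ε Z)
        * (step H T i (Fin.last k) (later (fourierTest H hΦ))).1 s Z := by
  rw [step_apply, stepFun, ← integral_const_mul, ← integral_const_mul]
  refine integral_congr_ae (Eventually.of_forall fun t => ?_)
  simp only [later_apply, fourierTest_apply]
  rw [fourierInv_collisionKernel_rescale h hε, map_mul, map_mul, map_mul, conj_intMult t i (Fin.last k)]
  ring

theorem integral_inner_slice {X : Type} [MeasurableSpace X] {ν : Measure X} [IsFiniteMeasure ν]
    (f : L2 n k) (χ : TestOn X n k) :
    ∫ t, inner ℂ f (slice t χ) ∂ν = ∫ z, (starRingEnd ℂ) (f z) * ∫ t, χ.1 t z ∂ν := by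
  simp_rw [inner_slice, ← integral_const_mul]
  rw [integral_integral_swap]
  obtain ⟨M, hM⟩ := TestOn.bounded_L2 χ
  have hm : MemLp (fun p : X × Conf n k => χ.1 p.1 p.2) 2 (ν.prod volume) := by
    refine memLp_two_of_lintegral (TestOn.measurable χ).aestronglyMeasurable ?_
    have hm2 : Measurable fun p : X × Conf n k => ‖χ.1 p.1 p.2‖ₑ ^ 2 :=
      (TestOn.measurable χ).enorm.pow_const 2
    rw [lintegral_prod _ hm2.aemeasurable]
    refine (lintegral_mono (g := fun _ => (M : ℝ≥0∞) ^ 2) fun x => ?_).trans_lt ?_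
    · rw [← eLpNorm_two_sq]
      exact pow_le_pow_left₀ zero_le (hM x) 2
    · rw [lintegral_const]
      exact ENNReal.mul_lt_top (by finiteness) (measure_lt_top _ _)
  have hf : MemLp (fun p : X × Conf n k => (starRingEnd ℂ) (f p.2)) 2 (ν.prod volume) :=
    ((Lp.memLp f).star).comp_snd ν
  exact hf.integrable_mul hm

end

end

end GPHierarchy

namespace GPHierarchy

noncomputable section

/-! ### Convergence of the mollified collision terms -/

section

variable {n k : ℕ} {α : ℝ} (H : Adm n α) (T : ℝ)

theorem inner_slice_later (f : L2 n k) (χ : TestOn ℝ n k) (t s : ℝ) :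
    inner ℂ f (slice (t, s) (later χ)) = (if s < t then 1 else 0) * inner ℂ f (slice t χ) := by
  rw [inner_slice, inner_slice, ← integral_const_mul]
  refine integral_congr_ae (Eventually.of_forall fun z => ?_)
  simp only [later_apply]
  ring

/-- The mollified collision term of a test function. -/
def mollStep (h : Pt n → ℝ) (ε : ℝ) (hh : IsMollifier h) (i : Fin k ⊕ Fin k) (ψ : TestOn ℝ n k)
    (s : ℝ) : L2 n (k + 1) :=
  mulL2 (fun Z => (starRingEnd ℂ) (mollFactor h ε Z))
    (Complex.continuous_conj.comp (continuous_mollFactor hh ε)).measurable _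
    (fun Z => (RCLike.norm_conj _).trans_le (norm_mollFactor_le h ε Z))
    (slice s (step H T i (Fin.last k) (later ψ)))

variable {T} {h : Pt n → ℝ} (hh : IsMollifier h)

include hh

theorem coeFn_mollStep (ε : ℝ) (i : Fin k ⊕ Fin k) (ψ : TestOn ℝ n k) (s : ℝ) :
    mollStep H T h ε hh i ψ s =ᵐ[volume] fun Z => (starRingEnd ℂ) (mollFactor h ε Z)
      * (step H T i (Fin.last k) (later ψ)).1 s Z := by
  have h1 : mollStep H T h ε hh i ψ s =ᵐ[volume] fun Z => (starRingEnd ℂ) (mollFactor h ε Z)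
      * slice s (step H T i (Fin.last k) (later ψ)) Z := coeFn_mulL2 _ _ _
  filter_upwards [h1, coeFn_slice s (step H T i (Fin.last k) (later ψ))] with Z e1 e2
  rw [e1, e2]

theorem integral_inner_later {ε : ℝ} (hε : 0 < ε) {Φ : ℝ × Conf n k → ℂ} (hΦ : Admissible Φ)
    (i : Fin k ⊕ Fin k) (s : ℝ) (f : L2 n (k + 1)) :
    ∫ t, inner ℂ f (slice (t, s) (later (fourierTest H (admissible_collisionKernel hh hε hΦ i))))
      ∂tm T = inner ℂ f (mollStep H T h ε hh i (fourierTest H hΦ) s) := by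
  have h1 := integral_inner_slice (ν := tm T) f (pull (fun t : ℝ => (t, s)) measurable_prodMk_right
    (later (fourierTest H (admissible_collisionKernel hh hε hΦ i))))
  refine h1.trans ?_
  rw [L2.inner_def]
  refine integral_congr_ae ?_
  filter_upwards [coeFn_mollStep H hh ε i (fourierTest H hΦ) s] with Z e1
  rw [e1, RCLike.inner_apply, ← integral_later_fourierTest H T hh hε hΦ i s Z, mul_comm]
  rfl

theorem tendsto_mollStep (i : Fin k ⊕ Fin k) (ψ : TestOn ℝ n k) (s : ℝ) :
    Tendsto (fun ε => mollStep H T h ε hh i ψ s) (𝓝[>] 0)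
      (𝓝 (slice s (step H T i (Fin.last k) (later ψ)))) := by
  refine tendsto_mulL2 _ _ (fun Z => ?_) _
  have := (Complex.continuous_conj.tendsto _).comp (tendsto_mollFactor hh Z)
  rw [map_one] at this
  exact this.mono_left nhdsWithin_le_nhds

theorem norm_mollStep_le (ε : ℝ) (i : Fin k ⊕ Fin k) (ψ : TestOn ℝ n k) (s : ℝ) :
    ‖mollStep H T h ε hh i ψ s‖ ≤ (((∫ u, ‖h u‖) * ∫ u, ‖h u‖).toNNReal : ℝ≥0)
      * ‖slice s (step H T i (Fin.last k) (later ψ))‖ :=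
  norm_mulL2_le _ _ _

theorem stronglyMeasurable_mollStep (ε : ℝ) (i : Fin k ⊕ Fin k) (ψ : TestOn ℝ n k) :
    StronglyMeasurable (mollStep H T h ε hh i ψ) :=
  (ContinuousLinearMap.continuous _).comp_stronglyMeasurable (stronglyMeasurable_slice _)

theorem tendsto_integral_mollStep (i : Fin k ⊕ Fin k) (ψ : TestOn ℝ n k) {r : ℝ → L2 n (k + 1)}
    (hr : Integrable r (tm T)) :
    Tendsto (fun ε => ∫ s, inner ℂ (r s) (mollStep H T h ε hh i ψ s) ∂tm T) (𝓝[>] 0)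
      (𝓝 (∫ s, inner ℂ (r s) (slice s (step H T i (Fin.last k) (later ψ))) ∂tm T)) := by
  obtain ⟨M, hM⟩ := exists_norm_slice_le (step H T i (Fin.last k) (later ψ))
  refine tendsto_integral_filter_of_dominated_convergence
    (fun s => ‖r s‖ * ((((∫ u, ‖h u‖) * ∫ u, ‖h u‖).toNNReal : ℝ≥0) * M)) ?_ ?_ ?_ ?_
  · exact Eventually.of_forall fun ε => hr.aestronglyMeasurable.inner
      (stronglyMeasurable_mollStep H hh ε i ψ).aestronglyMeasurable
  · refine Eventually.of_forall fun ε => Eventually.of_forall fun s => ?_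
    refine (norm_inner_le_norm _ _).trans (mul_le_mul_of_nonneg_left ?_ (norm_nonneg _))
    exact (norm_mollStep_le H hh ε i ψ s).trans (mul_le_mul_of_nonneg_left (hM s) (NNReal.coe_nonneg _))
  · exact hr.norm.mul_const _
  · refine Eventually.of_forall fun s => ?_
    exact tendsto_const_nhds.inner (tendsto_mollStep H hh i ψ s)

omit hh

theorem intervalIntegral_eq_tm {E : Type*} [NormedAddCommGroup E] [NormedSpace ℝ E] (r : ℝ → E)
    {t : ℝ} (ht : t ∈ Icc 0 T) : ∫ s in (0 : ℝ)..t, r s = ∫ s, (Iio t).indicator r s ∂tm T := by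
  rw [intervalIntegral.integral_of_le ht.1, integral_Ioc_eq_integral_Ioo,
    integral_indicator measurableSet_Iio, tm, Measure.restrict_restrict measurableSet_Iio,
    ← integral_Ico_eq_integral_Ioo]
  congr 2
  ext s
  simp only [mem_Ico, mem_inter_iff, mem_Iio, mem_Icc]
  exact ⟨fun hs => ⟨hs.2, hs.1, hs.2.le.trans ht.2⟩, fun hs => ⟨hs.2.1, hs.1⟩⟩

/-- The upper limit `t` of the Duhamel integral becomes the cut-off `s < t` contained in `later`. -/
theorem inner_add_integral {r : ℝ → L2 n k} (hr : Integrable r (tm T)) (g : L2 n k)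
    (χ : TestOn ℝ n k) {t : ℝ} (ht : t ∈ Icc 0 T) :
    inner ℂ (g + ∫ s in (0 : ℝ)..t, r s) (slice t χ)
      = inner ℂ g (slice t χ) + ∫ s, inner ℂ (r s) (slice (t, s) (later χ)) ∂tm T := by
  rw [inner_add_left, intervalIntegral_eq_tm r ht]
  congr 1
  rw [← inner_conj_symm, ← integral_inner (hr.indicator measurableSet_Iio), ← integral_conj]
  refine integral_congr_ae (Eventually.of_forall fun s => ?_)
  simp only
  rw [inner_conj_symm, inner_slice_later]
  by_cases hs : s < t
  · rw [indicator_of_mem (show s ∈ Iio t from hs), if_pos hs, one_mul]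
  · rw [indicator_of_notMem (show s ∉ Iio t from hs), if_neg hs, zero_mul, inner_zero_left]

theorem integrable_inner_later {r : ℝ → L2 n k} (hr : Integrable r (tm T)) (χ : TestOn ℝ n k) :
    Integrable (fun p : ℝ × ℝ => inner ℂ (r p.2) (slice p (later χ))) ((tm T).prod (tm T)) := by
  obtain ⟨M, hM⟩ := exists_norm_slice_le (later χ)
  have h1 : Integrable (fun p : ℝ × ℝ => r p.2) ((tm T).prod (tm T)) := hr.comp_snd _
  refine (h1.norm.mul_const M).mono' (h1.aestronglyMeasurable.inner
    (stronglyMeasurable_slice _).aestronglyMeasurable) (Eventually.of_forall fun p => ?_)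
  exact (norm_inner_le_norm _ _).trans (mul_le_mul_of_nonneg_left (hM p) (norm_nonneg _))

/-- The initial data sit at `s = 0`, where the strict cut-off of `later` equals `1` only for `t >
0`; the exceptional time is a null set. -/
theorem ae_tm_pos (T : ℝ) : ∀ᵐ t ∂tm T, 0 < t ∧ t ∈ Icc 0 T := by
  have h1 : ∀ᵐ t : ℝ ∂tm T, t ≠ 0 := by
    refine ae_restrict_of_ae ?_
    exact compl_mem_ae_iff.2 (measure_singleton 0)
  filter_upwards [h1, ae_restrict_mem measurableSet_Icc] with t ht ht'
  exact ⟨lt_of_le_of_ne ht'.1 (Ne.symm ht), ht'⟩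

include hh

/-- The integral over `t` is carried out first, which is the time integration inside the collision
step. For the Duhamel part this is Fubini on the square of times. -/
theorem integral_inner_fourierTest_collisionKernel {ε : ℝ} (hε : 0 < ε) {Φ : ℝ × Conf n k → ℂ}
    (hΦ : Admissible Φ) (i : Fin k ⊕ Fin k) {r : ℝ → L2 n (k + 1)} (hr : Integrable r (tm T))
    (g : L2 n (k + 1)) :
    Integrable (fun t => inner ℂ (g + ∫ s in (0 : ℝ)..t, r s)
      (slice t (fourierTest H (admissible_collisionKernel hh hε hΦ i)))) (tm T) ∧
    ∫ t, inner ℂ (g + ∫ s in (0 : ℝ)..t, r s)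
      (slice t (fourierTest H (admissible_collisionKernel hh hε hΦ i))) ∂tm T
      = inner ℂ g (mollStep H T h ε hh i (fourierTest H hΦ) 0)
        + ∫ s, inner ℂ (r s) (mollStep H T h ε hh i (fourierTest H hΦ) s) ∂tm T := by
  obtain ⟨χ, hχ⟩ : ∃ χ, χ = fourierTest H (admissible_collisionKernel hh hε hΦ i) := ⟨_, rfl⟩
  have e1 : (fun t => inner ℂ (g + ∫ s in (0 : ℝ)..t, r s) (slice t χ)) =ᵐ[tm T]
      fun t => inner ℂ g (slice t χ) + ∫ s, inner ℂ (r s) (slice (t, s) (later χ)) ∂tm T := by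
    filter_upwards [ae_tm_pos T] with t ht
    exact inner_add_integral hr g χ ht.2
  have i1 : Integrable (fun t => inner ℂ g (slice t χ)) (tm T) :=
    integrable_inner_slice (r := fun _ => g) (integrable_const g) χ
  have i2 := integrable_inner_later hr χ
  have i3 : Integrable (fun t => ∫ s, inner ℂ (r s) (slice (t, s) (later χ)) ∂tm T) (tm T) :=
    i2.integral_prod_left
  have e2 : ∫ t, inner ℂ g (slice t χ) ∂tm T
      = inner ℂ g (mollStep H T h ε hh i (fourierTest H hΦ) 0) := by
    rw [← integral_inner_later H hh hε hΦ i 0 g, ← hχ]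
    refine integral_congr_ae ?_
    filter_upwards [ae_tm_pos T] with t ht
    rw [inner_slice_later, if_pos ht.1, one_mul]
  have e3 : ∫ t, ∫ s, inner ℂ (r s) (slice (t, s) (later χ)) ∂tm T ∂tm T
      = ∫ s, inner ℂ (r s) (mollStep H T h ε hh i (fourierTest H hΦ) s) ∂tm T := by
    rw [integral_integral_swap i2]
    refine integral_congr_ae (Eventually.of_forall fun s => ?_)
    simp only
    rw [← integral_inner_later H hh hε hΦ i s (r s), ← hχ]
  rw [← hχ]
  refine ⟨(i1.add i3).congr e1.symm, ?_⟩
  rw [integral_congr_ae e1, integral_add i1 i3, e2, e3]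

omit hh

theorem inner_slice_duhamel {μ : ℝ} {f : L2 n (k + 1)} (hf : PermInvariant f) (ψ : TestOn ℝ n k)
    (s : ℝ) : inner ℂ f (slice s (duhamel H T μ ψ)) = (Complex.I * μ) * ∑ i : Fin k ⊕ Fin k,
      (sgn i : ℂ) * inner ℂ f (slice s (step H T i (Fin.last k) (later ψ))) := by
  rw [duhamel, LinearMap.smul_apply, map_smul, inner_smul_right, LinearMap.sum_apply, map_sum,
    inner_sum]
  congr 1
  refine Finset.sum_congr rfl fun i _ => ?_
  rw [LinearMap.smul_apply, map_smul, inner_smul_right, LinearMap.comp_apply,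
    inner_slice_step H T hf i (adj i) (Fin.last k)]

include hh

/-- For every `ε > 0` the pairing is an expression in `mollStep`, and its limit is the one with the
exact step at the last particle. Permutation invariance of `g` and `r` then replaces this step by
the adjacent one used in `duhamel`. -/
theorem tendsto_mollifiedB (μ : ℝ) {Φ : ℝ × Conf n k → ℂ} (hc : Continuous Φ)
    (hs : HasCompactSupport Φ) {g : L2 n (k + 1)} (hg : PermInvariant g) {r : ℝ → L2 n (k + 1)}
    (hr : Integrable r (tm T)) (hrp : ∀ᵐ t ∂tm T, PermInvariant (r t)) {γ : ℝ → L2 n (k + 1)}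
    (hγ : ∀ t ∈ Icc 0 T, γ t = fromInt H (k + 1) t (g + ∫ s in (0 : ℝ)..t, r s)) :
    Tendsto (fun ε : ℝ => ∫ t in Ioo 0 T, ∫ z : Conf n k,
        Φ (t, z) * ((-Complex.I * (μ : ℂ)) * mollifiedB h ε (γ t) z)) (𝓝[>] 0)
      (𝓝 ((starRingEnd ℂ) (inner ℂ g (slice 0 (duhamel H T μ
          (fourierTest H (admissible_of_continuous hc hs))))
        + ∫ t, inner ℂ (r t) (slice t (duhamel H T μ
          (fourierTest H (admissible_of_continuous hc hs)))) ∂tm T))) := by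
  obtain ⟨ψ, hψ⟩ : ∃ ψ, ψ = fourierTest H (admissible_of_continuous hc hs) := ⟨_, rfl⟩
  have e1 : ∀ᶠ ε in 𝓝[>] (0 : ℝ), (starRingEnd ℂ) ((Complex.I * μ) * ∑ i : Fin k ⊕ Fin k, (sgn i : ℂ)
      * (inner ℂ g (mollStep H T h ε hh i ψ 0) + ∫ s, inner ℂ (r s) (mollStep H T h ε hh i ψ s) ∂tm T))
      = ∫ t in Ioo 0 T, ∫ z : Conf n k,
        Φ (t, z) * ((-Complex.I * (μ : ℂ)) * mollifiedB h ε (γ t) z) := by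
    filter_upwards [self_mem_nhdsWithin] with ε hε
    have i1 := fun i => integral_inner_fourierTest_collisionKernel H hh hε
      (admissible_of_continuous hc hs) i hr g
    rw [← integral_Icc_eq_integral_Ioo]
    have e2 : ∀ t ∈ Icc 0 T, ∫ z : Conf n k,
        Φ (t, z) * ((-Complex.I * (μ : ℂ)) * mollifiedB h ε (γ t) z)
          = (starRingEnd ℂ) ((Complex.I * μ) * ∑ i : Fin k ⊕ Fin k, (sgn i : ℂ)
            * inner ℂ (g + ∫ s in (0 : ℝ)..t, r s) (slice t (fourierTest H
              (admissible_collisionKernel hh hε (admissible_of_continuous hc hs) i)))) := by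
      intro t ht
      simp_rw [mul_left_comm (Φ _)]
      rw [integral_const_mul, hγ t ht, integral_mul_mollifiedB_fromInt H hh hε hc hs, map_mul, map_sum]
      simp only [map_mul, Complex.conj_I, Complex.conj_ofReal]
    rw [setIntegral_congr_fun measurableSet_Icc e2, integral_conj,
      integral_const_mul (μ := volume.restrict (Icc 0 T)) (L := ℂ), integral_finsetSum]
    · congr 2
      refine Finset.sum_congr rfl fun i _ => ?_
      rw [integral_const_mul (μ := volume.restrict (Icc 0 T)) (L := ℂ), hψ]
      congr 1
      exact (i1 i).2.symm
    · intro i _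
      exact (i1 i).1.const_mul _
  refine Tendsto.congr' e1 ?_
  rw [← hψ]
  have e3 : inner ℂ g (slice 0 (duhamel H T μ ψ)) + ∫ t, inner ℂ (r t) (slice t (duhamel H T μ ψ)) ∂tm T
      = (Complex.I * μ) * ∑ i : Fin k ⊕ Fin k, (sgn i : ℂ)
      * (inner ℂ g (slice 0 (step H T i (Fin.last k) (later ψ)))
        + ∫ s, inner ℂ (r s) (slice s (step H T i (Fin.last k) (later ψ))) ∂tm T) := by
    have e4 : ∫ t, inner ℂ (r t) (slice t (duhamel H T μ ψ)) ∂tm T = ∫ t, (Complex.I * μ)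
        * ∑ i : Fin k ⊕ Fin k, (sgn i : ℂ)
          * inner ℂ (r t) (slice t (step H T i (Fin.last k) (later ψ))) ∂tm T := by
      refine integral_congr_ae ?_
      filter_upwards [hrp] with t ht
      exact inner_slice_duhamel H ht ψ t
    rw [e4, inner_slice_duhamel H hg, integral_const_mul (μ := tm T) (L := ℂ), integral_finsetSum,
      ← mul_add, ← Finset.sum_add_distrib]
    · congr 1
      refine Finset.sum_congr rfl fun i _ => ?_
      rw [integral_const_mul (μ := tm T) (L := ℂ), mul_add]
    · intro i _
      exact (integrable_inner_slice hr _).const_mul _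
  rw [e3]
  refine (Complex.continuous_conj.tendsto _).comp (Tendsto.const_mul _ (tendsto_finsetSum _ fun i _ =>
    Tendsto.const_mul _ (Tendsto.add ?_ ?_)))
  · exact tendsto_const_nhds.inner (tendsto_mollStep H hh i ψ 0)
  · exact tendsto_integral_mollStep H hh i ψ hr

end

end

end GPHierarchy

namespace GPHierarchy

noncomputable section

/-! ### Solutions in the interaction picture -/

section

variable {n k : ℕ} {α : ℝ} (H : Adm n α) {T : ℝ}

theorem exists_isMollifier (n : ℕ) : ∃ h : Pt n → ℝ, IsMollifier h := by
  obtain ⟨φ⟩ : Nonempty (ContDiffBump (0 : Pt n)) := inferInstance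
  exact ⟨φ.normed volume, φ.contDiff_normed, φ.hasCompactSupport_normed, φ.integral_normed⟩

theorem denseRange_contDiff : DenseRange fun F : {F : Conf n k → ℂ // ContDiff ℝ ∞ F ∧
    HasCompactSupport F} => (F.2.1.continuous.memLp_of_hasCompactSupport (p := 2) (μ := volume)
      F.2.2).toLp F.1 := by
  refine Metric.denseRange_iff.2 fun c ε hε => ?_
  obtain ⟨g, h1, h2, h3⟩ := MemLp.exist_eLpNorm_sub_le (by norm_num) (by norm_num) (Lp.memLp c)
    (half_pos hε)
  refine ⟨⟨g, h2, h1⟩, ?_⟩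
  have hg : MemLp g 2 volume := h2.continuous.memLp_of_hasCompactSupport h1
  rw [dist_eq_norm, Lp.norm_def]
  have e : eLpNorm (c - hg.toLp g : L2 n k) 2 volume = eLpNorm ((c : Conf n k → ℂ) - g) 2 volume := by
    refine eLpNorm_congr_ae ?_
    filter_upwards [Lp.coeFn_sub c (hg.toLp g), hg.coeFn_toLp] with z e1 e2
    rw [e1, Pi.sub_apply, e2, Pi.sub_apply]
  refine lt_of_le_of_lt ?_ (half_lt_self hε)
  change (eLpNorm (c - hg.toLp g : L2 n k) 2 volume).toReal ≤ ε / 2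
  rw [e]
  exact ENNReal.toReal_le_of_le_ofReal (by positivity) h3

theorem inner_toLp_eq {F : Conf n k → ℂ} (hF : MemLp F 2 volume) (u : L2 n k) :
    inner ℂ (hF.toLp F) u = ∫ z, (starRingEnd ℂ) (F z) * u z := by
  rw [L2.inner_def]
  refine integral_congr_ae ?_
  filter_upwards [hF.coeFn_toLp] with z hz
  rw [hz, RCLike.inner_apply, mul_comm]

theorem integrable_fromInt {r : ℝ → L2 n k} (hr : Integrable r (tm T)) :
    Integrable (fun t => fromInt H k t (r t)) (tm T) := by
  refine hr.mono (aestronglyMeasurable_fromInt H hr.aestronglyMeasurable)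
    (Eventually.of_forall fun t => ?_)
  rw [fromInt_apply, LinearIsometryEquiv.norm_map]
  exact (norm_mulL2_le _ _ _).trans (by simp)

/-- Products `a(t) F(z)` suffice: for each `F` the fundamental lemma in time makes the pairing with
`F` vanish almost everywhere, density of such `F` gives that the represented function is zero, and
`fromInt` is injective. -/
theorem ae_eq_zero_of_fourierTest {d : ℝ → L2 n k} (hd : Integrable d (tm T))
    (h0 : ∀ (Φ : ℝ × Conf n k → ℂ) (hc : ContDiff ℝ ∞ Φ) (hs : HasCompactSupport Φ),
      tsupport Φ ⊆ Ioo 0 T ×ˢ univ → ∫ t, inner ℂ (d t) (slice t (fourierTest H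
        (admissible_of_continuous hc.continuous hs))) ∂tm T = 0) : d =ᵐ[tm T] 0 := by
  have hf := integrable_fromInt H hd
  have h1 : ∀ F : Conf n k → ℂ, ContDiff ℝ ∞ F → HasCompactSupport F →
      ∀ᵐ t ∂tm T, ∫ z, F z * fromInt H k t (d t) z = 0 := by
    intro F hF hFs
    have hm : MemLp F 2 volume := hF.continuous.memLp_of_hasCompactSupport hFs
    obtain ⟨y, hy⟩ : ∃ y : ℝ → ℂ, y = fun t => ∫ z, F z * fromInt H k t (d t) z := ⟨_, rfl⟩
    have hyi : Integrable y (tm T) := by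
      have e : y = fun t => inner ℂ (hm.star.toLp _) (fromInt H k t (d t)) := by
        rw [hy]
        funext t
        rw [inner_toLp_eq]
        simp
      rw [e]
      exact hf.const_inner _
    have h2 : ∀ᵐ t, t ∈ Ioo 0 T → y t = 0 := by
      refine isOpen_Ioo.ae_eq_zero_of_integral_contDiff_smul_eq_zero ?_ fun a ha has hat => ?_
      · have : IntegrableOn y (Ioo 0 T) := IntegrableOn.mono_set hyi Ioo_subset_Icc_self
        exact this.locallyIntegrableOn
      · obtain ⟨Φ, hΦ⟩ : ∃ Φ : ℝ × Conf n k → ℂ, Φ = fun p => (a p.1 : ℂ) * F p.2 := ⟨_, rfl⟩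
        have hΦc : ContDiff ℝ ∞ Φ := by
          rw [hΦ]
          exact (Complex.ofRealCLM.contDiff.comp (ha.comp contDiff_fst)).mul (hF.comp contDiff_snd)
        have hΦs : HasCompactSupport Φ := by
          refine HasCompactSupport.intro (has.isCompact.prod hFs.isCompact) fun p hp => ?_
          rw [mem_prod, not_and_or] at hp
          rw [hΦ]
          rcases hp with hp | hp
          · simp [image_eq_zero_of_notMem_tsupport hp]
          · simp [image_eq_zero_of_notMem_tsupport hp]
        have hΦt : tsupport Φ ⊆ Ioo 0 T ×ˢ univ := by
          refine Subset.trans (closure_minimal (t := tsupport a ×ˢ univ) (fun p hp => ?_)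
            ((isClosed_tsupport a).prod isClosed_univ)) (prod_mono_left hat)
          refine ⟨subset_tsupport a fun h => hp ?_, mem_univ _⟩
          rw [hΦ]
          simp [h]
        have h3 := h0 Φ hΦc hΦs hΦt
        simp_rw [inner_fourierTest] at h3
        rw [integral_conj, map_eq_zero] at h3
        rw [← setIntegral_eq_integral_of_forall_compl_eq_zero (s := Icc 0 T), ← h3]
        · refine integral_congr_ae (Eventually.of_forall fun t => ?_)
          simp only [hΦ, hy, mul_assoc]
          rw [integral_const_mul, Complex.real_smul]
        · intro t ht
          have : t ∉ tsupport a := fun h => ht (Ioo_subset_Icc_self (hat h))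
          rw [image_eq_zero_of_notMem_tsupport this, zero_smul]
    have h3 : ∀ᵐ t ∂tm T, t ∈ Ioo 0 T := by
      rw [tm, ← restrict_Ioo_eq_restrict_Icc]
      exact ae_restrict_mem measurableSet_Ioo
    filter_upwards [ae_restrict_of_ae h2, h3] with t ht ht'
    have := ht ht'
    rwa [hy] at this
  have h2 : (fun t => fromInt H k t (d t)) =ᵐ[tm T] 0 := by
    refine ae_eq_zero_of_forall_inner (𝕜 := ℂ) fun c => ?_
    obtain ⟨a, hlim⟩ := exists_seq_tendsto_of_denseRange (denseRange_contDiff (n := n) (k := k)) c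
    have h3 : ∀ᵐ t ∂tm T, ∀ j, ∫ z, (starRingEnd ℂ) ((a j).1 z) * fromInt H k t (d t) z = 0 :=
      ae_all_iff.2 fun j => h1 _ (Complex.conjCLE.contDiff.comp (a j).2.1)
        ((a j).2.2.comp_left (map_zero _))
    filter_upwards [h3] with t ht
    have h4 := hlim.inner (𝕜 := ℂ) (tendsto_const_nhds (x := fromInt H k t (d t)))
    simp_rw [inner_toLp_eq, ht] at h4
    exact tendsto_nhds_unique h4 tendsto_const_nhds
  filter_upwards [h2] with t ht
  exact fromInt_injective H t (ht.trans (map_zero _).symm)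

theorem integral_inner_fourierTest {Φ : ℝ × Conf n k → ℂ} (hΦ : Admissible Φ) (r : ℝ → L2 n k) :
    ∫ t, inner ℂ (r t) (slice t (fourierTest H hΦ)) ∂tm T
      = (starRingEnd ℂ) (∫ t in Ioo 0 T, ∫ z, Φ (t, z) * fromInt H k t (r t) z) := by
  simp_rw [inner_fourierTest]
  rw [integral_conj, ← integral_Icc_eq_integral_Ioo]
  rfl

variable {μ : ℝ}

/-- The right hand side of the equation of the interaction picture. -/
def duhamelFunctional {T : ℝ} (μ : ℝ) (g : L2 n (k + 1)) {r : ℝ → L2 n (k + 1)}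
    (hr : Integrable r (tm T)) : TestOn ℝ n k →ₗ[ℂ] ℂ where
  toFun ψ := inner ℂ g (slice 0 (duhamel H T μ ψ))
    + ∫ t, inner ℂ (r t) (slice t (duhamel H T μ ψ)) ∂tm T
  map_add' ψ φ := by
    simp only [map_add, inner_add_right]
    rw [integral_add (integrable_inner_slice hr _) (integrable_inner_slice hr _)]
    ring
  map_smul' c ψ := by
    simp only [map_smul, inner_smul_right]
    rw [integral_const_mul (μ := tm T) (L := ℂ), RingHom.id_apply, smul_eq_mul, mul_add]

theorem norm_duhamelFunctional_le (hμ : |μ| ≤ 1) (hT : 0 < T) (g : L2 n (k + 2))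
    {r : ℝ → L2 n (k + 2)} (hr : Integrable r (tm T)) (ψ : TestOn ℝ n (k + 1)) :
    ‖duhamelFunctional H μ g hr ψ‖ ≤ (√T)⁻¹ * 2 ^ (k + 1) * (expConst H * √T)
      * (‖g‖ + ∫ t, ‖r t‖ ∂tm T) * testNorm T ψ := by
  have h1 : ∀ (f : L2 n (k + 2)) (s : ℝ), ‖inner ℂ f (slice s (duhamel H T μ ψ))‖
      ≤ (√T)⁻¹ * 2 ^ (k + 1) * (expConst H * √T) * testNorm T ψ * ‖f‖ := by
    intro f s
    -- An expansion with one collision reads only the entry `k + 1` of the hierarchy, so a single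
    -- function can be completed arbitrarily and `norm_expansion_succ_le` applies with `m = 0`.
    obtain ⟨f', hf'⟩ : ∃ f' : Hierarchy n, f' (k + 1) = f :=
      ⟨Function.update 0 (k + 1) f, Function.update_self _ _ _⟩
    subst hf'
    refine (norm_expansion_succ_le hμ hT f' s 0 k ψ).trans_eq ?_
    rw [zero_add, pow_one, add_zero]
    ring
  refine (norm_add_le _ _).trans ?_
  have h2 : ‖∫ t, inner ℂ (r t) (slice t (duhamel H T μ ψ)) ∂tm T‖
      ≤ (√T)⁻¹ * 2 ^ (k + 1) * (expConst H * √T) * testNorm T ψ * ∫ t, ‖r t‖ ∂tm T := by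
    rw [← integral_const_mul]
    exact norm_integral_le_of_norm_le (hr.norm.const_mul _) (Eventually.of_forall fun t => h1 (r t) t)
  exact (add_le_add (h1 g 0) h2).trans_eq (by ring)

/-- Uniqueness of limits, for a single mollifier. -/
theorem IsCollision.eq_duhamelFunctional {γ : ℝ → L2 n (k + 1)} {g : L2 n (k + 1)}
    {r : ℝ → L2 n (k + 1)} {ρ : ℝ → L2 n k} (hr : Integrable r (tm T)) (hg : PermInvariant g)
    (hrp : ∀ᵐ t ∂tm T, PermInvariant (r t))
    (hγ : ∀ t ∈ Icc 0 T, γ t = fromInt H (k + 1) t (g + ∫ s in (0 : ℝ)..t, r s))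
    (hcoll : IsCollision μ T γ fun t => fromInt H k t (ρ t)) {Φ : ℝ × Conf n k → ℂ}
    (hc : ContDiff ℝ ∞ Φ) (hs : HasCompactSupport Φ) (ht : tsupport Φ ⊆ Ioo 0 T ×ˢ univ) :
    ∫ t, inner ℂ (ρ t) (slice t (fourierTest H (admissible_of_continuous hc.continuous hs))) ∂tm T
      = duhamelFunctional H μ g hr (fourierTest H (admissible_of_continuous hc.continuous hs)) := by
  obtain ⟨h, hh⟩ := exists_isMollifier n
  have h1 := tendsto_mollifiedB H hh μ hc.continuous hs hg hr hrp hγ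
  have h2 := tendsto_nhds_unique h1 (hcoll h hh Φ hc hs ht)
  rw [integral_inner_fourierTest, ← h2, Complex.conj_conj]
  rfl

theorem IsCollision.of_eq_duhamelFunctional {γ : ℝ → L2 n (k + 1)} {g : L2 n (k + 1)}
    {r : ℝ → L2 n (k + 1)} {ρ : ℝ → L2 n k} (hr : Integrable r (tm T)) (hg : PermInvariant g)
    (hrp : ∀ᵐ t ∂tm T, PermInvariant (r t))
    (hγ : ∀ t ∈ Icc 0 T, γ t = fromInt H (k + 1) t (g + ∫ s in (0 : ℝ)..t, r s))
    (he : ∀ ψ : TestOn ℝ n k, ∫ t, inner ℂ (ρ t) (slice t ψ) ∂tm T = duhamelFunctional H μ g hr ψ) :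
    IsCollision μ T γ fun t => fromInt H k t (ρ t) := by
  intro h hh Φ hc hs ht
  have h1 := tendsto_mollifiedB H hh μ hc.continuous hs hg hr hrp hγ
  refine h1.trans_eq ?_
  have h2 := he (fourierTest H (admissible_of_continuous hc.continuous hs))
  rw [integral_inner_fourierTest] at h2
  congr 1
  refine Eq.trans ?_ (Complex.conj_conj _)
  rw [h2]
  rfl

/-- The collision relation gives the identity only for test functions that come from smooth `Φ`, and
`ρ` is merely integrable in time. The functional on the right is bounded in `L²`, hence represented
by some `R`; such test functions suffice to show `ρ = R`, and the identity follows for all test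
functions. -/
theorem IsCollision.eq_duhamelFunctional_of_test (hμ : |μ| ≤ 1) (hT : 0 < T)
    {γ : ℝ → L2 n (k + 2)} {g : L2 n (k + 2)}
    {r : ℝ → L2 n (k + 2)} {ρ : ℝ → L2 n (k + 1)} (hr : Integrable r (tm T))
    (hρ : Integrable ρ (tm T)) (hg : PermInvariant g) (hrp : ∀ᵐ t ∂tm T, PermInvariant (r t))
    (hγ : ∀ t ∈ Icc 0 T, γ t = fromInt H (k + 2) t (g + ∫ s in (0 : ℝ)..t, r s))
    (hcoll : IsCollision μ T γ fun t => fromInt H (k + 1) t (ρ t)) (ψ : TestOn ℝ n (k + 1)) :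
    ∫ t, inner ℂ (ρ t) (slice t ψ) ∂tm T = duhamelFunctional H μ g hr ψ := by
  have hD := expConst_nonneg H
  have hI : 0 ≤ ∫ t, ‖r t‖ ∂tm T := integral_nonneg fun _ => norm_nonneg _
  obtain ⟨R, -, hR⟩ := exists_riesz T (L := duhamelFunctional H μ g hr) (by positivity)
    fun ψ => norm_duhamelFunctional_le H hμ hT g hr ψ
  have hRi := integrable_of_lp one_le_two R
  have h1 : (fun t => ρ t - R t) =ᵐ[tm T] 0 := by
    refine ae_eq_zero_of_fourierTest H (hρ.sub hRi) fun Φ hc hs ht => ?_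
    simp only [inner_sub_left]
    rw [integral_sub (integrable_inner_slice hρ _) (integrable_inner_slice hRi _), ← hR,
      hcoll.eq_duhamelFunctional H hr hg hrp hγ hc hs ht, sub_self]
  rw [hR]
  refine integral_congr_ae ?_
  filter_upwards [h1] with t ht
  rw [sub_eq_zero.1 ht]

end

end

end GPHierarchy

namespace GPHierarchy

noncomputable section

/-! ### The interaction picture of a solution -/

section

variable {n : ℕ} {α μ T : ℝ}

theorem IsSolution.restrict {T₀ : ℝ} {Γ₀ : Hierarchy n} {Γ Ξ : ℝ → Hierarchy n}
    (h : IsSolution α μ T₀ Γ₀ Γ Ξ) (hT : T ≤ T₀) : IsSolution α μ T Γ₀ Γ Ξ := by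
  have hsub : Icc 0 T ⊆ Icc 0 T₀ := Icc_subset_Icc_right hT
  have hle : volume.restrict (Icc 0 T) ≤ volume.restrict (Icc 0 T₀) :=
    Measure.restrict_mono hsub le_rfl
  refine ⟨⟨fun t ht => h.memC.mem t (hsub ht), fun k t₀ ht => ?_, ?_⟩,
    ⟨fun k => (h.memL1.measurable k).mono_measure hle, ae_mono hle h.memL1.mem, ?_⟩, ?_,
    fun k t ht => h.mild k t (hsub ht)⟩
  · exact (h.memC.continuous k t₀ (hsub ht)).mono_left (nhdsWithin_mono _ hsub)
  · exact h.memC.bounded.mono fun k => biSup_mono hsub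
  · exact h.memL1.bounded.mono fun k => lintegral_mono' hle le_rfl
  · intro k m hm Φ hc hs ht
    have hsub' : Ioo 0 T ⊆ Ioo 0 T₀ := Ioo_subset_Ioo_right hT
    have h1 := h.bHat k m hm Φ hc hs (ht.trans (prod_mono_left hsub'))
    have h2 : ∀ t ∈ Ioo 0 T₀ \ Ioo 0 T, ∀ z, Φ (t, z) = 0 := fun t ht' z =>
      image_eq_zero_of_notMem_tsupport fun h' => ht'.2 (ht h').1
    have h3 : ∀ F : ℝ → Conf n (k + 1) → ℂ, ∫ t in Ioo 0 T, ∫ z, Φ (t, z) * F t z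
        = ∫ t in Ioo 0 T₀, ∫ z, Φ (t, z) * F t z := by
      intro F
      refine (setIntegral_eq_of_subset_of_forall_sdiff_eq_zero measurableSet_Ioo hsub'
        fun t ht' => ?_).symm
      simp [h2 t ht']
    rw [h3]
    exact h1.congr fun ε => (h3 _).symm

theorem freeEvol_zero {k : ℕ} (f : L2 n k) : freeEvol 0 f = f := by
  rw [freeEvol_eq, propagator_zero, LinearIsometryEquiv.apply_symm_apply]

theorem IsSolution.apply_zero (hT : 0 ≤ T) {Γ₀ : Hierarchy n} {Γ Ξ : ℝ → Hierarchy n}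
    (h : IsSolution α μ T Γ₀ Γ Ξ) : Γ 0 = Γ₀ := by
  funext k
  rw [h.mild k 0 ⟨le_rfl, hT⟩, freeEvol_zero, intervalIntegral.integral_same, add_zero]

theorem IsSolution.memH_init (hT : 0 ≤ T) {Γ₀ : Hierarchy n} {Γ Ξ : ℝ → Hierarchy n}
    (h : IsSolution α μ T Γ₀ Γ Ξ) : MemH α Γ₀ :=
  h.apply_zero hT ▸ h.memC.mem 0 ⟨le_rfl, hT⟩

variable (H : Adm n α)

theorem MemL1.lintegral_toInt {Ξ : ℝ → Hierarchy n} (h : MemL1 α T Ξ) (k : ℕ) :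
    ∫⁻ t, ‖toInt H (k + 1) t (Ξ t k)‖ₑ ∂tm T = ∫⁻ t in Icc 0 T, sobolevNorm α (Ξ t k) := by
  refine lintegral_congr_ae ?_
  filter_upwards [h.mem] with t ht
  exact enorm_toInt H t (ht.mem k).2

theorem MemL1.integrable_toInt {Ξ : ℝ → Hierarchy n} (h : MemL1 α T Ξ) (k : ℕ) :
    Integrable (fun t => toInt H (k + 1) t (Ξ t k)) (tm T) := by
  refine ⟨aestronglyMeasurable_toInt H (h.measurable k) ?_, ?_⟩
  · filter_upwards [h.mem] with t ht
    exact (ht.mem k).2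
  · rw [HasFiniteIntegral, h.lintegral_toInt H]
    obtain ⟨l, hl, hs⟩ := h.bounded
    exact (le_of_geomSum_lt_top hl k).trans_lt (ENNReal.mul_lt_top hs (by finiteness))

theorem IsSolution.eq_fromInt (hT : 0 ≤ T) {Γ₀ : Hierarchy n} {Γ Ξ : ℝ → Hierarchy n}
    (h : IsSolution α μ T Γ₀ Γ Ξ) (k : ℕ) {t : ℝ} (ht : t ∈ Icc 0 T) :
    Γ t k = fromInt H (k + 1) t (toInt H (k + 1) 0 (Γ₀ k)
      + ∫ s in (0 : ℝ)..t, toInt H (k + 1) s (Ξ s k)) := by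
  have hi := h.memL1.integrable_toInt H k
  rw [h.mild k t ht, map_add, intervalIntegral_eq_tm _ ht, intervalIntegral_eq_tm _ ht,
    ← ContinuousLinearMap.integral_comp_comm _ (hi.indicator measurableSet_Iio)]
  congr 1
  · conv_lhs => rw [← fromInt_toInt H 0 ((h.memH_init hT).mem k).2]
    rw [freeEvol_fromInt, add_zero]
  · refine integral_congr_ae ?_
    filter_upwards [h.memL1.mem] with s hs
    by_cases hst : s ∈ Iio t
    · rw [indicator_of_mem hst, indicator_of_mem hst]
      conv_lhs => rw [← fromInt_toInt H s (hs.mem k).2]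
      rw [freeEvol_fromInt, sub_add_cancel]
    · rw [indicator_of_notMem hst, indicator_of_notMem hst, map_zero]

theorem isSymm_toInt {k : ℕ} (t : ℝ) {f : L2 n k} (hf : MemSobolev α f) :
    PermInvariant (toInt H k t f) ∧ FlipInvariant (toInt H k t f) := by
  rw [← isSymm_fromInt H t, fromInt_toInt H t hf.2]
  exact hf.1

/-- Every solution satisfies the equation to which the series argument applies. The symmetry
contained in `MemSobolev` is used for the data and for the collision terms. -/
theorem IsSolution.isInteraction (hμ : |μ| ≤ 1) (hT : 0 < T) {Γ₀ : Hierarchy n}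
    {Γ Ξ : ℝ → Hierarchy n} (h : IsSolution α μ T Γ₀ Γ Ξ) :
    IsInteraction H T μ (fun k => toInt H (k + 1) 0 (Γ₀ k))
      (fun t k => toInt H (k + 1) t (Ξ t k)) := by
  refine ⟨fun k => h.memL1.integrable_toInt H k, fun k ψ => ?_⟩
  refine IsCollision.eq_duhamelFunctional_of_test H hμ hT (h.memL1.integrable_toInt H (k + 1))
    (h.memL1.integrable_toInt H k) (isSymm_toInt H 0 ((h.memH_init hT.le).mem (k + 1))).1 ?_
    (fun t ht => h.eq_fromInt H hT.le (k + 1) ht) ?_ ψ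
  · filter_upwards [h.memL1.mem] with t ht
    exact (isSymm_toInt H t (ht.mem (k + 1))).1
  · intro m hm Φ hc hs ht
    refine (h.bHat k m hm Φ hc hs ht).trans_eq ?_
    congr 1
    refine integral_congr_ae ?_
    have h1 := h.memL1.mem
    rw [← restrict_Ioo_eq_restrict_Icc] at h1
    filter_upwards [h1] with t ht
    rw [fromInt_toInt H t (ht.mem k).2]

theorem enorm_add_integral_le {k : ℕ} (g : L2 n k) (r : ℝ → L2 n k) {t : ℝ} (ht : t ∈ Icc 0 T) :
    ‖g + ∫ s in (0 : ℝ)..t, r s‖ₑ ≤ ‖g‖ₑ + ∫⁻ s, ‖r s‖ₑ ∂tm T := by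
  refine (enorm_add_le _ _).trans (add_le_add le_rfl ?_)
  rw [intervalIntegral_eq_tm r ht]
  refine (enorm_integral_le_lintegral_enorm _).trans (lintegral_mono fun s => ?_)
  exact enorm_indicator_le_enorm_self _ _

theorem map_add_intervalIntegral {k : ℕ} (P : L2 n k →L[ℝ] L2 n k) {g : L2 n k} (hg : P g = g)
    {r : ℝ → L2 n k} (hr : Integrable r (tm T)) (hP : ∀ᵐ s ∂tm T, P (r s) = r s) {t : ℝ}
    (ht : t ∈ Icc 0 T) : P (g + ∫ s in (0 : ℝ)..t, r s) = g + ∫ s in (0 : ℝ)..t, r s := by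
  rw [map_add, hg, intervalIntegral_eq_tm r ht, ← P.integral_comp_comm (hr.indicator measurableSet_Iio)]
  congr 1
  refine integral_congr_ae ?_
  filter_upwards [hP] with s hs
  by_cases hst : s ∈ Iio t
  · rw [indicator_of_mem hst, hs]
  · rw [indicator_of_notMem hst, map_zero]

theorem star_add_L2 {k : ℕ} (f g : L2 n k) : star (f + g) = star f + star g := by
  refine Lp.ext ?_
  filter_upwards [Lp.coeFn_star (f + g), Lp.coeFn_add f g, Lp.coeFn_add (star f) (star g),
    Lp.coeFn_star f, Lp.coeFn_star g] with z h1 h2 h3 h4 h5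
  rw [h1, h3, Pi.star_apply, h2, Pi.add_apply, Pi.add_apply, h4, h5, star_add]
  rfl

/-- The Hermitian symmetry as a real linear map. -/
def flipCLM (n k : ℕ) : L2 n k →L[ℝ] L2 n k :=
  (AddMonoidHom.mk' (fun f : L2 n k => star (compL2 (flipIso n k) f)) fun f g => by
    rw [map_add, star_add_L2]).toRealLinearMap
      ((continuous_star_L2 n k).comp (compL2 (flipIso n k)).continuous)

theorem isSymm_add_integral {k : ℕ} {g : L2 n k} (hg : PermInvariant g ∧ FlipInvariant g)
    {r : ℝ → L2 n k} (hr : Integrable r (tm T))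
    (hs : ∀ᵐ s ∂tm T, PermInvariant (r s) ∧ FlipInvariant (r s)) {t : ℝ} (ht : t ∈ Icc 0 T) :
    PermInvariant (g + ∫ s in (0 : ℝ)..t, r s) ∧ FlipInvariant (g + ∫ s in (0 : ℝ)..t, r s) := by
  simp only [permInvariant_iff, flipInvariant_iff] at hg hs ⊢
  refine ⟨fun σ => ?_, ?_⟩
  · refine map_add_intervalIntegral
      ((compL2 (permIso n σ)).toContinuousLinearMap.restrictScalars ℝ) (hg.1 σ) hr ?_ ht
    filter_upwards [hs] with s hs
    exact hs.1 σ
  · refine map_add_intervalIntegral (flipCLM n k) hg.2 hr ?_ ht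
    filter_upwards [hs] with s hs
    exact hs.2

theorem continuousOn_add_integral {k : ℕ} (hT : 0 ≤ T) (g : L2 n k) {r : ℝ → L2 n k}
    (hr : Integrable r (tm T)) : ContinuousOn (fun t => g + ∫ s in (0 : ℝ)..t, r s) (Icc 0 T) := by
  refine continuousOn_const.add ?_
  have := intervalIntegral.continuousOn_primitive_interval (a := (0 : ℝ)) (b := T)
    (f := r) (μ := volume) (by rw [uIcc_of_le hT]; exact hr)
  rwa [uIcc_of_le hT] at this

theorem tendsto_sobolevNorm_fromInt {k : ℕ} {G : ℝ → L2 n k} {S : Set ℝ} {t₀ : ℝ}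
    (hG : ContinuousWithinAt G S t₀) :
    Tendsto (fun t => sobolevNorm α (fromInt H k t (G t) - fromInt H k t₀ (G t₀))) (𝓝[S] t₀) (𝓝 0) := by
  have e : ∀ t, sobolevNorm α (fromInt H k t (G t) - fromInt H k t₀ (G t₀))
      = ‖propagator n k (t - t₀) (G t) - G t₀‖ₑ := by
    intro t
    rw [← sobolevNorm_fromInt H t₀, map_sub, ← fromInt_add, sub_add_cancel]
  simp_rw [e]
  have h1 : Tendsto (fun t => (t - t₀, G t)) (𝓝[S] t₀) (𝓝 (t₀ - t₀, G t₀)) :=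
    ((tendsto_id.sub_const t₀).mono_left nhdsWithin_le_nhds).prodMk_nhds hG
  have h2 : Tendsto (fun t => propagator n k (t - t₀) (G t)) (𝓝[S] t₀) (𝓝 (G t₀)) := by
    have h3 := (continuous_propagator.tendsto (t₀ - t₀, G t₀)).comp h1
    simp only [sub_self, propagator_zero] at h3
    exact h3
  have h4 := (h2.sub_const (G t₀)).enorm
  rwa [sub_self, enorm_zero] at h4

/-- The converse passage. The symmetries and the bounds survive the time integral, and the equation
tested against `fourierTest` identifies the collision terms as `B̂ Γ` for every mollifier at once.
-/
theorem IsInteraction.isSolution (hT : 0 < T) {g : Hierarchy n} {r : ℝ → Hierarchy n}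
    (h : IsInteraction H T μ g r) (hg : GeomBounded fun k => ‖g k‖ₑ)
    (hr : GeomBounded fun k => ∫⁻ t, ‖r t k‖ₑ ∂tm T)
    (hgs : ∀ k, PermInvariant (g k) ∧ FlipInvariant (g k))
    (hrs : ∀ᵐ t ∂tm T, ∀ k, PermInvariant (r t k) ∧ FlipInvariant (r t k)) :
    IsSolution α μ T (fun k => fromInt H (k + 1) 0 (g k))
      (fun t k => fromInt H (k + 1) t (g k + ∫ s in (0 : ℝ)..t, r s k))
      (fun t k => fromInt H (k + 1) t (r t k)) := by
  have hgr := hg.add hr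
  have hrs' : ∀ k, ∀ᵐ t ∂tm T, PermInvariant (r t k) ∧ FlipInvariant (r t k) :=
    fun k => hrs.mono fun t ht => ht k
  refine ⟨⟨fun t ht => ⟨fun k => ⟨?_, ?_⟩, ?_⟩, fun k t₀ ht₀ => ?_, ?_⟩, ⟨fun k => ?_, ?_, ?_⟩,
    fun k => ?_, fun k t ht => ?_⟩
  · exact (isSymm_fromInt H t).2 (isSymm_add_integral (hgs k) (h.integrable k) (hrs' k) ht)
  · rw [sobolevNorm_fromInt]
    exact enorm_lt_top
  · refine hgr.mono fun k => ?_
    rw [sobolevNorm_fromInt]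
    exact enorm_add_integral_le _ _ ht
  · refine tendsto_sobolevNorm_fromInt H ((continuousOn_add_integral hT.le (g k) (h.integrable k)) t₀ ht₀)
  · refine hgr.mono fun k => iSup₂_le fun t ht => ?_
    rw [sobolevNorm_fromInt]
    exact enorm_add_integral_le _ _ ht
  · exact aestronglyMeasurable_fromInt H (h.integrable k).aestronglyMeasurable
  -- Membership in `𝓗^α` for almost every `t` follows by Tonelli: the time integral of the geometric
  -- sums is the geometric sum of the time integrals, which is finite.
  · obtain ⟨l, hl, hs⟩ := hr
    have h1 : ∫⁻ t, geomSum (fun k => ‖r t k‖ₑ) l ∂tm T < ⊤ := by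
      refine lt_of_eq_of_lt ?_ hs
      simp only [geomSum, div_eq_mul_inv]
      rw [lintegral_tsum fun k => ((h.integrable k).aestronglyMeasurable.enorm).mul_const _]
      refine tsum_congr fun k => ?_
      rw [lintegral_mul_const'' _ (h.integrable k).aestronglyMeasurable.enorm]
    have h2 : ∀ᵐ t ∂tm T, geomSum (fun k => ‖r t k‖ₑ) l < ⊤ := by
      refine ae_lt_top' ?_ h1.ne
      simp only [geomSum, div_eq_mul_inv]
      exact AEMeasurable.tsum fun k =>
        ((h.integrable k).aestronglyMeasurable.enorm).mul_const _
    filter_upwards [hrs, h2] with t ht ht2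
    refine ⟨fun k => ⟨(isSymm_fromInt H t).2 (ht k), ?_⟩, ⟨l, hl, ?_⟩⟩
    · rw [sobolevNorm_fromInt]
      exact enorm_lt_top
    · simp_rw [sobolevNorm_fromInt]
      exact ht2
  · simp_rw [sobolevNorm_fromInt]
    exact hr
  · refine IsCollision.of_eq_duhamelFunctional H (h.integrable (k + 1)) (hgs (k + 1)).1
      ((hrs' (k + 1)).mono fun t ht => ht.1) (fun t ht => rfl) fun ψ => ?_
    exact h.eq k ψ
  · rw [map_add, freeEvol_fromInt, add_zero, intervalIntegral_eq_tm _ ht, intervalIntegral_eq_tm _ ht,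
      ← ContinuousLinearMap.integral_comp_comm _ ((h.integrable k).indicator measurableSet_Iio)]
    congr 1
    refine integral_congr_ae (Eventually.of_forall fun s => ?_)
    simp only
    by_cases hst : s ∈ Iio t
    · rw [indicator_of_mem hst, indicator_of_mem hst, freeEvol_fromInt, sub_add_cancel]
    · rw [indicator_of_notMem hst, indicator_of_notMem hst, map_zero]

end

end

end GPHierarchy

namespace GPHierarchy

noncomputable section

/-! ### Existence, a priori bound and stability -/

section

variable {n : ℕ} {α μ T : ℝ} (H : Adm n α)

/-- The series argument needs one rate for `g` and `r`. The larger of two rates close to their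
infima serves both, and either one keeps `D √T l` at most `1/2`. -/
theorem IsInteraction.lintegral_le_majorant (hμ : |μ| ≤ 1) (hT : 0 < T) {g : Hierarchy n}
    {r : ℝ → Hierarchy n} (h : IsInteraction H T μ g r) (hg : GeomBounded fun k => ‖g k‖ₑ)
    (hr : GeomBounded fun k => ∫⁻ t, ‖r t k‖ₑ ∂tm T)
    (hgT : expConst H * √T * (2 * quasiNorm fun k => ‖g k‖ₑ) ≤ 1 / 3)
    (hrT : expConst H * √T * (2 * quasiNorm fun k => ∫⁻ t, ‖r t k‖ₑ ∂tm T) ≤ 1 / 3) (k : ℕ) :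
    ∫⁻ t, ‖r t k‖ₑ ∂tm T ≤ majorant H T (fun j => ‖g j‖ₑ) k := by
  have hD : 0 ≤ expConst H * √T := mul_nonneg (expConst_nonneg H) (Real.sqrt_nonneg _)
  obtain ⟨L, hL, hXL⟩ := exists_rate_bound hD hgT
  obtain ⟨l, hl, h1, h2⟩ := exists_rate hg hL
  obtain ⟨L', hL', hXL'⟩ := exists_rate_bound hD hrT
  obtain ⟨l', hl', h1', h2'⟩ := exists_rate hr hL'
  refine h.lintegral_le hμ hT (lt_max_of_lt_left hl : 0 < max l l') ?_
    (((geomSum_antitone hl (le_max_left _ _)).trans h1).trans_lt ENNReal.one_lt_top)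
    (((geomSum_antitone hl' (le_max_right _ _)).trans h1').trans_lt ENNReal.one_lt_top) k
  rcases le_total l l' with hll | hll
  · rw [max_eq_right hll]
    linarith [mul_le_mul_of_nonneg_left h2'.le hD]
  · rw [max_eq_left hll]
    linarith [mul_le_mul_of_nonneg_left h2.le hD]

theorem MemH.sobolevNorm_eq {Γ₀ : Hierarchy n} (h : MemH α Γ₀) :
    (fun k => sobolevNorm α (Γ₀ k)) = fun k => ‖toInt H (k + 1) 0 (Γ₀ k)‖ₑ :=
  funext fun k => (enorm_toInt H 0 (h.mem k).2).symm

theorem exists_isSolution (hμ : |μ| ≤ 1) (hT : 0 < T) {Γ₀ : Hierarchy n} (h : MemH α Γ₀)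
    (hb : expConst H * √T * (2 * hNorm α Γ₀) ≤ 1 / 3) :
    ∃ Γ Ξ : ℝ → Hierarchy n, IsSolution α μ T Γ₀ Γ Ξ ∧ Γ 0 = Γ₀ ∧
      l1Norm α T Ξ ≤ 12 * hNorm α Γ₀ := by
  obtain ⟨g, hg⟩ : ∃ g : Hierarchy n, g = fun k => toInt H (k + 1) 0 (Γ₀ k) := ⟨_, rfl⟩
  have e : (fun k => sobolevNorm α (Γ₀ k)) = fun k => ‖g k‖ₑ := hg ▸ h.sobolevNorm_eq H
  have e0 : (fun k => fromInt H (k + 1) 0 (g k)) = Γ₀ := by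
    rw [hg]
    exact funext fun k => fromInt_toInt H 0 (h.mem k).2
  have hgb : GeomBounded fun k => ‖g k‖ₑ := e ▸ h.bounded
  rw [hNorm, e] at hb ⊢
  have hD : 0 ≤ expConst H * √T := mul_nonneg (expConst_nonneg H) (Real.sqrt_nonneg _)
  obtain ⟨L, hL, hXL⟩ := exists_rate_bound hD hb
  obtain ⟨l, hl, h1, h2⟩ := exists_rate hgb hL
  obtain ⟨r, hr, -, hrb, hrs⟩ := exists_isInteraction (H := H) hμ hT hl
    (by linarith [mul_le_mul_of_nonneg_left h2.le hD]) (h1.trans_lt ENNReal.one_lt_top)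
  have hgs : ∀ k, PermInvariant (g k) ∧ FlipInvariant (g k) := by
    rw [hg]
    exact fun k => isSymm_toInt H 0 (h.mem k)
  have hs := hr.isSolution H hT hgb (GeomBounded.of_le_majorant H hgb hb hrb) hgs
    (hrs (fun k => (hgs k).1) fun k => (hgs k).2)
  rw [e0] at hs
  refine ⟨_, _, hs, hs.apply_zero hT.le, ?_⟩
  rw [l1Norm]
  simp_rw [sobolevNorm_fromInt]
  exact quasiNorm_le_of_le_majorant H hgb hb hrb

include H in
theorem IsSolution.l1Norm_le (hμ : |μ| ≤ 1) (hT : 0 < T) {Γ₀ : Hierarchy n}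
    {Γ Ξ : ℝ → Hierarchy n} (h : IsSolution α μ T Γ₀ Γ Ξ)
    (hb : expConst H * √T * (2 * hNorm α Γ₀) ≤ 1 / 3)
    (hb' : expConst H * √T * (2 * l1Norm α T Ξ) ≤ 1 / 3) : l1Norm α T Ξ ≤ 12 * hNorm α Γ₀ := by
  have h0 := h.memH_init hT.le
  have e := h0.sobolevNorm_eq H
  have e' : (fun k => ∫⁻ t in Icc 0 T, sobolevNorm α (Ξ t k))
      = fun k => ∫⁻ t, ‖toInt H (k + 1) t (Ξ t k)‖ₑ ∂tm T :=
    funext fun k => (h.memL1.lintegral_toInt H k).symm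
  have hg := h0.bounded
  have hr := h.memL1.bounded
  rw [hNorm, e] at hb ⊢
  rw [l1Norm, e'] at hb' ⊢
  rw [e] at hg
  rw [e'] at hr
  exact quasiNorm_le_of_le_majorant H hg hb
    ((h.isInteraction H hμ hT).lintegral_le_majorant H hμ hT hg hr hb hb')

include H in
theorem sobolevNorm_sub_le {k : ℕ} {f f' : L2 n k} (hf : sobolevNorm α f < ⊤)
    (hf' : sobolevNorm α f' < ⊤) :
    sobolevNorm α (f - f') ≤ sobolevNorm α f + sobolevNorm α f' := by
  rw [← enorm_toInt H 0 hf, ← enorm_toInt H 0 hf', ← fromInt_toInt H 0 hf, ← fromInt_toInt H 0 hf',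
    ← map_sub, sobolevNorm_fromInt, toInt_fromInt, toInt_fromInt]
  exact enorm_sub_le

include H in
theorem MemL1.bounded_sub {Ξ Ξ' : ℝ → Hierarchy n} (h : MemL1 α T Ξ) (h' : MemL1 α T Ξ') :
    GeomBounded fun k => ∫⁻ t in Icc 0 T, sobolevNorm α ((Ξ - Ξ') t k) := by
  refine (h.bounded.add h'.bounded).mono fun k => ?_
  rw [← h.lintegral_toInt H k, ← h'.lintegral_toInt H k,
    ← lintegral_add_left' (h.integrable_toInt H k).aestronglyMeasurable.enorm]
  refine lintegral_mono_ae ?_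
  filter_upwards [h.mem, h'.mem] with t ht ht'
  rw [enorm_toInt H t (ht.mem k).2, enorm_toInt H t (ht'.mem k).2]
  exact sobolevNorm_sub_le H (ht.mem k).2 (ht'.mem k).2

include H in
theorem MemH.bounded_sub {Γ₀ Γ₀' : Hierarchy n} (h : MemH α Γ₀) (h' : MemH α Γ₀') :
    GeomBounded fun k => sobolevNorm α ((Γ₀ - Γ₀') k) :=
  (h.bounded.add h'.bounded).mono fun k => sobolevNorm_sub_le H (h.mem k).2 (h'.mem k).2

include H in
-- By linearity the difference solves the interaction equation with data `g`. Its collision terms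
-- are bounded by the majorant, and at each time the difference itself is `g` plus a time integral
-- of them; hence the factor `13`.
theorem IsSolution.cNorm_sub_le (hμ : |μ| ≤ 1) (hT : 0 < T) {Γ₀ Γ₀' : Hierarchy n}
    {Γ Ξ Γ' Ξ' : ℝ → Hierarchy n} (h : IsSolution α μ T Γ₀ Γ Ξ) (h' : IsSolution α μ T Γ₀' Γ' Ξ')
    (hb : expConst H * √T * (2 * hNorm α (Γ₀ - Γ₀')) ≤ 1 / 3)
    (hb' : expConst H * √T * (2 * l1Norm α T (Ξ - Ξ')) ≤ 1 / 3) :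
    cNorm α T (Γ - Γ') ≤ 13 * hNorm α (Γ₀ - Γ₀') := by
  have h0 := h.memH_init hT.le
  have h0' := h'.memH_init hT.le
  have hI := (h.isInteraction H hμ hT).sub (h'.isInteraction H hμ hT)
  obtain ⟨g, hg⟩ : ∃ g : Hierarchy n, g = (fun k => toInt H (k + 1) 0 (Γ₀ k))
    - fun k => toInt H (k + 1) 0 (Γ₀' k) := ⟨_, rfl⟩
  obtain ⟨r, hr⟩ : ∃ r : ℝ → Hierarchy n, r = (fun t k => toInt H (k + 1) t (Ξ t k))
    - fun t k => toInt H (k + 1) t (Ξ' t k) := ⟨_, rfl⟩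
  rw [← hg, ← hr] at hI
  have e : (fun k => sobolevNorm α ((Γ₀ - Γ₀') k)) = fun k => ‖g k‖ₑ := by
    funext k
    rw [hg, Pi.sub_apply, Pi.sub_apply, ← toInt_sub H 0 (h0.mem k).2 (h0'.mem k).2,
      ← sobolevNorm_fromInt H 0, map_toInt_sub H 0 (h0.mem k).2 (h0'.mem k).2]
  have e' : (fun k => ∫⁻ t in Icc 0 T, sobolevNorm α ((Ξ - Ξ') t k))
      = fun k => ∫⁻ t, ‖r t k‖ₑ ∂tm T := by
    funext k
    refine lintegral_congr_ae ?_
    filter_upwards [h.memL1.mem, h'.memL1.mem] with t ht ht'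
    rw [hr, Pi.sub_apply, Pi.sub_apply, Pi.sub_apply, Pi.sub_apply,
      ← toInt_sub H t (ht.mem k).2 (ht'.mem k).2, ← sobolevNorm_fromInt H t,
      map_toInt_sub H t (ht.mem k).2 (ht'.mem k).2]
  have hgb := h0.bounded_sub H h0'
  have hrb := h.memL1.bounded_sub H h'.memL1
  rw [hNorm, e] at hb ⊢
  rw [l1Norm, e'] at hb'
  rw [e] at hgb
  rw [e'] at hrb
  refine quasiNorm_le_of_le_add_majorant H hgb hb fun k => iSup₂_le fun t ht => ?_
  have e2 : (Γ - Γ') t k = fromInt H (k + 1) t (g k + ∫ s in (0 : ℝ)..t, r s k) := by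
    have i1 : IntervalIntegrable (fun s => toInt H (k + 1) s (Ξ s k)) volume 0 t :=
      (intervalIntegrable_iff_integrableOn_Icc_of_le ht.1).2 ((h.memL1.integrable_toInt H k).mono_measure
        (Measure.restrict_mono (Icc_subset_Icc_right ht.2) le_rfl))
    have i2 : IntervalIntegrable (fun s => toInt H (k + 1) s (Ξ' s k)) volume 0 t :=
      (intervalIntegrable_iff_integrableOn_Icc_of_le ht.1).2 ((h'.memL1.integrable_toInt H k).mono_measure
        (Measure.restrict_mono (Icc_subset_Icc_right ht.2) le_rfl))
    have e3 : ∫ s in (0 : ℝ)..t, r s k = (∫ s in (0 : ℝ)..t, toInt H (k + 1) s (Ξ s k))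
        - ∫ s in (0 : ℝ)..t, toInt H (k + 1) s (Ξ' s k) := by
      rw [hr]
      exact intervalIntegral.integral_sub i1 i2
    rw [Pi.sub_apply, Pi.sub_apply, h.eq_fromInt H hT.le k ht, h'.eq_fromInt H hT.le k ht, ← map_sub, e3, hg,
      Pi.sub_apply, add_sub_add_comm]
  rw [e2, sobolevNorm_fromInt]
  refine (enorm_add_integral_le _ _ ht).trans (add_le_add le_rfl ?_)
  exact hI.lintegral_le_majorant H hμ hT hgb hrb hb hb' k

/-- The square root of the condition on `T`, with the `3` of `A = 3` turning into the bound `1 / 3`.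
-/
theorem rate_le_of_sq_le {D N T : ℝ} (hD : 0 ≤ D) (hN : 0 ≤ N) (hT : 0 < T)
    (h : 4 * (D ^ 2 + 1) * 3 ^ 2 * N ^ 2 * T ≤ 1) : D * √T * (2 * N) ≤ 1 / 3 := by
  have h1 : (D * √T * (2 * N)) ^ 2 ≤ (1 / 3) ^ 2 := by
    rw [mul_pow, mul_pow, Real.sq_sqrt hT.le]
    nlinarith [mul_nonneg (sq_nonneg N) hT.le]
  exact (sq_le_sq₀ (by positivity) (by norm_num)).1 h1

end

end

end GPHierarchy

/-! ### Choice of the constants -/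

theorem theorem2p2 :
    ∃ A : ℝ, 2 < A ∧ ∀ n : ℕ, 2 ≤ n → ∀ α : ℝ, ((n : ℝ) - 1) / 2 < α →
      ∃ C : ℝ, 0 < C ∧ ∀ μ : ℝ, (μ = 1 ∨ μ = -1) →
        -- (1) existence
        (∀ Γ₀ : GPHierarchy.Hierarchy n, GPHierarchy.MemH α Γ₀ →
          ∀ T : ℝ, 0 < T → 4 * C * A ^ 2 * GPHierarchy.hNorm α Γ₀ ^ 2 * T ≤ 1 →
            ∃ Γ Ξ : ℝ → GPHierarchy.Hierarchy n,
              GPHierarchy.IsSolution α μ T Γ₀ Γ Ξ ∧ Γ 0 = Γ₀ ∧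
              GPHierarchy.l1Norm α T Ξ ≤ 4 * A * GPHierarchy.hNorm α Γ₀) ∧
        -- (2) a priori bound
        (∀ T₀ : ℝ, 0 < T₀ → ∀ (Γ₀ : GPHierarchy.Hierarchy n) (Γ Ξ : ℝ → GPHierarchy.Hierarchy n),
          GPHierarchy.IsSolution α μ T₀ Γ₀ Γ Ξ →
          ∀ T : ℝ, 0 < T → T ≤ T₀ →
            4 * C * A ^ 2 *
              max (GPHierarchy.l1Norm α T₀ Ξ ^ 2) (GPHierarchy.hNorm α Γ₀ ^ 2) * T ≤ 1 →
            GPHierarchy.l1Norm α T Ξ ≤ 4 * A * GPHierarchy.hNorm α Γ₀) ∧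
        -- (3) stability
        (∀ T₀ : ℝ, 0 < T₀ → ∀ (Γ₀ Γ₀' : GPHierarchy.Hierarchy n)
          (Γ Ξ Γ' Ξ' : ℝ → GPHierarchy.Hierarchy n),
          GPHierarchy.IsSolution α μ T₀ Γ₀ Γ Ξ → GPHierarchy.IsSolution α μ T₀ Γ₀' Γ' Ξ' →
          ∀ T : ℝ, 0 < T → T ≤ T₀ →
            4 * C * A ^ 2 *
              max (GPHierarchy.l1Norm α T₀ (Ξ - Ξ') ^ 2)
                (GPHierarchy.hNorm α (Γ₀ - Γ₀') ^ 2) * T ≤ 1 →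
            GPHierarchy.cNorm α T (Γ - Γ') ≤
              (1 + 4 * A) * GPHierarchy.hNorm α (Γ₀ - Γ₀')) := by
  -- With `A = 3` one has `4 A = 12` and `1 + 4 A = 13`, the factors lost in the two comparisons
  -- with the majorant, and `1 / A` is the smallness required of the rates.
  refine ⟨3, by norm_num, fun n hn α hα => ?_⟩
  have H : GPHierarchy.Adm n α := ⟨hn, hα⟩
  have hD := GPHierarchy.expConst_nonneg H
  -- The summand `1` makes `C` positive without any lower bound on `expConst H`.
  refine ⟨GPHierarchy.expConst H ^ 2 + 1, by positivity, fun μ hμ => ?_⟩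
  have hμ1 : |μ| ≤ 1 := by
    rcases hμ with rfl | rfl <;> simp
  have hmax : ∀ {a b T : ℝ}, 0 < T →
      4 * (GPHierarchy.expConst H ^ 2 + 1) * 3 ^ 2 * max (a ^ 2) (b ^ 2) * T ≤ 1 →
      4 * (GPHierarchy.expConst H ^ 2 + 1) * 3 ^ 2 * a ^ 2 * T ≤ 1 ∧
        4 * (GPHierarchy.expConst H ^ 2 + 1) * 3 ^ 2 * b ^ 2 * T ≤ 1 := by
    intro a b T hT h
    refine ⟨le_trans ?_ h, le_trans ?_ h⟩
    · gcongr
      exact le_max_left _ _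
    · gcongr
      exact le_max_right _ _
  have hres : ∀ {T T₀ : ℝ} {Ξ : ℝ → GPHierarchy.Hierarchy n}, T ≤ T₀ →
      GPHierarchy.GeomBounded (fun k => ∫⁻ t in Set.Icc 0 T₀, GPHierarchy.sobolevNorm α (Ξ t k)) →
      GPHierarchy.l1Norm α T Ξ ≤ GPHierarchy.l1Norm α T₀ Ξ := by
    intro T T₀ Ξ hT h
    exact GPHierarchy.quasiNorm_mono (fun k => lintegral_mono'
      (Measure.restrict_mono (Set.Icc_subset_Icc_right hT) le_rfl) le_rfl) h
  refine ⟨fun Γ₀ hΓ₀ T hT hC => ?_, fun T₀ hT₀ Γ₀ Γ Ξ h T hT hTT hC => ?_,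
    fun T₀ hT₀ Γ₀ Γ₀' Γ Ξ Γ' Ξ' h h' T hT hTT hC => ?_⟩
  · obtain ⟨Γ, Ξ, h1, h2, h3⟩ := GPHierarchy.exists_isSolution H hμ1 hT hΓ₀
      (GPHierarchy.rate_le_of_sq_le hD (GPHierarchy.quasiNorm_nonneg _) hT hC)
    exact ⟨Γ, Ξ, h1, h2, h3.trans_eq (by norm_num)⟩
  · obtain ⟨hC1, hC2⟩ := hmax hT hC
    refine ((h.restrict hTT).l1Norm_le H hμ1 hT
      (GPHierarchy.rate_le_of_sq_le hD (GPHierarchy.quasiNorm_nonneg _) hT hC2) ?_).trans_eq (by norm_num)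
    refine le_trans ?_ (GPHierarchy.rate_le_of_sq_le hD (GPHierarchy.quasiNorm_nonneg _) hT hC1)
    gcongr
    exact hres hTT h.memL1.bounded
  · obtain ⟨hC1, hC2⟩ := hmax hT hC
    refine ((h.restrict hTT).cNorm_sub_le H hμ1 hT (h'.restrict hTT)
      (GPHierarchy.rate_le_of_sq_le hD (GPHierarchy.quasiNorm_nonneg _) hT hC2) ?_).trans_eq (by norm_num)
    refine le_trans ?_ (GPHierarchy.rate_le_of_sq_le hD (GPHierarchy.quasiNorm_nonneg _) hT hC1)
    gcongr
    exact hres hTT (h.memL1.bounded_sub H h'.memL1)
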